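/- Let $n,m\in\mathbb N$ and $T>0$. For $A\subseteq\{1,\dots,m\}$, $I\subseteq\{1,\dots,n\}$ with $1\le |A|=|I|$, and for $1\le i\le n$, $1\le\alpha\le m$, let $\tau$, $v_i$, $d_\alpha$, $m_{A,I}$ be real functions of $(t,x)\in[0,T]\times\mathbb R^n$, continuously differentiable up to the boundary. Write $m_{\emptyset,\emptyset}=\tau$, $m_{\alpha i}=m_{\{\alpha\},\{i\}}$, and let $O_A(\alpha)$ be the number such that $\alpha$ is the $O_A(\alpha)$-th smallest element of $A\cup\{\alpha\}$ (similarly $O_I(i)$). Repeated indices $i,j,k\in\{1,\dots,n\}$, $\alpha,\beta\in\{1,\dots,m\}$ are summed; sums $\sum_{A,I}$ run over $1\le|A|=|I|$ unless otherwise indicated. Suppose that on $[0,T]\times\mathbb R^n$ $$\partial_t\tau+v_j\partial_j\tau-\tau\partial_jv_j=0,$$ $$\partial_td_\alpha+v_i\partial_id_\alpha+\sum_{A\ni\alpha,\,I\ni i}(-1)^{O_A(\alpha)+O_I(i)}m_{A\setminus\{\alpha\},I\setminus\{i\}}\,\partial_im_{A,I}=0,$$ $$\partial_tv_i+\sum_{A,I,j:\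 j\in I,\,i\notin I\setminus\{j\}}(-1)^{O_I(j)+O_{I\setminus\{j\}}(i)}m_{A,(I\setminus\{j\})\cup\{i\}}\,\partial_jm_{A,I}-\sum_{A,I}m_{A,I}\partial_im_{A,I}+v_j\partial_jv_i-\tau\partial_i\tau=0,$$ $$\partial_tm_{A,I}+v_j\partial_jm_{A,I}+\sum_{i\in I,\,j\notin I\setminus\{i\}}(-1)^{O_{I\setminus\{i\}}(j)+O_I(i)}m_{A,(I\setminus\{i\})\cup\{j\}}\,\partial_iv_j-m_{A,I}\partial_jv_j+\sum_{\alpha\in A,\,i\in I}(-1)^{O_A(\alpha)+O_I(i)}m_{A\setminus\{\alpha\},I\setminus\{i\}}\,\partial_id_\alpha=0.$$ Put $$\lambda=\tfrac12\Big(\tau^2+\sum_iv_i^2+\sum_\alpha d_\alpha^2+\sum_{A,I}m_{A,I}^2-1\Big),\qquad \omega_i=\tau v_i-m_{\alpha i}d_\alpha,$$ $$\varphi^\alpha_{A,I}=\sum_{i\in I}(-1)^{O_A(\alpha)+O_I(i)}m_{A,I\setminus\{i\}}m_{\alpha i}-\mathbf 1_{\{\alpha\notin A\}}\,\tau\, m_{A\cup\{\alpha\},I}\qquad(|I|=|A|+1),$$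 $$\psi^i_{A,I}=\sum_{\alpha\in A}(-1)^{O_A(\alpha)+O_I(i)}m_{A\setminus\{\alpha\},I}m_{\alpha i}-\mathbf 1_{\{i\notin I\}}\,\tau\, m_{A,I\cup\{i\}}\qquad(|A|=|I|+1).$$ **(a)** On $[0,T]\times\mathbb R^n$, for all $i$, $\alpha$ and all admissible $A,I$ (the equation for $\lambda$ being asserted at the points where $\tau\ne0$): $$\partial_t\omega_i=\omega_i\partial_jv_j-\omega_j\partial_iv_j-v_j\partial_j\omega_i+\tau\partial_i\lambda+\sum_{A,I,\,j\in I}(-1)^{O_I(j)+O_{I\setminus\{j\}}(i)}\,\partial_jm_{A,I}\,\psi^i_{A,I\setminus\{j\}},$$ $$\partial_t\lambda=-v_j\partial_j\lambda+\tau\partial_i\omega_i+\sum_{\substack{A,I,\ i,j\in I\\ 2\le|I|=|A|+1}}(-1)^{O_I(i)+O_I(j)}m_{A,I\setminus\{j\}}\,\partial_j\Big(\frac{m_{A,I\setminus\{i\}}\,\omega_i}{\tau}\Big)+\sum_{\substack{A,I,\alpha,\ i\in I\\ 2\le|I|=|A|+1}}(-1)^{O_A(\alpha)+O_I(i)}m_{A,I\setminus\{i\}}\,\partial_i\Big(\frac{\varphi^\alpha_{A,I}\,d_\alpha}{\tau}\Big),$$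 $$\partial_t\varphi^\alpha_{A,I}=2\varphi^\alpha_{A,I}\partial_jv_j-v_j\partial_j\varphi^\alpha_{A,I}-\sum_{j\in I,\,k\notin I\setminus\{j\}}(-1)^{O_{I\setminus\{j\}}(k)+O_I(j)}\varphi^\alpha_{A,(I\setminus\{j\})\cup\{k\}}\partial_jv_k+\sum_{\beta\in A,\,j\in I}(-1)^{O_A(\alpha)+O_A(\beta)+O_{A\setminus\{\beta\}}(\alpha)+O_I(j)}\varphi^\alpha_{A\setminus\{\beta\},I\setminus\{j\}}\partial_jd_\beta,$$ $$\begin{aligned}\partial_t\psi^i_{A,I}={}&2\psi^i_{A,I}\partial_jv_j-v_j\partial_j\psi^i_{A,I}-\sum_k(-1)^{O_I(i)+O_I(k)}\psi^k_{A,I}\partial_iv_k\\&+\sum_{\beta\in A,\,j\in I}(-1)^{O_A(\beta)+O_I(j)+O_I(i)+O_{I\setminus\{j\}}(i)}\psi^i_{A\setminus\{\beta\},I\setminus\{j\}}\partial_jd_\beta\\&-\sum_{j\in I,\,k\notin I\setminus\{j\}}(-1)^{O_I(i)+O_I(j)+O_{I\setminus\{j\}}(k)+O_{(I\setminus\{j\})\cup\{k\}}(i)}\psi^i_{A,(I\setminus\{j\})\cup\{k\}}\partial_jv_k.\end{aligned}$$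 **(b)** Suppose in addition that $\tau,v_i,d_\alpha,m_{A,I}$ are bounded on $[0,T]\times\mathbb R^n$. If at $t=0$, for every $x\in\mathbb R^n$, one has $\tau\ne0$ and $$\tau v_i=m_{\alpha i}d_\alpha,\qquad \tau^2+\sum_iv_i^2+\sum_\alpha d_\alpha^2+\sum_{A,I}m_{A,I}^2=1,\qquad m_{A,I}=\tau\,[F]_{A,I}\quad\text{with }F_{\alpha i}=\tau^{-1}m_{\alpha i},$$ where $[F]_{A,I}$ is the minor of $F$ with rows $A$ and columns $I$, then $\tau\neq0$ and these constraints hold at every $(t,x)\in[0,T]\times\mathbb R^n$. -/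

import Mathlib

namespace ExtremalSurface

/-- The space `ℝⁿ`. -/
abbrev Space (n : ℕ) := EuclideanSpace ℝ (Fin n)

/-- Real functions of time and space. -/
abbrev Field (n : ℕ) := ℝ → Space n → ℝ

/-- `∂_t f`, for functions on `[0,T] × ℝⁿ` (one-sided at the two end points). -/
noncomputable def dt {n : ℕ} (T : ℝ) (f : Field n) : Field n :=
  fun t x => derivWithin (fun s => f s x) (Set.Icc 0 T) t

/-- `∂_j f`. -/
noncomputable def dx {n : ℕ} (j : Fin n) (f : Field n) : Field n :=
  fun t x => fderiv ℝ (f t) x (EuclideanSpace.single j 1)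

/-- `f` is continuously differentiable on `[0,T] × ℝⁿ`, up to the boundary. -/
def IsC1 {n : ℕ} (T : ℝ) (f : Field n) : Prop :=
  ContDiffOn ℝ 1 (fun p : ℝ × Space n => f p.1 p.2) (Set.Icc 0 T ×ˢ Set.univ)

/-- `O_A(a)`: the element `a` is the `O_A(a)`-th smallest element of `A ∪ {a}`. -/
def ord {k : ℕ} (A : Finset (Fin k)) (a : Fin k) : ℕ :=
  (A.filter (fun b => b < a)).card + 1

/-- The pairs `(A, I)`, `A ⊆ {1,…,m}`, `I ⊆ {1,…,n}`, with `1 ≤ |A| = |I|`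
(hence `|A| ≤ min m n`). -/
def minorPairs (n m : ℕ) : Finset (Finset (Fin m) × Finset (Fin n)) :=
  Finset.univ.filter (fun p => p.1.Nonempty ∧ p.1.card = p.2.card)

/-- The pairs `(A, I)` with `2 ≤ |I| = |A| + 1`. -/
def bigPairs (n m : ℕ) : Finset (Finset (Fin m) × Finset (Fin n)) :=
  Finset.univ.filter (fun p => 2 ≤ p.2.card ∧ p.2.card = p.1.card + 1)

/-- The minor `[F]_{A,I}`: rows in `A` and columns in `I`, both in increasing order. -/
noncomputable def matrixMinor {n m : ℕ} (F : Matrix (Fin m) (Fin n) ℝ)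
    (A : Finset (Fin m)) (I : Finset (Fin n)) (h : A.card = I.card) : ℝ :=
  (F.submatrix (A.orderEmbOfFin rfl) (I.orderEmbOfFin h.symm)).det

/-- The unknowns `(τ, v_i, d_α, m_{A,I})`. Only the entries `μ A I` with `(A, I)` in
`minorPairs n m` are unknowns of the system; all other entries of `μ` are ignored. -/
structure State (n m : ℕ) where
  τ : Field n
  v : Fin n → Field n
  d : Fin m → Field n
  μ : Finset (Fin m) → Finset (Fin n) → Field n

namespace State

variable {n m : ℕ} (W : State n m)

/-- `m_{A,I}`, with the convention `m_{∅,∅} = τ`. -/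
def mm (A : Finset (Fin m)) (I : Finset (Fin n)) : Field n :=
  if A = ∅ ∧ I = ∅ then W.τ else W.μ A I

/-- The entry `m_{α i} = m_{{α},{i}}`. -/
def entry (α : Fin m) (i : Fin n) : Field n := W.mm {α} {i}

/-- `W` is a classical (continuously differentiable) solution of the non-conservative system
on `[0,T] × ℝⁿ`. -/
structure IsSolution (T : ℝ) : Prop where
  c1_τ : IsC1 T W.τ
  c1_v : ∀ i, IsC1 T (W.v i)
  c1_d : ∀ α, IsC1 T (W.d α)
  c1_m : ∀ p ∈ minorPairs n m, IsC1 T (W.mm p.1 p.2)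
  eq_τ : ∀ t ∈ Set.Icc 0 T, ∀ x,
    dt T W.τ t x + ∑ j, W.v j t x * dx j W.τ t x - W.τ t x * ∑ j, dx j (W.v j) t x = 0
  eq_d : ∀ α, ∀ t ∈ Set.Icc 0 T, ∀ x,
    dt T (W.d α) t x + ∑ i, W.v i t x * dx i (W.d α) t x
      + ∑ p ∈ minorPairs n m, ∑ i, (if α ∈ p.1 ∧ i ∈ p.2 then
          (-1 : ℝ) ^ (ord p.1 α + ord p.2 i) * W.mm (p.1 \ {α}) (p.2 \ {i}) t x
            * dx i (W.mm p.1 p.2) t x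
        else 0) = 0
  eq_v : ∀ i, ∀ t ∈ Set.Icc 0 T, ∀ x,
    dt T (W.v i) t x
      + ∑ p ∈ minorPairs n m, ∑ j, (if j ∈ p.2 ∧ i ∉ p.2 \ {j} then
          (-1 : ℝ) ^ (ord p.2 j + ord (p.2 \ {j}) i) * W.mm p.1 ((p.2 \ {j}) ∪ {i}) t x
            * dx j (W.mm p.1 p.2) t x
        else 0)
      - ∑ p ∈ minorPairs n m, W.mm p.1 p.2 t x * dx i (W.mm p.1 p.2) t x
      + ∑ j, W.v j t x * dx j (W.v i) t x - W.τ t x * dx i W.τ t x = 0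
  eq_m : ∀ p ∈ minorPairs n m, ∀ t ∈ Set.Icc 0 T, ∀ x,
    dt T (W.mm p.1 p.2) t x + ∑ j, W.v j t x * dx j (W.mm p.1 p.2) t x
      + ∑ i, ∑ j, (if i ∈ p.2 ∧ j ∉ p.2 \ {i} then
          (-1 : ℝ) ^ (ord (p.2 \ {i}) j + ord p.2 i) * W.mm p.1 ((p.2 \ {i}) ∪ {j}) t x
            * dx i (W.v j) t x
        else 0)
      - W.mm p.1 p.2 t x * ∑ j, dx j (W.v j) t x
      + ∑ α, ∑ i, (if α ∈ p.1 ∧ i ∈ p.2 then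
          (-1 : ℝ) ^ (ord p.1 α + ord p.2 i) * W.mm (p.1 \ {α}) (p.2 \ {i}) t x
            * dx i (W.d α) t x
        else 0) = 0

/-- All the unknowns are bounded on `[0,T] × ℝⁿ`. -/
def IsBounded (T : ℝ) : Prop :=
  ∃ C : ℝ, ∀ t ∈ Set.Icc 0 T, ∀ x,
    |W.τ t x| ≤ C ∧ (∀ i, |W.v i t x| ≤ C) ∧ (∀ α, |W.d α t x| ≤ C) ∧
      ∀ p ∈ minorPairs n m, |W.mm p.1 p.2 t x| ≤ C

/-- The matrix `F = τ⁻¹ m` (meaningful where `τ ≠ 0`). -/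
noncomputable def F (t : ℝ) (x : Space n) : Matrix (Fin m) (Fin n) ℝ :=
  Matrix.of fun α i => (W.τ t x)⁻¹ * W.entry α i t x

/-- The algebraic constraints at the point `(t, x)`. -/
structure Constraints (t : ℝ) (x : Space n) : Prop where
  τ_ne_zero : W.τ t x ≠ 0
  momentum : ∀ i, W.τ t x * W.v i t x = ∑ α, W.entry α i t x * W.d α t x
  energy : W.τ t x ^ 2 + ∑ i, W.v i t x ^ 2 + ∑ α, W.d α t x ^ 2
    + ∑ p ∈ minorPairs n m, W.mm p.1 p.2 t x ^ 2 = 1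
  minors : ∀ (A : Finset (Fin m)) (I : Finset (Fin n)) (h : A.card = I.card), A.Nonempty →
    W.mm A I t x = W.τ t x * matrixMinor (W.F t x) A I h

/-- `λ = ½ (τ² + v² + d² + ∑ m_{A,I}² - 1)`. -/
noncomputable def lam : Field n := fun t x =>
  (1 / 2) * (W.τ t x ^ 2 + ∑ i, W.v i t x ^ 2 + ∑ α, W.d α t x ^ 2
    + ∑ p ∈ minorPairs n m, W.mm p.1 p.2 t x ^ 2 - 1)

/-- `ω_i = τ v_i - m_{α i} d_α`. -/
noncomputable def om (i : Fin n) : Field n := fun t x =>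
  W.τ t x * W.v i t x - ∑ α, W.entry α i t x * W.d α t x

/-- `φ^α_{A,I}`, used for `|I| = |A| + 1`. -/
noncomputable def phi (α : Fin m) (A : Finset (Fin m)) (I : Finset (Fin n)) : Field n :=
  fun t x =>
    ∑ i ∈ I, (-1 : ℝ) ^ (ord A α + ord I i) * W.mm A (I \ {i}) t x * W.entry α i t x
      - (if α ∉ A then W.τ t x * W.mm (A ∪ {α}) I t x else 0)

/-- `ψ^i_{A,I}`, used for `|A| = |I| + 1`. -/
noncomputable def psi (i : Fin n) (A : Finset (Fin m)) (I : Finset (Fin n)) : Field n :=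
  fun t x =>
    ∑ α ∈ A, (-1 : ℝ) ^ (ord A α + ord I i) * W.mm (A \ {α}) I t x * W.entry α i t x
      - (if i ∉ I then W.τ t x * W.mm A (I ∪ {i}) t x else 0)

/-- The evolution equations of `λ`, `ω_i`, `φ^α_{A,I}`, `ψ^i_{A,I}` at the point `(t, x)`. The one
of `λ` contains divisions by `τ` and is asserted where `τ ≠ 0`. -/
structure ConstraintEvolution (T t : ℝ) (x : Space n) : Prop where
  evol_om : ∀ i,
    dt T (W.om i) t x =
      W.om i t x * ∑ j, dx j (W.v j) t x - ∑ j, W.om j t x * dx i (W.v j) t x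
        - ∑ j, W.v j t x * dx j (W.om i) t x + W.τ t x * dx i W.lam t x
        + ∑ p ∈ minorPairs n m, ∑ j, (if j ∈ p.2 then
            (-1 : ℝ) ^ (ord p.2 j + ord (p.2 \ {j}) i) * dx j (W.mm p.1 p.2) t x
              * W.psi i p.1 (p.2 \ {j}) t x
          else 0)
  evol_lam : W.τ t x ≠ 0 →
    dt T W.lam t x =
      -∑ j, W.v j t x * dx j W.lam t x + W.τ t x * ∑ i, dx i (W.om i) t x
        + ∑ p ∈ bigPairs n m, ∑ i, ∑ j, (if i ∈ p.2 ∧ j ∈ p.2 then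
            (-1 : ℝ) ^ (ord p.2 i + ord p.2 j) * W.mm p.1 (p.2 \ {j}) t x
              * dx j (fun s y => W.mm p.1 (p.2 \ {i}) s y * W.om i s y / W.τ s y) t x
          else 0)
        + ∑ p ∈ bigPairs n m, ∑ α, ∑ i, (if i ∈ p.2 then
            (-1 : ℝ) ^ (ord p.1 α + ord p.2 i) * W.mm p.1 (p.2 \ {i}) t x
              * dx i (fun s y => W.phi α p.1 p.2 s y * W.d α s y / W.τ s y) t x
          else 0)
  evol_phi : ∀ (α : Fin m) (A : Finset (Fin m)) (I : Finset (Fin n)), I.card = A.card + 1 →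
    dt T (W.phi α A I) t x =
      2 * W.phi α A I t x * ∑ j, dx j (W.v j) t x - ∑ j, W.v j t x * dx j (W.phi α A I) t x
        - ∑ j, ∑ k, (if j ∈ I ∧ k ∉ I \ {j} then
            (-1 : ℝ) ^ (ord (I \ {j}) k + ord I j) * W.phi α A ((I \ {j}) ∪ {k}) t x
              * dx j (W.v k) t x
          else 0)
        + ∑ β, ∑ j, (if β ∈ A ∧ j ∈ I then
            (-1 : ℝ) ^ (ord A α + ord A β + ord (A \ {β}) α + ord I j)
              * W.phi α (A \ {β}) (I \ {j}) t x * dx j (W.d β) t x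
          else 0)
  evol_psi : ∀ (i : Fin n) (A : Finset (Fin m)) (I : Finset (Fin n)), A.card = I.card + 1 →
    dt T (W.psi i A I) t x =
      2 * W.psi i A I t x * ∑ j, dx j (W.v j) t x - ∑ j, W.v j t x * dx j (W.psi i A I) t x
        - ∑ k, (-1 : ℝ) ^ (ord I i + ord I k) * W.psi k A I t x * dx i (W.v k) t x
        + ∑ β ∈ A, ∑ j ∈ I,
            (-1 : ℝ) ^ (ord A β + ord I j + ord I i + ord (I \ {j}) i)
              * W.psi i (A \ {β}) (I \ {j}) t x * dx j (W.d β) t x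
        - ∑ j, ∑ k, (if j ∈ I ∧ k ∉ I \ {j} then
            (-1 : ℝ) ^ (ord I i + ord I j + ord (I \ {j}) k + ord ((I \ {j}) ∪ {k}) i)
              * W.psi i A ((I \ {j}) ∪ {k}) t x * dx j (W.v k) t x
          else 0)

end State

end ExtremalSurface

/-!
The theorem rests on reading `(A, I) ↦ m_{A,I}` as a vector `m` of a fermionic Fock space. Extend
`m_{A,I}` by zero to `|A| ≠ |I|` and put `m_{∅,∅} = τ`. For a column `i` let `c_i`, `c†_i` be the
operators `(c_i f)(A, I) = (-1)^{O_I(i)} f(A, I \ {i})` for `i ∈ I` and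
`(c†_i f)(A, I) = (-1)^{O_I(i)} f(A, I ∪ {i})` for `i ∉ I`, and for a row `α` let `a_α`, `a†_α` be
the same operators on `A`. They obey the canonical anticommutation relations (`up_up`,
`down_down`, `down_up`), and `c_i`, `c†_i` are adjoint to each other (`sum_up_mul`). All signs of
the equations are those of these operators. With `D = ∂_t + v_j ∂_j` the system reads

* `D m = ∑ ∂_k v_j c†_j c_k m - ∑ ∂_k d_β a_β c_k m`, the equation of `τ` included,
* `D v_i = ∑_j ⟨c_j m, ∂_j c_i m⟩` and `D d_α = -∑_j ⟨a_α c_j m, ∂_j m⟩`,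

while up to a sign `φ^α = ∑ m_{αi} c_i m - τ a†_α m` and `ψ^i = ∑ m_{αi} a_α m - τ c†_i m`. The
evolution equations of `φ` and `ψ` are then consequences of the anticommutation relations alone
(`phiB_flow`, `psiB_flow`); the one of `ω` is a direct computation (`evol_om_ip`); and
`D λ = ∑_j ⟨c_j m, ∂_j (∑ v_i c_i m - ∑ d_α a†_α m)⟩` (`evol_lam_ip`), where the differentiated
vector equals `τ⁻¹ (∑ ω_i c_i m + ∑ d_α φ^α)` (`Z_eq`).

For the propagation of the constraints, `τ` solves a linear transport equation along the
characteristics of the bounded field `v`, so it cannot vanish (`exists_zero_of_transport`). The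
equations of `φ` and of `ψ` are closed linear transport systems with continuous coefficients, hence
`φ = ψ = 0`. Then `λ` and the components of `Y = τ⁻¹ ∑ ω_i c_i m` satisfy
`D λ = ∑ ⟨c_j m, ∂_j Y⟩` and `D Y = ∑ c_j m ∂_j λ` up to terms of order zero in `ω`, which is
linear in `Y`. This is a symmetric hyperbolic system whose principal part has bounded
coefficients, so finite speed of propagation and a localised energy estimate
(`symmetric_hyperbolic_unique`) give `λ = 0` and `Y = 0`, hence `ω = 0`. Finally `φ = 0` is the
recursion of Laplace expansion, which forces `m_{A,I} = τ [F]_{A,I}` (`Mv_eq_of_phi_eq_zero`).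
-/

/-! ### Creation and annihilation operators on functions of finite sets -/

namespace ExtremalSurface

section Fermion

variable {k : ℕ} {V : Type*} [AddCommGroup V] [Module ℝ V]

theorem ord_sdiff_of_lt {A : Finset (Fin k)} {a b : Fin k} (ha : a ∈ A) (h : a < b) :
    ord A b = ord (A \ {a}) b + 1 := by
  unfold ord
  have : A.filter (· < b) = insert a ((A \ {a}).filter (· < b)) := by
    ext c; simp only [Finset.mem_filter, Finset.mem_insert, Finset.mem_sdiff,
      Finset.mem_singleton]
    by_cases hc : c = a
    · subst hc; simp [ha, h]
    · simp [hc]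
  rw [this, Finset.card_insert_of_notMem (by simp)]

theorem ord_sdiff_of_not_lt {A : Finset (Fin k)} {a b : Fin k} (h : ¬ a < b) :
    ord (A \ {a}) b = ord A b := by
  unfold ord
  congr 2
  ext c; simp only [Finset.mem_filter, Finset.mem_sdiff, Finset.mem_singleton]
  refine ⟨fun hc => ⟨hc.1.1, hc.2⟩, fun hc => ⟨⟨hc.1, ?_⟩, hc.2⟩⟩
  rintro rfl; exact h hc.2

theorem sign_sdiff {A : Finset (Fin k)} {a b : Fin k} (ha : a ∈ A) :
    (-1 : ℝ) ^ ord (A \ {a}) b = if a < b then -(-1 : ℝ) ^ ord A b else (-1) ^ ord A b := by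
  split_ifs with h
  · rw [ord_sdiff_of_lt ha h, pow_succ]; ring
  · rw [ord_sdiff_of_not_lt h]

theorem union_sdiff_singleton {A : Finset (Fin k)} {a : Fin k} (ha : a ∉ A) :
    (A ∪ {a}) \ {a} = A := by
  ext c; simp only [Finset.mem_sdiff, Finset.mem_union, Finset.mem_singleton]
  by_cases hc : c = a
  · subst hc; simp [ha]
  · simp [hc]

theorem sdiff_union_singleton {A : Finset (Fin k)} {a : Fin k} (ha : a ∈ A) :
    (A \ {a}) ∪ {a} = A := by
  ext c; simp only [Finset.mem_sdiff, Finset.mem_union, Finset.mem_singleton]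
  by_cases hc : c = a
  · subst hc; simp [ha]
  · simp [hc]

theorem sign_union {A : Finset (Fin k)} {a b : Fin k} (ha : a ∉ A) :
    (-1 : ℝ) ^ ord (A ∪ {a}) b = if a < b then -(-1 : ℝ) ^ ord A b else (-1) ^ ord A b := by
  have := sign_sdiff (A := A ∪ {a}) (a := a) (b := b) (by simp)
  rw [union_sdiff_singleton ha] at this
  rw [this]; split_ifs <;> simp

theorem sign_mul_self (A : Finset (Fin k)) (a : Fin k) :
    (-1 : ℝ) ^ ord A a * (-1) ^ ord A a = 1 := by
  rw [← pow_add, ← two_mul, pow_mul]; simp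

/-- The fermionic creation operator `f ↦ (A ↦ ± f (A \ {a}))`, on functions of finite sets. -/
def up (a : Fin k) : (Finset (Fin k) → V) →ₗ[ℝ] (Finset (Fin k) → V) where
  toFun f A := if a ∈ A then (-1 : ℝ) ^ ord A a • f (A \ {a}) else 0
  map_add' f g := by ext A; by_cases h : a ∈ A <;> simp [h]
  map_smul' c f := by ext A; by_cases h : a ∈ A <;> simp [h, smul_comm c]

/-- The fermionic annihilation operator `f ↦ (A ↦ ± f (A ∪ {a}))`, adjoint to `up a`. -/
def down (a : Fin k) : (Finset (Fin k) → V) →ₗ[ℝ] (Finset (Fin k) → V) where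
  toFun f A := if a ∉ A then (-1 : ℝ) ^ ord A a • f (A ∪ {a}) else 0
  map_add' f g := by ext A; by_cases h : a ∈ A <;> simp [h]
  map_smul' c f := by ext A; by_cases h : a ∈ A <;> simp [h, smul_comm c]

theorem up_apply (a : Fin k) (f : Finset (Fin k) → V) (A : Finset (Fin k)) :
    up a f A = if a ∈ A then (-1 : ℝ) ^ ord A a • f (A \ {a}) else 0 := rfl

theorem down_apply (a : Fin k) (f : Finset (Fin k) → V) (A : Finset (Fin k)) :
    down a f A = if a ∉ A then (-1 : ℝ) ^ ord A a • f (A ∪ {a}) else 0 := rfl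

/-- Creation operators anticommute. -/
theorem up_up (a b : Fin k) (f : Finset (Fin k) → V) : up a (up b f) = -up b (up a f) := by
  ext A
  simp only [up_apply, Pi.neg_apply]
  by_cases hab : a = b
  · subst hab; simp
  by_cases ha : a ∈ A <;> by_cases hb : b ∈ A <;>
    simp only [ha, hb, if_true, if_false, smul_zero, Finset.mem_sdiff, Finset.mem_singleton,
      hab, Ne.symm hab, not_false_eq_true, and_self, and_true, neg_zero, ite_self, smul_smul]
  rw [sign_sdiff ha, sign_sdiff hb, sdiff_right_comm, ← neg_smul]
  congr 1
  rcases lt_or_gt_of_ne hab with h | h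
  · simp [h, h.not_gt]; ring
  · simp [h, h.not_gt]; ring

/-- Annihilation operators anticommute. -/
theorem down_down (a b : Fin k) (f : Finset (Fin k) → V) :
    down a (down b f) = -down b (down a f) := by
  ext A
  simp only [down_apply, Pi.neg_apply]
  by_cases hab : a = b
  · subst hab; simp
  by_cases ha : a ∈ A <;> by_cases hb : b ∈ A <;>
    simp [-Finset.union_singleton, -Finset.union_insert, -Finset.insert_union, -Finset.union_assoc, ha, hb, hab, Ne.symm hab, smul_smul]
  have hs : A ∪ {a} ∪ {b} = A ∪ {b} ∪ {a} := Finset.union_right_comm _ _ _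
  rw [sign_union ha, sign_union hb, hs, ← neg_smul]
  congr 1
  rcases lt_or_gt_of_ne hab with h | h
  · simp [h, h.not_gt]; ring
  · simp [h, h.not_gt]; ring

/-- The canonical anticommutation relation between annihilation and creation operators. -/
theorem down_up (a b : Fin k) (f : Finset (Fin k) → V) :
    down a (up b f) = (if a = b then f else 0) - up b (down a f) := by
  ext A
  simp only [down_apply, up_apply, Pi.sub_apply]
  by_cases hab : a = b
  · subst hab
    by_cases ha : a ∈ A
    · simp only [ha, not_true_eq_false, if_false, if_true, smul_smul, Finset.mem_sdiff,
        Finset.mem_singleton, and_false, not_false_eq_true, sdiff_union_singleton ha]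
      rw [sign_sdiff ha]; simp [sign_mul_self]
    · simp only [ha, not_false_eq_true, if_true, if_false, smul_smul, Finset.mem_union,
        Finset.mem_singleton, or_true, union_sdiff_singleton ha, sub_zero]
      rw [sign_union ha]; simp [sign_mul_self]
  · by_cases ha : a ∈ A <;> by_cases hb : b ∈ A <;>
      simp [-Finset.union_singleton, ha, hb, hab, Ne.symm hab, smul_smul]
    have hs : (A ∪ {a}) \ {b} = (A \ {b}) ∪ {a} := by
      ext c; simp only [Finset.mem_sdiff, Finset.mem_union, Finset.mem_singleton]
      constructor
      · tauto
      · rintro (h | rfl)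
        · tauto
        · exact ⟨Or.inr rfl, hab⟩
    rw [sign_union ha, sign_sdiff hb, hs, ← neg_smul]
    congr 1
    rcases lt_or_gt_of_ne hab with h | h
    · simp [h, h.not_gt]; ring
    · simp [h, h.not_gt]; ring

/-- `up a` and `down a` are adjoint to each other. -/
theorem sum_up_mul (a : Fin k) (f g : Finset (Fin k) → ℝ) :
    ∑ A, up a f A * g A = ∑ A, f A * down a g A := by
  simp only [up_apply, down_apply, smul_eq_mul, ite_mul, mul_ite, zero_mul, mul_zero]
  rw [← Finset.sum_filter, ← Finset.sum_filter]
  refine Finset.sum_bij' (fun A _ => A \ {a}) (fun A _ => A ∪ {a}) ?_ ?_ ?_ ?_ ?_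
  · intro A _; simp
  · intro A _; simp
  · intro A hA; exact sdiff_union_singleton (by simpa using hA)
  · intro A hA; exact union_sdiff_singleton (by simpa using hA)
  · intro A hA
    have hA : a ∈ A := by simpa using hA
    simp only [sdiff_union_singleton hA]
    rw [sign_sdiff hA]; simp; ring

end Fermion

end ExtremalSurface

/-! ### Operators on families of minors, and the flow of the quadratic maps -/

namespace ExtremalSurface

section Algebra

variable {n m : ℕ}

/-- Families of real numbers indexed by a set of rows and a set of columns. -/
abbrev Minors (m n : ℕ) := Finset (Fin m) → Finset (Fin n) → ℝ

/-- The creation operator of the column `i`. -/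
def colUp (i : Fin n) : Minors m n →ₗ[ℝ] Minors m n := (up i).compLeft _

/-- The annihilation operator of the column `i`. -/
def colDown (i : Fin n) : Minors m n →ₗ[ℝ] Minors m n := (down i).compLeft _

/-- The creation operator of the row `α`. -/
def rowUp (α : Fin m) : Minors m n →ₗ[ℝ] Minors m n := up α

/-- The annihilation operator of the row `α`. -/
def rowDown (α : Fin m) : Minors m n →ₗ[ℝ] Minors m n := down α

theorem colUp_apply (i : Fin n) (f : Minors m n) (A I) :
    colUp i f A I = if i ∈ I then (-1 : ℝ) ^ ord I i * f A (I \ {i}) else 0 := rfl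

theorem colDown_apply (i : Fin n) (f : Minors m n) (A I) :
    colDown i f A I = if i ∉ I then (-1 : ℝ) ^ ord I i * f A (I ∪ {i}) else 0 := rfl

theorem rowUp_apply (α : Fin m) (f : Minors m n) (A I) :
    rowUp α f A I = if α ∈ A then (-1 : ℝ) ^ ord A α * f (A \ {α}) I else 0 := by
  simp only [rowUp, up_apply]; split_ifs <;> simp

theorem rowDown_apply (α : Fin m) (f : Minors m n) (A I) :
    rowDown α f A I = if α ∉ A then (-1 : ℝ) ^ ord A α * f (A ∪ {α}) I else 0 := by
  simp only [rowDown, down_apply]; split_ifs <;> simp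

theorem colUp_colUp (i j : Fin n) (f : Minors m n) :
    colUp i (colUp j f) = -colUp j (colUp i f) := funext fun A => up_up i j (f A)

theorem colDown_colDown (i j : Fin n) (f : Minors m n) :
    colDown i (colDown j f) = -colDown j (colDown i f) := funext fun A => down_down i j (f A)

theorem colDown_colUp (i j : Fin n) (f : Minors m n) :
    colDown i (colUp j f) = (if i = j then f else 0) - colUp j (colDown i f) := by
  funext A
  have := down_up i j (f A)
  split_ifs at this ⊢ <;> exact this

theorem rowUp_rowUp (α β : Fin m) (f : Minors m n) :
    rowUp α (rowUp β f) = -rowUp β (rowUp α f) := up_up α β f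

theorem rowDown_rowUp (α β : Fin m) (f : Minors m n) :
    rowDown α (rowUp β f) = (if α = β then f else 0) - rowUp β (rowDown α f) := down_up α β f

theorem colUp_rowUp (i : Fin n) (α : Fin m) (f : Minors m n) :
    colUp i (rowUp α f) = rowUp α (colUp i f) := by
  ext A I; simp only [colUp_apply, rowUp_apply]; split_ifs <;> ring

theorem colUp_rowDown (i : Fin n) (α : Fin m) (f : Minors m n) :
    colUp i (rowDown α f) = rowDown α (colUp i f) := by
  ext A I; simp only [colUp_apply, rowDown_apply]; split_ifs <;> ring

theorem colDown_rowUp (i : Fin n) (α : Fin m) (f : Minors m n) :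
    colDown i (rowUp α f) = rowUp α (colDown i f) := by
  ext A I; simp only [colDown_apply, rowUp_apply]; split_ifs <;> ring

theorem colDown_rowDown (i : Fin n) (α : Fin m) (f : Minors m n) :
    colDown i (rowDown α f) = rowDown α (colDown i f) := by
  ext A I; simp only [colDown_apply, rowDown_apply]; split_ifs <;> ring

/-- The Euclidean inner product of two families. -/
def ip (f g : Minors m n) : ℝ := ∑ A, ∑ I, f A I * g A I

theorem ip_comm (f g : Minors m n) : ip f g = ip g f := by simp only [ip, mul_comm]

theorem ip_add (f g h : Minors m n) : ip f (g + h) = ip f g + ip f h := by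
  simp only [ip, Pi.add_apply, mul_add, Finset.sum_add_distrib]

theorem ip_smul (c : ℝ) (f g : Minors m n) : ip f (c • g) = c * ip f g := by
  simp only [ip, Pi.smul_apply, smul_eq_mul, Finset.mul_sum]
  exact Finset.sum_congr rfl fun _ _ => Finset.sum_congr rfl fun _ _ => by ring

/-- `ip f` as a linear map. -/
def ipL (f : Minors m n) : Minors m n →ₗ[ℝ] ℝ where
  toFun := ip f
  map_add' := ip_add f
  map_smul' c g := ip_smul c f g

theorem ip_sub (f g h : Minors m n) : ip f (g - h) = ip f g - ip f h := (ipL f).map_sub g h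

theorem ip_sum {ι : Type*} (s : Finset ι) (f : Minors m n) (g : ι → Minors m n) :
    ip f (∑ i ∈ s, g i) = ∑ i ∈ s, ip f (g i) := map_sum (ipL f) g s

theorem ip_colUp (i : Fin n) (f g : Minors m n) : ip (colUp i f) g = ip f (colDown i g) :=
  Finset.sum_congr rfl fun A _ => sum_up_mul i (f A) (g A)

theorem ip_rowUp (α : Fin m) (f g : Minors m n) : ip (rowUp α f) g = ip f (rowDown α g) := by
  unfold ip
  rw [Finset.sum_comm, Finset.sum_comm (f := fun A I => f A I * _)]
  refine Finset.sum_congr rfl fun I _ => ?_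
  have := sum_up_mul α (fun A => f A I) (fun A => g A I)
  simpa only [up_apply, down_apply, smul_eq_mul, rowUp_apply, rowDown_apply] using this

/-- The second quantisation `∑ V_{kj} c†_j c_k` of a square matrix `V`, acting on the columns. -/
def colFlow (V : Fin n → Fin n → ℝ) : Minors m n →ₗ[ℝ] Minors m n :=
  ∑ k, ∑ j, V k j • (colDown j ∘ₗ colUp k)

/-- The operator `∑ D_{kβ} a_β c_k`, which creates a row and a column. -/
def pairUp (D : Fin n → Fin m → ℝ) : Minors m n →ₗ[ℝ] Minors m n :=
  ∑ k, ∑ β, D k β • (rowUp β ∘ₗ colUp k)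

theorem colFlow_apply (V : Fin n → Fin n → ℝ) (f : Minors m n) :
    colFlow V f = ∑ k, ∑ j, V k j • colDown j (colUp k f) := by
  simp [colFlow, LinearMap.sum_apply]

theorem pairUp_apply (D : Fin n → Fin m → ℝ) (f : Minors m n) :
    pairUp D f = ∑ k, ∑ β, D k β • rowUp β (colUp k f) := by
  simp [pairUp, LinearMap.sum_apply]

theorem colUp_colFlow (V : Fin n → Fin n → ℝ) (i : Fin n) (f : Minors m n) :
    colUp i (colFlow V f) = colFlow V (colUp i f) + ∑ k, V k i • colUp k f := by
  simp only [colFlow_apply, map_sum, map_smul]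
  have h : ∀ k j, colUp i (colDown j (colUp k f))
      = colDown j (colUp k (colUp i f)) + if i = j then colUp k f else 0 := by
    intro k j
    rw [colUp_colUp k i f, map_neg, colDown_colUp j i]
    simp only [eq_comm (a := i)]; abel
  simp only [h, smul_add, Finset.sum_add_distrib, smul_ite, smul_zero, Finset.sum_ite_eq,
    Finset.mem_univ, if_true]

theorem colDown_colFlow (V : Fin n → Fin n → ℝ) (i : Fin n) (f : Minors m n) :
    colDown i (colFlow V f) = colFlow V (colDown i f) - ∑ j, V i j • colDown j f := by
  simp only [colFlow_apply, map_sum, map_smul]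
  have h : ∀ k j, colDown i (colDown j (colUp k f))
      = colDown j (colUp k (colDown i f)) - if i = k then colDown j f else 0 := by
    intro k j
    rw [colDown_colDown i j, colDown_colUp i k, map_sub]
    split_ifs <;> simp
  simp only [h, smul_sub, Finset.sum_sub_distrib, smul_ite, smul_zero]
  congr 1
  rw [Finset.sum_comm]
  simp

theorem rowUp_colFlow (V : Fin n → Fin n → ℝ) (α : Fin m) (f : Minors m n) :
    rowUp α (colFlow V f) = colFlow V (rowUp α f) := by
  simp only [colFlow_apply, map_sum, map_smul, colUp_rowUp, colDown_rowUp]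

theorem rowDown_colFlow (V : Fin n → Fin n → ℝ) (α : Fin m) (f : Minors m n) :
    rowDown α (colFlow V f) = colFlow V (rowDown α f) := by
  simp only [colFlow_apply, map_sum, map_smul, colUp_rowDown, colDown_rowDown]

theorem colUp_pairUp (D : Fin n → Fin m → ℝ) (i : Fin n) (f : Minors m n) :
    colUp i (pairUp D f) = -pairUp D (colUp i f) := by
  simp only [pairUp_apply, map_sum, map_smul, colUp_rowUp, colUp_colUp i, map_neg, smul_neg,
    Finset.sum_neg_distrib]

theorem rowUp_pairUp (D : Fin n → Fin m → ℝ) (α : Fin m) (f : Minors m n) :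
    rowUp α (pairUp D f) = -pairUp D (rowUp α f) := by
  simp only [pairUp_apply, map_sum, map_smul, colUp_rowUp, rowUp_rowUp α, smul_neg,
    Finset.sum_neg_distrib]

theorem colDown_pairUp (D : Fin n → Fin m → ℝ) (i : Fin n) (f : Minors m n) :
    colDown i (pairUp D f) = -pairUp D (colDown i f) + ∑ β, D i β • rowUp β f := by
  simp only [pairUp_apply, map_sum, map_smul, colDown_rowUp, colDown_colUp i, map_sub, smul_sub,
    Finset.sum_sub_distrib]
  rw [sub_eq_neg_add]
  congr 1
  rw [Finset.sum_comm]
  refine Finset.sum_congr rfl fun β _ => ?_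
  simp [apply_ite (rowUp β)]

theorem rowDown_pairUp (D : Fin n → Fin m → ℝ) (α : Fin m) (f : Minors m n) :
    rowDown α (pairUp D f) = -pairUp D (rowDown α f) + ∑ k, D k α • colUp k f := by
  simp only [pairUp_apply, map_sum, map_smul, colUp_rowDown, rowDown_rowUp α, smul_sub,
    Finset.sum_sub_distrib]
  rw [sub_eq_neg_add]
  simp

/-- `colFlow` in the order of the operators that the signs of the system display; reordering
produces the divergence. -/
theorem colFlow_eq (V : Fin n → Fin n → ℝ) (f : Minors m n) :
    colFlow V f = (∑ j, V j j) • f - ∑ k, ∑ j, V k j • colUp k (colDown j f) := by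
  simp only [colFlow_apply, colDown_colUp, smul_sub, Finset.sum_sub_distrib, Finset.sum_smul]
  simp

theorem ord_empty (a : Fin n) : ord (∅ : Finset (Fin n)) a = 1 := by simp [ord]

theorem ord_singleton_self (a : Fin n) : ord ({a} : Finset (Fin n)) a = 1 := by
  simp [ord, Finset.filter_singleton]

theorem colFlow_empty (V : Fin n → Fin n → ℝ) (f : Minors m n) :
    colFlow V f ∅ ∅ = (∑ j, V j j) * f ∅ ∅ := by
  simp [colFlow_eq, Finset.sum_apply, colUp_apply]

theorem pairUp_empty (D : Fin n → Fin m → ℝ) (f : Minors m n) : pairUp D f ∅ ∅ = 0 := by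
  simp [pairUp_apply, Finset.sum_apply, rowUp_apply]

theorem colFlow_singleton (V : Fin n → Fin n → ℝ) (f : Minors m n) (α : Fin m) (i : Fin n) :
    colFlow V f {α} {i} = (∑ j, V j j) * f {α} {i} - ∑ j, V i j * f {α} {j} := by
  simp only [colFlow_eq, Pi.sub_apply, Pi.smul_apply, smul_eq_mul, Finset.sum_apply, colUp_apply,
    colDown_apply, Finset.mem_singleton]
  congr 1
  rw [Finset.sum_comm]
  refine Finset.sum_congr rfl fun j _ => ?_
  simp [ord_empty, ord_singleton_self]

theorem pairUp_singleton (D : Fin n → Fin m → ℝ) (f : Minors m n) (α : Fin m) (i : Fin n) :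
    pairUp D f {α} {i} = D i α * f ∅ ∅ := by
  simp only [pairUp_apply, Finset.sum_apply, Pi.smul_apply, smul_eq_mul, rowUp_apply, colUp_apply,
    Finset.mem_singleton]
  simp [ord_singleton_self]

/-- The bilinear map whose diagonal gives, up to a sign, the functions `φ^α_{A,I}`. -/
def phiB (α : Fin m) (f g : Minors m n) : Minors m n :=
  ∑ i, f {α} {i} • colUp i g - f ∅ ∅ • rowDown α g

/-- The bilinear map whose diagonal gives, up to a sign, the functions `ψ^i_{A,I}`. -/
def psiB (i : Fin n) (f g : Minors m n) : Minors m n :=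
  ∑ α, f {α} {i} • rowUp α g - f ∅ ∅ • colDown i g

/-- The derivative of the quadratic map `f ↦ phiB α f f` along the flow that drives the
`m_{A,I}`. The terms that are not a linear image of `phiB α f f` cancel. -/
theorem phiB_flow (V : Fin n → Fin n → ℝ) (D : Fin n → Fin m → ℝ) (α : Fin m) (f : Minors m n) :
    phiB α (colFlow V f - pairUp D f) f + phiB α f (colFlow V f - pairUp D f)
      = (∑ j, V j j) • phiB α f f + colFlow V (phiB α f f) + pairUp D (phiB α f f) := by
  simp only [phiB, Pi.sub_apply, colFlow_empty, pairUp_empty, colFlow_singleton,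
    pairUp_singleton, map_sub, map_sum, map_smul, colUp_colFlow, colUp_pairUp, rowDown_colFlow,
    rowDown_pairUp, sub_smul, smul_sub, smul_add, Finset.sum_sub_distrib, Finset.sum_add_distrib,
    sub_zero, mul_smul, ← Finset.smul_sum, smul_neg, Finset.sum_neg_distrib]
  have h : ∑ i, (∑ j, V i j * f {α} {j}) • colUp i f
      = ∑ i, f {α} {i} • ∑ k, V k i • colUp k f := by
    simp only [Finset.sum_smul, Finset.smul_sum, smul_smul]
    rw [Finset.sum_comm]
    simp only [mul_comm]
  have h2 : ∑ i, D i α • f ∅ ∅ • colUp i f = f ∅ ∅ • ∑ i, D i α • colUp i f := by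
    simp only [Finset.smul_sum]
    exact Finset.sum_congr rfl fun _ _ => smul_comm _ _ _
  rw [h, h2]
  abel

/-- The derivative of the quadratic map `f ↦ psiB i f f` along the flow that drives the
`m_{A,I}`. -/
theorem psiB_flow (V : Fin n → Fin n → ℝ) (D : Fin n → Fin m → ℝ) (i : Fin n) (f : Minors m n) :
    psiB i (colFlow V f - pairUp D f) f + psiB i f (colFlow V f - pairUp D f)
      = (∑ j, V j j) • psiB i f f + colFlow V (psiB i f f) + pairUp D (psiB i f f)
        - ∑ k, V i k • psiB k f f := by
  simp only [psiB, Pi.sub_apply, colFlow_empty, pairUp_empty, colFlow_singleton,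
    pairUp_singleton, map_sub, map_sum, map_smul, colDown_colFlow, rowUp_pairUp, rowUp_colFlow,
    colDown_pairUp, sub_smul, smul_sub, smul_add, Finset.sum_sub_distrib,
    sub_zero, mul_smul, ← Finset.smul_sum, smul_neg, Finset.sum_neg_distrib]
  have h : ∑ β, (∑ j, V i j * f {β} {j}) • rowUp β f
      = ∑ k, V i k • ∑ β, f {β} {k} • rowUp β f := by
    simp only [Finset.sum_smul, Finset.smul_sum, smul_smul]
    rw [Finset.sum_comm]
  have h2 : ∑ β, D i β • f ∅ ∅ • rowUp β f = f ∅ ∅ • ∑ β, D i β • rowUp β f := by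
    simp only [Finset.smul_sum]
    exact Finset.sum_congr rfl fun _ _ => smul_comm _ _ _
  have h3 : ∑ k, V i k • f ∅ ∅ • colDown k f = f ∅ ∅ • ∑ k, V i k • colDown k f := by
    simp only [Finset.smul_sum]
    exact Finset.sum_congr rfl fun _ _ => smul_comm _ _ _
  rw [h, h2, h3]
  abel

end Algebra

end ExtremalSurface

/-! ### Space-time derivatives, and the equations of the system in operator form -/

namespace ExtremalSurface

section Calculus

variable {n : ℕ} {T : ℝ}

/-- Differentiability at the single point `(t, x)`, within `[0,T] × ℝⁿ`, jointly in time and space. -/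
def DiffAt (T : ℝ) (f : Field n) (t : ℝ) (x : Space n) : Prop :=
  DifferentiableWithinAt ℝ (fun p : ℝ × Space n => f p.1 p.2) (Set.Icc 0 T ×ˢ Set.univ) (t, x)

/-- The derivative at `(t, x)`, within `[0,T] × ℝⁿ`, in the space-time direction `e`. -/
noncomputable def dd (T : ℝ) (e : ℝ × Space n) (f : Field n) : Field n :=
  fun t x => fderivWithin ℝ (fun p : ℝ × Space n => f p.1 p.2) (Set.Icc 0 T ×ˢ Set.univ) (t, x) e

/-- The unit vector of the time axis. -/
def eT : ℝ × Space n := (1, 0)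

/-- The unit vector of the `j`-th space axis. -/
noncomputable def eX (j : Fin n) : ℝ × Space n := (0, EuclideanSpace.single j 1)

theorem uniqueDiffOn_slab (hT : 0 < T) :
    UniqueDiffOn ℝ (Set.Icc 0 T ×ˢ (Set.univ : Set (Space n))) :=
  (uniqueDiffOn_Icc hT).prod uniqueDiffOn_univ

theorem uniqueDiff_slab (hT : 0 < T) {t : ℝ} (ht : t ∈ Set.Icc 0 T) (x : Space n) :
    UniqueDiffWithinAt ℝ (Set.Icc 0 T ×ˢ (Set.univ : Set (Space n))) (t, x) :=
  uniqueDiffOn_slab hT (t, x) ⟨ht, trivial⟩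

theorem IsC1.diffAt {f : Field n} (h : IsC1 T f) {t : ℝ} (ht : t ∈ Set.Icc 0 T) (x : Space n) :
    DiffAt T f t x := (h.differentiableOn one_ne_zero) (t, x) ⟨ht, trivial⟩

theorem DiffAt.hasDerivWithinAt {f : Field n} {t : ℝ} {x : Space n} (h : DiffAt T f t x) :
    HasDerivWithinAt (fun s => f s x) (dd T eT f t x) (Set.Icc 0 T) t := by
  have h1 : HasDerivWithinAt (fun s : ℝ => (s, x)) (1, 0) (Set.Icc 0 T) t :=
    (hasDerivWithinAt_id t _).prodMk (hasDerivWithinAt_const t _ x)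
  have h2 : Set.MapsTo (fun s : ℝ => (s, x)) (Set.Icc 0 T) (Set.Icc 0 T ×ˢ Set.univ) :=
    fun s hs => ⟨hs, trivial⟩
  exact h.hasFDerivWithinAt.comp_hasDerivWithinAt t h1 h2

theorem DiffAt.hasFDerivAt {f : Field n} {t : ℝ} {x : Space n} (h : DiffAt T f t x)
    (ht : t ∈ Set.Icc 0 T) :
    HasFDerivAt (f t) ((fderivWithin ℝ (fun p : ℝ × Space n => f p.1 p.2)
      (Set.Icc 0 T ×ˢ Set.univ) (t, x)).comp (ContinuousLinearMap.inr ℝ ℝ (Space n))) x := by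
  have h1 : HasFDerivAt (fun y : Space n => (t, y)) (ContinuousLinearMap.inr ℝ ℝ (Space n)) x :=
    hasFDerivAt_prodMk_right t x
  rw [← hasFDerivWithinAt_univ] at h1 ⊢
  exact h.hasFDerivWithinAt.comp x h1 fun y _ => ⟨ht, trivial⟩

theorem DiffAt.dt_eq {f : Field n} {t : ℝ} {x : Space n} (h : DiffAt T f t x) (hT : 0 < T)
    (ht : t ∈ Set.Icc 0 T) : dt T f t x = dd T eT f t x :=
  h.hasDerivWithinAt.derivWithin (uniqueDiffOn_Icc hT t ht)

theorem DiffAt.dx_eq {f : Field n} {t : ℝ} {x : Space n} (h : DiffAt T f t x)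
    (ht : t ∈ Set.Icc 0 T) (j : Fin n) : dx j f t x = dd T (eX j) f t x := by
  rw [dx, (h.hasFDerivAt ht).fderiv]; rfl

variable {f g : Field n} {t : ℝ} {x : Space n} {e : ℝ × Space n}

theorem DiffAt.const (c : ℝ) : DiffAt T (fun _ (_ : Space n) => c) t x :=
  differentiableWithinAt_const c

theorem DiffAt.add (hf : DiffAt T f t x) (hg : DiffAt T g t x) :
    DiffAt T (fun s y => f s y + g s y) t x := DifferentiableWithinAt.fun_add hf hg

theorem DiffAt.sub (hf : DiffAt T f t x) (hg : DiffAt T g t x) :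
    DiffAt T (fun s y => f s y - g s y) t x := DifferentiableWithinAt.fun_sub hf hg

theorem DiffAt.mul (hf : DiffAt T f t x) (hg : DiffAt T g t x) :
    DiffAt T (fun s y => f s y * g s y) t x := DifferentiableWithinAt.fun_mul hf hg

theorem DiffAt.div (hf : DiffAt T f t x) (hg : DiffAt T g t x) (h : g t x ≠ 0) :
    DiffAt T (fun s y => f s y / g s y) t x :=
  by
  simp only [div_eq_mul_inv]
  exact hf.mul ((differentiableAt_inv h).comp_differentiableWithinAt (t, x) hg)

theorem DiffAt.sum {ι : Type*} {s : Finset ι} {F : ι → Field n}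
    (h : ∀ i ∈ s, DiffAt T (F i) t x) : DiffAt T (fun r y => ∑ i ∈ s, F i r y) t x :=
  DifferentiableWithinAt.fun_sum h

theorem dd_const (c : ℝ) : dd T e (fun _ (_ : Space n) => c) t x = 0 := by
  simp [dd]

theorem dd_add (hT : 0 < T) (ht : t ∈ Set.Icc 0 T) (hf : DiffAt T f t x) (hg : DiffAt T g t x) :
    dd T e (fun s y => f s y + g s y) t x = dd T e f t x + dd T e g t x := by
  unfold dd; rw [fderivWithin_fun_add (uniqueDiff_slab hT ht x) hf hg]; rfl

theorem dd_sub (hT : 0 < T) (ht : t ∈ Set.Icc 0 T) (hf : DiffAt T f t x) (hg : DiffAt T g t x) :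
    dd T e (fun s y => f s y - g s y) t x = dd T e f t x - dd T e g t x := by
  unfold dd; rw [fderivWithin_fun_sub (uniqueDiff_slab hT ht x) hf hg]; rfl

theorem dd_mul (hT : 0 < T) (ht : t ∈ Set.Icc 0 T) (hf : DiffAt T f t x) (hg : DiffAt T g t x) :
    dd T e (fun s y => f s y * g s y) t x = dd T e f t x * g t x + f t x * dd T e g t x := by
  unfold dd; rw [fderivWithin_fun_mul (uniqueDiff_slab hT ht x) hf hg]
  simp; ring

theorem dd_const_mul (hT : 0 < T) (ht : t ∈ Set.Icc 0 T) (c : ℝ) (hf : DiffAt T f t x) :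
    dd T e (fun s y => c * f s y) t x = c * dd T e f t x := by
  rw [dd_mul hT ht (DiffAt.const c) hf, dd_const]; ring

theorem dd_sum (hT : 0 < T) (ht : t ∈ Set.Icc 0 T) {ι : Type*} {s : Finset ι} {F : ι → Field n}
    (h : ∀ i ∈ s, DiffAt T (F i) t x) :
    dd T e (fun r y => ∑ i ∈ s, F i r y) t x = ∑ i ∈ s, dd T e (F i) t x := by
  unfold dd; rw [fderivWithin_fun_sum (uniqueDiff_slab hT ht x) h]; simp

theorem dd_sq (hT : 0 < T) (ht : t ∈ Set.Icc 0 T) (hf : DiffAt T f t x) :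
    dd T e (fun s y => f s y ^ 2) t x = 2 * f t x * dd T e f t x := by
  simp only [pow_two, dd_mul hT ht hf hf]; ring

theorem DiffAt.sq (hf : DiffAt T f t x) : DiffAt T (fun s y => f s y ^ 2) t x :=
  DifferentiableWithinAt.fun_pow hf 2

/-- Fields that agree near `(t, x)`, within `[0,T] × ℝⁿ`, have the same derivatives there. -/
theorem dd_congr (h : ∀ᶠ p in nhdsWithin (t, x) (Set.Icc 0 T ×ˢ (Set.univ : Set (Space n))),
    f p.1 p.2 = g p.1 p.2) (hx : f t x = g t x) : dd T e f t x = dd T e g t x := by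
  unfold dd
  rw [Filter.EventuallyEq.fderivWithin_eq h hx]

end Calculus

/-- A sum over all pairs whose terms vanish for `|A| ≠ |I|` is a sum over `minorPairs` and the
term of `(∅, ∅)`. -/
theorem sum_eq_sum_minorPairs {n m : ℕ} (f : Finset (Fin m) → Finset (Fin n) → ℝ)
    (h : ∀ A I, A.card ≠ I.card → f A I = 0) :
    ∑ A, ∑ I, f A I = f ∅ ∅ + ∑ p ∈ minorPairs n m, f p.1 p.2 := by
  have hs : minorPairs n m = (Finset.univ.filter fun p : Finset (Fin m) × Finset (Fin n) =>
      p.1.card = p.2.card).erase (∅, ∅) := by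
    ext ⟨A, I⟩
    simp only [minorPairs, Finset.mem_filter, Finset.mem_univ, true_and, Finset.mem_erase, ne_eq,
      Prod.mk.injEq, Finset.nonempty_iff_ne_empty]
    refine and_congr_left fun hc => not_congr ⟨fun hA => ⟨hA, ?_⟩, fun hA => hA.1⟩
    subst hA; exact Finset.card_eq_zero.1 hc.symm
  rw [hs, Finset.add_sum_erase _ (fun p : Finset (Fin m) × Finset (Fin n) => f p.1 p.2)
    (a := (∅, ∅)) (by simp), Finset.sum_filter, Fintype.sum_prod_type]
  refine Finset.sum_congr rfl fun A _ => Finset.sum_congr rfl fun I _ => ?_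
  split_ifs with hc
  · rfl
  · exact h A I hc

namespace State

variable {n m : ℕ} (W : State n m) {T : ℝ}

/-- `m_{A,I}`, extended by zero to the pairs with `|A| ≠ |I|`. -/
def M (A : Finset (Fin m)) (I : Finset (Fin n)) : Field n :=
  fun t x => if A.card = I.card then W.mm A I t x else 0

/-- The family of all `m_{A,I}` at a point. -/
def Mv (t : ℝ) (x : Space n) : Minors m n := fun A I => W.M A I t x

/-- The derivatives of all `m_{A,I}` at a point, in the direction `e`. -/
noncomputable def dM (T : ℝ) (e : ℝ × Space n) (t : ℝ) (x : Space n) : Minors m n :=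
  fun A I => dd T e (W.M A I) t x

theorem M_of_card_eq {A : Finset (Fin m)} {I : Finset (Fin n)} (h : A.card = I.card) :
    W.M A I = W.mm A I := by funext t x; simp [M, h]

theorem M_of_card_ne {A : Finset (Fin m)} {I : Finset (Fin n)} (h : A.card ≠ I.card) :
    W.M A I = fun _ _ => 0 := by funext t x; simp [M, h]

theorem M_empty : W.M ∅ ∅ = W.τ := by funext t x; simp [M, mm]

theorem M_singleton (α : Fin m) (i : Fin n) : W.M {α} {i} = W.entry α i := by
  funext t x; simp [M, entry]

theorem Mv_of_card_ne {A : Finset (Fin m)} {I : Finset (Fin n)} (h : A.card ≠ I.card) (t x) :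
    W.Mv t x A I = 0 := by simp [Mv, M, h]

theorem dM_of_card_ne {A : Finset (Fin m)} {I : Finset (Fin n)} (h : A.card ≠ I.card) (e t x) :
    W.dM T e t x A I = 0 := by simp [dM, M_of_card_ne W h, dd_const]

variable {W}

theorem IsSolution.c1_M (hW : W.IsSolution T) (A : Finset (Fin m)) (I : Finset (Fin n)) :
    IsC1 T (W.M A I) := by
  by_cases h : A.card = I.card
  · rw [M_of_card_eq W h]
    by_cases hA : A = ∅
    · subst hA
      have : I = ∅ := Finset.card_eq_zero.1 (by simpa using h.symm)
      subst this
      rw [← M_of_card_eq W h, M_empty]; exact hW.c1_τ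
    · exact hW.c1_m (A, I) (by simp [minorPairs, h, Finset.nonempty_iff_ne_empty, hA])
  · rw [M_of_card_ne W h]; exact contDiffOn_const

variable {t : ℝ} {x : Space n}

theorem IsSolution.diffAt_M (hW : W.IsSolution T) (ht : t ∈ Set.Icc 0 T) (A I) :
    DiffAt T (W.M A I) t x := (hW.c1_M A I).diffAt ht x

theorem IsSolution.diffAt_v (hW : W.IsSolution T) (ht : t ∈ Set.Icc 0 T) (i) :
    DiffAt T (W.v i) t x := (hW.c1_v i).diffAt ht x

theorem IsSolution.diffAt_d (hW : W.IsSolution T) (ht : t ∈ Set.Icc 0 T) (α) :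
    DiffAt T (W.d α) t x := (hW.c1_d α).diffAt ht x

theorem card_sdiff_union {k : ℕ} {I : Finset (Fin k)} {i j : Fin k} (hi : i ∈ I)
    (hj : j ∉ I \ {i}) : ((I \ {i}) ∪ {j}).card = I.card := by
  rw [Finset.union_singleton, Finset.card_insert_of_notMem hj,
    Finset.card_sdiff_of_subset (by simpa using hi)]
  have := Finset.card_pos.2 ⟨i, hi⟩
  simp; omega

theorem card_sdiff_singleton' {k : ℕ} {I : Finset (Fin k)} {i : Fin k} (hi : i ∈ I) :
    (I \ {i}).card + 1 = I.card := by
  rw [Finset.card_sdiff_of_subset (by simpa using hi)]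
  have := Finset.card_pos.2 ⟨i, hi⟩
  simp; omega

theorem card_union_singleton' {k : ℕ} {I : Finset (Fin k)} {i : Fin k} (hi : i ∉ I) :
    (I ∪ {i}).card = I.card + 1 := by
  rw [Finset.union_singleton, Finset.card_insert_of_notMem hi]

/-- The equations of all `m_{A,I}`, that of `m_{∅,∅} = τ` included, as one equation. -/
theorem IsSolution.evol_M (hW : W.IsSolution T) (hT : 0 < T) (ht : t ∈ Set.Icc 0 T) :
    W.dM T eT t x = -∑ j, W.v j t x • W.dM T (eX j) t x
      + (colFlow (fun k j => dd T (eX k) (W.v j) t x) (W.Mv t x)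
        - pairUp (fun k β => dd T (eX k) (W.d β) t x) (W.Mv t x)) := by
  funext A I
  by_cases hc : A.card = I.card
  · by_cases hA : A = ∅
    · subst hA
      obtain rfl : I = ∅ := Finset.card_eq_zero.1 (by simpa using hc.symm)
      have h := hW.eq_τ t ht x
      simp only [(hW.c1_τ.diffAt ht x).dx_eq ht, (hW.c1_τ.diffAt ht x).dt_eq hT ht,
        fun j => (hW.diffAt_v (x := x) ht j).dx_eq ht] at h
      simp only [Pi.add_apply, Pi.sub_apply, Pi.neg_apply, Finset.sum_apply, Pi.smul_apply,
        smul_eq_mul, colFlow_empty, pairUp_empty, dM, Mv, M_empty]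
      linarith
    · have h := hW.eq_m (A, I) (by simp [minorPairs, hc, Finset.nonempty_iff_ne_empty, hA]) t ht x
      simp only [← M_of_card_eq W hc, (hW.diffAt_M (x := x) ht A I).dx_eq ht,
        (hW.diffAt_M (x := x) ht A I).dt_eq hT ht, fun j => (hW.diffAt_v (x := x) ht j).dx_eq ht,
        fun j => (hW.diffAt_d (x := x) ht j).dx_eq ht] at h
      simp only [colFlow_eq, pairUp_apply, Pi.add_apply, Pi.sub_apply, Pi.neg_apply,
        Finset.sum_apply, Pi.smul_apply, smul_eq_mul]
      have h1 : (∑ i, ∑ j, (if i ∈ I ∧ j ∉ I \ {i} then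
          (-1 : ℝ) ^ (ord (I \ {i}) j + ord I i) * W.mm A ((I \ {i}) ∪ {j}) t x
            * dd T (eX i) (W.v j) t x else 0))
          = ∑ i, ∑ j, dd T (eX i) (W.v j) t x * colUp i (colDown j (W.Mv t x)) A I := by
        refine Finset.sum_congr rfl fun i _ => Finset.sum_congr rfl fun j _ => ?_
        rw [colUp_apply]
        by_cases hi : i ∈ I
        · by_cases hj : j ∉ I \ {i}
          · rw [if_pos ⟨hi, hj⟩, if_pos hi, colDown_apply, if_pos hj, Mv,
              M_of_card_eq W (by rw [card_sdiff_union hi hj, hc]), pow_add]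
            ring
          · rw [if_neg (fun h => hj h.2), if_pos hi, colDown_apply, if_neg hj]; ring
        · rw [if_neg (fun h => hi h.1), if_neg hi]; ring
      have h2 : (∑ α, ∑ i, (if α ∈ A ∧ i ∈ I then
          (-1 : ℝ) ^ (ord A α + ord I i) * W.mm (A \ {α}) (I \ {i}) t x
            * dd T (eX i) (W.d α) t x else 0))
          = ∑ i, ∑ α, dd T (eX i) (W.d α) t x * rowUp α (colUp i (W.Mv t x)) A I := by
        rw [Finset.sum_comm]
        refine Finset.sum_congr rfl fun i _ => Finset.sum_congr rfl fun α _ => ?_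
        rw [rowUp_apply]
        by_cases hα : α ∈ A
        · by_cases hi : i ∈ I
          · have h1 := card_sdiff_singleton' hα
            have h2 := card_sdiff_singleton' hi
            rw [if_pos ⟨hα, hi⟩, if_pos hα, colUp_apply, if_pos hi, Mv,
              M_of_card_eq W (by omega), pow_add]
            ring
          · rw [if_neg (fun h => hi h.2), if_pos hα, colUp_apply, if_neg hi]; ring
        · rw [if_neg (fun h => hα h.1), if_neg hα]; ring
      simp only [M_of_card_eq W hc] at h
      rw [h1, h2, ← M_of_card_eq W hc] at h
      simp only [dM]
      have h3 : W.Mv t x A I = W.M A I t x := rfl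
      rw [h3]
      linarith
  · have h1 : ∀ i j, colUp i (colDown j (W.Mv t x)) A I = 0 := by
      intro i j
      rw [colUp_apply]
      split_ifs with hi
      · rw [colDown_apply]
        split_ifs with hj
        · ring
        · rw [Mv_of_card_ne W (by rw [card_sdiff_union hi hj]; exact hc)]; ring
      · rfl
    have h2 : ∀ i β, rowUp β (colUp i (W.Mv t x)) A I = 0 := by
      intro i β
      rw [rowUp_apply]
      split_ifs with hβ
      · rw [colUp_apply]
        split_ifs with hi
        · have h1 := card_sdiff_singleton' hβ
          have h2 := card_sdiff_singleton' hi
          rw [Mv_of_card_ne W (by omega)]; ring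
        · ring
      · rfl
    simp only [colFlow_eq, pairUp_apply, Pi.add_apply, Pi.sub_apply, Pi.neg_apply,
        Finset.sum_apply, Pi.smul_apply, smul_eq_mul, h1, h2, dM_of_card_ne W hc,
        Mv_of_card_ne W hc]
    simp

/-- The sums of the system run over the nonempty pairs; the term of `(∅, ∅)` is split off. -/
theorem sum_minorPairs_ip (f : Minors m n) (e : ℝ × Space n)
    (F : Finset (Fin m) → Finset (Fin n) → ℝ) (h : ∀ p ∈ minorPairs n m, F p.1 p.2 = f p.1 p.2) :
    ∑ p ∈ minorPairs n m, F p.1 p.2 * dd T e (W.M p.1 p.2) t x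
      = ip f (W.dM T e t x) - f ∅ ∅ * dd T e W.τ t x := by
  unfold ip
  rw [sum_eq_sum_minorPairs (fun A I => f A I * W.dM T e t x A I)
    (fun A I hc => by rw [dM_of_card_ne W hc, mul_zero])]
  simp only [dM, M_empty, add_sub_cancel_left]
  exact Finset.sum_congr rfl fun p hp => by rw [h p hp]

theorem mm_eq_M {p : Finset (Fin m) × Finset (Fin n)} (hp : p ∈ minorPairs n m) :
    W.mm p.1 p.2 = W.M p.1 p.2 :=
  (M_of_card_eq W (Finset.mem_filter.1 hp).2.2).symm

theorem IsSolution.evol_d (hW : W.IsSolution T) (hT : 0 < T) (ht : t ∈ Set.Icc 0 T) (α : Fin m) :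
    dd T eT (W.d α) t x = -∑ i, W.v i t x * dd T (eX i) (W.d α) t x
      - ∑ i, ip (rowUp α (colUp i (W.Mv t x))) (W.dM T (eX i) t x) := by
  have h := hW.eq_d α t ht x
  simp only [(hW.diffAt_d (x := x) ht α).dx_eq ht, (hW.diffAt_d (x := x) ht α).dt_eq hT ht] at h
  rw [Finset.sum_comm (s := minorPairs n m)] at h
  have h1 : ∀ i, ∑ p ∈ minorPairs n m, (if α ∈ p.1 ∧ i ∈ p.2 then
          (-1 : ℝ) ^ (ord p.1 α + ord p.2 i) * W.mm (p.1 \ {α}) (p.2 \ {i}) t x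
            * dx i (W.mm p.1 p.2) t x else 0)
        = ip (rowUp α (colUp i (W.Mv t x))) (W.dM T (eX i) t x) := by
    intro i
    have h2 := sum_minorPairs_ip (T := T) (W := W) (t := t) (x := x)
      (rowUp α (colUp i (W.Mv t x))) (eX i) (fun A I => if α ∈ A ∧ i ∈ I then
          (-1 : ℝ) ^ (ord A α + ord I i) * W.mm (A \ {α}) (I \ {i}) t x else 0) ?_
    · rw [show rowUp α (colUp i (W.Mv t x)) ∅ ∅ = 0 by simp [rowUp_apply], zero_mul,
        sub_zero] at h2
      rw [← h2]
      refine Finset.sum_congr rfl fun p hp => ?_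
      rw [mm_eq_M hp, (hW.diffAt_M ht p.1 p.2).dx_eq ht, ite_mul, zero_mul]
    · rintro ⟨A, I⟩ hp
      have hc := (Finset.mem_filter.1 hp).2.2
      simp only at hc ⊢
      rw [rowUp_apply]
      by_cases hα : α ∈ A
      · by_cases hi : i ∈ I
        · have h1 := card_sdiff_singleton' hα
          have h2 := card_sdiff_singleton' hi
          rw [if_pos ⟨hα, hi⟩, if_pos hα, colUp_apply, if_pos hi, Mv,
            M_of_card_eq W (by omega), pow_add]
          ring
        · rw [if_neg (fun h => hi h.2), if_pos hα, colUp_apply, if_neg hi]; ring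
      · rw [if_neg (fun h => hα h.1), if_neg hα]
  simp only [h1] at h
  linarith

theorem IsSolution.evol_v (hW : W.IsSolution T) (hT : 0 < T) (ht : t ∈ Set.Icc 0 T) (i : Fin n) :
    dd T eT (W.v i) t x = -∑ j, W.v j t x * dd T (eX j) (W.v i) t x
      + ip (W.Mv t x) (W.dM T (eX i) t x)
      - ∑ j, ip (colUp j (colDown i (W.Mv t x))) (W.dM T (eX j) t x) := by
  have h := hW.eq_v i t ht x
  simp only [(hW.diffAt_v (x := x) ht i).dx_eq ht, (hW.diffAt_v (x := x) ht i).dt_eq hT ht,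
    (hW.c1_τ.diffAt ht x).dx_eq ht] at h
  rw [Finset.sum_comm (s := minorPairs n m)] at h
  have h1 : ∀ j, ∑ p ∈ minorPairs n m, (if j ∈ p.2 ∧ i ∉ p.2 \ {j} then
          (-1 : ℝ) ^ (ord p.2 j + ord (p.2 \ {j}) i) * W.mm p.1 ((p.2 \ {j}) ∪ {i}) t x
            * dx j (W.mm p.1 p.2) t x else 0)
        = ip (colUp j (colDown i (W.Mv t x))) (W.dM T (eX j) t x) := by
    intro j
    have h2 := sum_minorPairs_ip (T := T) (W := W) (t := t) (x := x)
      (colUp j (colDown i (W.Mv t x))) (eX j) (fun A I => if j ∈ I ∧ i ∉ I \ {j} then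
          (-1 : ℝ) ^ (ord I j + ord (I \ {j}) i) * W.mm A ((I \ {j}) ∪ {i}) t x else 0) ?_
    · rw [show colUp j (colDown i (W.Mv t x)) ∅ ∅ = 0 by simp [colUp_apply], zero_mul,
        sub_zero] at h2
      rw [← h2]
      refine Finset.sum_congr rfl fun p hp => ?_
      rw [mm_eq_M hp, (hW.diffAt_M ht p.1 p.2).dx_eq ht, ite_mul, zero_mul]
    · rintro ⟨A, I⟩ hp
      have hc := (Finset.mem_filter.1 hp).2.2
      simp only at hc ⊢
      rw [colUp_apply]
      by_cases hj : j ∈ I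
      · by_cases hi : i ∉ I \ {j}
        · rw [if_pos ⟨hj, hi⟩, if_pos hj, colDown_apply, if_pos hi, Mv,
            M_of_card_eq W (by rw [card_sdiff_union hj hi, hc]), pow_add]
          ring
        · rw [if_neg (fun h => hi h.2), if_pos hj, colDown_apply, if_neg hi]; ring
      · rw [if_neg (fun h => hj h.1), if_neg hj]
  have h3 : ∑ p ∈ minorPairs n m, W.mm p.1 p.2 t x * dx i (W.mm p.1 p.2) t x
      = ip (W.Mv t x) (W.dM T (eX i) t x) - W.τ t x * dd T (eX i) W.τ t x := by
    have h2 := sum_minorPairs_ip (T := T) (W := W) (t := t) (x := x)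
      (W.Mv t x) (eX i) (fun A I => W.M A I t x) (fun p _ => rfl)
    rw [show W.Mv t x ∅ ∅ = W.τ t x by rw [Mv, M_empty]] at h2
    rw [← h2]
    refine Finset.sum_congr rfl fun p hp => ?_
    rw [mm_eq_M hp, (hW.diffAt_M ht p.1 p.2).dx_eq ht]
  simp only [h1, h3] at h
  linarith

end State

end ExtremalSurface

/-! ### Evolution of `φ` and `ψ` -/

namespace ExtremalSurface

section Bilinear

variable {n m : ℕ}

/-- `phiB α` as a bilinear map. -/
def phiL (α : Fin m) : Minors m n →ₗ[ℝ] Minors m n →ₗ[ℝ] Minors m n :=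
  LinearMap.mk₂ ℝ (phiB α)
    (fun f f' g => by simp only [phiB, Pi.add_apply, add_smul, Finset.sum_add_distrib]; abel)
    (fun c f g => by
      simp only [phiB, Pi.smul_apply, smul_eq_mul, mul_smul, smul_sub, Finset.smul_sum])
    (fun f g g' => by
      simp only [phiB, map_add, smul_add, Finset.sum_add_distrib]; abel)
    (fun c f g => by
      simp only [phiB, map_smul, smul_sub, Finset.smul_sum, smul_comm c])

/-- `psiB i` as a bilinear map. -/
def psiL (i : Fin n) : Minors m n →ₗ[ℝ] Minors m n →ₗ[ℝ] Minors m n :=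
  LinearMap.mk₂ ℝ (psiB i)
    (fun f f' g => by simp only [psiB, Pi.add_apply, add_smul, Finset.sum_add_distrib]; abel)
    (fun c f g => by
      simp only [psiB, Pi.smul_apply, smul_eq_mul, mul_smul, smul_sub, Finset.smul_sum])
    (fun f g g' => by
      simp only [psiB, map_add, smul_add, Finset.sum_add_distrib]; abel)
    (fun c f g => by
      simp only [psiB, map_smul, smul_sub, Finset.smul_sum, smul_comm c])

/-- In the product rule for a bilinear map along `D`, the transport terms separate from the
terms of order zero. -/
theorem bilinear_transport (B : Minors m n →ₗ[ℝ] Minors m n →ₗ[ℝ] Minors m n) (v : Fin n → ℝ)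
    (f N : Minors m n) (g : Fin n → Minors m n) :
    B (-∑ j, v j • g j + N) f + B f (-∑ j, v j • g j + N)
      = -∑ j, v j • (B (g j) f + B f (g j)) + (B N f + B f N) := by
  simp only [map_add, map_neg, map_sum, map_smul, LinearMap.add_apply, LinearMap.neg_apply,
    LinearMap.sum_apply, LinearMap.smul_apply, smul_add, Finset.sum_add_distrib]
  abel

end Bilinear

namespace State

variable {n m : ℕ} {W : State n m} {T t : ℝ} {x : Space n}

/-- `φ^α_{A,I}` is `(-1)^{O_A(α)}` times the diagonal of `phiB α`. -/
theorem phi_eq (α : Fin m) {A : Finset (Fin m)} {I : Finset (Fin n)} (h : I.card = A.card + 1)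
    (t : ℝ) (x : Space n) :
    W.phi α A I t x = (-1 : ℝ) ^ ord A α * phiB α (W.Mv t x) (W.Mv t x) A I := by
  simp only [phi, phiB, Pi.sub_apply, Finset.sum_apply, Pi.smul_apply, smul_eq_mul, mul_sub,
    Finset.mul_sum]
  congr 1
  · rw [← Finset.sum_subset (Finset.subset_univ I)
      (fun i _ hi => by rw [colUp_apply, if_neg hi]; ring)]
    refine Finset.sum_congr rfl fun i hi => ?_
    have := card_sdiff_singleton' hi
    rw [colUp_apply, if_pos hi, Mv, Mv, M_singleton, M_of_card_eq W (by omega), pow_add]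
    ring
  · rw [rowDown_apply, Mv, Mv, M_empty]
    split_ifs with hα
    · ring
    · rw [M_of_card_eq W (by rw [card_union_singleton' hα, h])]
      linear_combination (-W.τ t x * W.mm (A ∪ {α}) I t x) * sign_mul_self A α

/-- `ψ^i_{A,I}` is `(-1)^{O_I(i)}` times the diagonal of `psiB i`. -/
theorem psi_eq (i : Fin n) {A : Finset (Fin m)} {I : Finset (Fin n)} (h : A.card = I.card + 1)
    (t : ℝ) (x : Space n) :
    W.psi i A I t x = (-1 : ℝ) ^ ord I i * psiB i (W.Mv t x) (W.Mv t x) A I := by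
  simp only [psi, psiB, Pi.sub_apply, Finset.sum_apply, Pi.smul_apply, smul_eq_mul, mul_sub,
    Finset.mul_sum]
  congr 1
  · rw [← Finset.sum_subset (Finset.subset_univ A)
      (fun i _ hi => by rw [rowUp_apply, if_neg hi]; ring)]
    refine Finset.sum_congr rfl fun α hα => ?_
    have := card_sdiff_singleton' hα
    rw [rowUp_apply, if_pos hα, Mv, Mv, M_singleton, M_of_card_eq W (by omega), pow_add]
    ring
  · rw [colDown_apply, Mv, Mv, M_empty]
    split_ifs with hi
    · ring
    · rw [M_of_card_eq W (by rw [card_union_singleton' hi, h])]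
      linear_combination (-W.τ t x * W.mm A (I ∪ {i}) t x) * sign_mul_self I i

theorem phiB_eq (α : Fin m) {A : Finset (Fin m)} {I : Finset (Fin n)} (h : I.card = A.card + 1)
    (t : ℝ) (x : Space n) :
    phiB α (W.Mv t x) (W.Mv t x) A I = (-1 : ℝ) ^ ord A α * W.phi α A I t x := by
  rw [phi_eq α h, ← mul_assoc, sign_mul_self, one_mul]

theorem psiB_eq (i : Fin n) {A : Finset (Fin m)} {I : Finset (Fin n)} (h : A.card = I.card + 1)
    (t : ℝ) (x : Space n) :
    psiB i (W.Mv t x) (W.Mv t x) A I = (-1 : ℝ) ^ ord I i * W.psi i A I t x := by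
  rw [psi_eq i h, ← mul_assoc, sign_mul_self, one_mul]

end State

section C1

variable {n : ℕ} {T : ℝ} {f g : Field n}

theorem IsC1.const (c : ℝ) : IsC1 T (fun _ (_ : Space n) => c) := contDiffOn_const

theorem IsC1.add (hf : IsC1 T f) (hg : IsC1 T g) : IsC1 T (fun t x => f t x + g t x) :=
  ContDiffOn.add hf hg

theorem IsC1.sub (hf : IsC1 T f) (hg : IsC1 T g) : IsC1 T (fun t x => f t x - g t x) :=
  ContDiffOn.sub hf hg

theorem IsC1.neg (hf : IsC1 T f) : IsC1 T (fun t x => -f t x) :=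
  ContDiffOn.neg hf

theorem IsC1.mul (hf : IsC1 T f) (hg : IsC1 T g) : IsC1 T (fun t x => f t x * g t x) :=
  ContDiffOn.mul hf hg

theorem IsC1.sum {ι : Type*} {s : Finset ι} {F : ι → Field n} (h : ∀ i ∈ s, IsC1 T (F i)) :
    IsC1 T (fun t x => ∑ i ∈ s, F i t x) :=
  ContDiffOn.sum h

theorem IsC1.inv (hf : IsC1 T f) (h0 : ∀ t ∈ Set.Icc 0 T, ∀ x, f t x ≠ 0) :
    IsC1 T (fun t x => (f t x)⁻¹) :=
  ContDiffOn.inv hf fun p hp => h0 p.1 hp.1 p.2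

end C1

namespace State

variable {n m : ℕ} {W : State n m} {T t : ℝ} {x : Space n}

theorem IsSolution.c1_colUp (hW : W.IsSolution T) (i : Fin n) (A I) :
    IsC1 T (fun s y => colUp i (W.Mv s y) A I) := by
  simp only [colUp_apply]
  split_ifs
  · exact (IsC1.const _).mul (hW.c1_M _ _)
  · exact IsC1.const 0

theorem IsSolution.c1_colDown (hW : W.IsSolution T) (i : Fin n) (A I) :
    IsC1 T (fun s y => colDown i (W.Mv s y) A I) := by
  simp only [colDown_apply]
  split_ifs
  · exact IsC1.const 0
  · exact (IsC1.const _).mul (hW.c1_M _ _)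

theorem IsSolution.c1_rowUp (hW : W.IsSolution T) (α : Fin m) (A I) :
    IsC1 T (fun s y => rowUp α (W.Mv s y) A I) := by
  simp only [rowUp_apply]
  split_ifs
  · exact (IsC1.const _).mul (hW.c1_M _ _)
  · exact IsC1.const 0

theorem IsSolution.c1_rowDown (hW : W.IsSolution T) (α : Fin m) (A I) :
    IsC1 T (fun s y => rowDown α (W.Mv s y) A I) := by
  simp only [rowDown_apply]
  split_ifs
  · exact IsC1.const 0
  · exact (IsC1.const _).mul (hW.c1_M _ _)

theorem IsSolution.dd_colUp (hW : W.IsSolution T) (hT : 0 < T) (ht : t ∈ Set.Icc 0 T) (i : Fin n)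
    (e A I) : dd T e (fun s y => colUp i (W.Mv s y) A I) t x = colUp i (W.dM T e t x) A I := by
  simp only [colUp_apply]
  split_ifs
  · exact dd_const_mul hT ht _ (hW.diffAt_M ht _ _)
  · exact dd_const 0

theorem IsSolution.dd_colDown (hW : W.IsSolution T) (hT : 0 < T) (ht : t ∈ Set.Icc 0 T)
    (i : Fin n) (e A I) :
    dd T e (fun s y => colDown i (W.Mv s y) A I) t x = colDown i (W.dM T e t x) A I := by
  simp only [colDown_apply]
  split_ifs
  · exact dd_const 0
  · exact dd_const_mul hT ht _ (hW.diffAt_M ht _ _)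

theorem IsSolution.dd_rowUp (hW : W.IsSolution T) (hT : 0 < T) (ht : t ∈ Set.Icc 0 T) (α : Fin m)
    (e A I) : dd T e (fun s y => rowUp α (W.Mv s y) A I) t x = rowUp α (W.dM T e t x) A I := by
  simp only [rowUp_apply]
  split_ifs
  · exact dd_const_mul hT ht _ (hW.diffAt_M ht _ _)
  · exact dd_const 0

theorem IsSolution.dd_rowDown (hW : W.IsSolution T) (hT : 0 < T) (ht : t ∈ Set.Icc 0 T)
    (α : Fin m) (e A I) :
    dd T e (fun s y => rowDown α (W.Mv s y) A I) t x = rowDown α (W.dM T e t x) A I := by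
  simp only [rowDown_apply]
  split_ifs
  · exact dd_const 0
  · exact dd_const_mul hT ht _ (hW.diffAt_M ht _ _)

theorem IsSolution.c1_phiB (hW : W.IsSolution T) (α : Fin m) (A I) :
    IsC1 T (fun s y => phiB α (W.Mv s y) (W.Mv s y) A I) := by
  simp only [phiB, Pi.sub_apply, Finset.sum_apply, Pi.smul_apply, smul_eq_mul]
  exact (IsC1.sum fun i _ => (hW.c1_M _ _).mul (hW.c1_colUp i A I)).sub
    ((hW.c1_M _ _).mul (hW.c1_rowDown α A I))

theorem IsSolution.c1_psiB (hW : W.IsSolution T) (i : Fin n) (A I) :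
    IsC1 T (fun s y => psiB i (W.Mv s y) (W.Mv s y) A I) := by
  simp only [psiB, Pi.sub_apply, Finset.sum_apply, Pi.smul_apply, smul_eq_mul]
  exact (IsC1.sum fun α _ => (hW.c1_M _ _).mul (hW.c1_rowUp α A I)).sub
    ((hW.c1_M _ _).mul (hW.c1_colDown i A I))

theorem IsSolution.dd_phiB (hW : W.IsSolution T) (hT : 0 < T) (ht : t ∈ Set.Icc 0 T) (α : Fin m)
    (e A I) : dd T e (fun s y => phiB α (W.Mv s y) (W.Mv s y) A I) t x
      = (phiB α (W.dM T e t x) (W.Mv t x) + phiB α (W.Mv t x) (W.dM T e t x)) A I := by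
  have hM : ∀ A I, DiffAt T (fun s y => W.Mv s y A I) t x := fun A I => hW.diffAt_M ht A I
  have hd : ∀ A I, dd T e (fun s y => W.Mv s y A I) t x = W.dM T e t x A I := fun _ _ => rfl
  have h1 := fun i => (hW.c1_colUp i A I).diffAt ht x
  have h2 := (hW.c1_rowDown α A I).diffAt ht x
  simp only [phiB, Pi.sub_apply, Finset.sum_apply, Pi.smul_apply, smul_eq_mul, Pi.add_apply]
  rw [dd_sub hT ht (DiffAt.sum fun i _ => (hM {α} {i}).mul (h1 i)) ((hM ∅ ∅).mul h2),
    dd_sum hT ht (fun i _ => (hM {α} {i}).mul (h1 i)), dd_mul hT ht (hM ∅ ∅) h2,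
    Finset.sum_congr rfl (fun i _ => dd_mul hT ht (hM {α} {i}) (h1 i)), Finset.sum_add_distrib]
  simp only [hW.dd_colUp hT ht, hW.dd_rowDown hT ht]
  simp only [hd]
  ring

theorem IsSolution.dd_psiB (hW : W.IsSolution T) (hT : 0 < T) (ht : t ∈ Set.Icc 0 T) (i : Fin n)
    (e A I) : dd T e (fun s y => psiB i (W.Mv s y) (W.Mv s y) A I) t x
      = (psiB i (W.dM T e t x) (W.Mv t x) + psiB i (W.Mv t x) (W.dM T e t x)) A I := by
  have hM : ∀ A I, DiffAt T (fun s y => W.Mv s y A I) t x := fun A I => hW.diffAt_M ht A I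
  have hd : ∀ A I, dd T e (fun s y => W.Mv s y A I) t x = W.dM T e t x A I := fun _ _ => rfl
  have h1 := fun α => (hW.c1_rowUp α A I).diffAt ht x
  have h2 := (hW.c1_colDown i A I).diffAt ht x
  simp only [psiB, Pi.sub_apply, Finset.sum_apply, Pi.smul_apply, smul_eq_mul, Pi.add_apply]
  rw [dd_sub hT ht (DiffAt.sum fun α _ => (hM {α} {i}).mul (h1 α)) ((hM ∅ ∅).mul h2),
    dd_sum hT ht (fun α _ => (hM {α} {i}).mul (h1 α)), dd_mul hT ht (hM ∅ ∅) h2,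
    Finset.sum_congr rfl (fun α _ => dd_mul hT ht (hM {α} {i}) (h1 α)), Finset.sum_add_distrib]
  simp only [hW.dd_rowUp hT ht, hW.dd_colDown hT ht]
  simp only [hd]
  ring

theorem IsSolution.evol_phiB (hW : W.IsSolution T) (hT : 0 < T) (ht : t ∈ Set.Icc 0 T)
    (α : Fin m) (A I) : dd T eT (fun s y => phiB α (W.Mv s y) (W.Mv s y) A I) t x
      = -∑ j, W.v j t x * dd T (eX j) (fun s y => phiB α (W.Mv s y) (W.Mv s y) A I) t x
        + ((∑ j, dd T (eX j) (W.v j) t x) * phiB α (W.Mv t x) (W.Mv t x) A I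
          + colFlow (fun k j => dd T (eX k) (W.v j) t x) (phiB α (W.Mv t x) (W.Mv t x)) A I
          + pairUp (fun k β => dd T (eX k) (W.d β) t x) (phiB α (W.Mv t x) (W.Mv t x)) A I) := by
  simp only [hW.dd_phiB hT ht]
  rw [hW.evol_M hT ht]
  have h := bilinear_transport (phiL α) (fun j => W.v j t x) (W.Mv t x)
    (colFlow (fun k j => dd T (eX k) (W.v j) t x) (W.Mv t x)
        - pairUp (fun k β => dd T (eX k) (W.d β) t x) (W.Mv t x)) (fun j => W.dM T (eX j) t x)
  simp only [phiL, LinearMap.mk₂_apply, phiB_flow] at h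
  rw [h]
  simp only [Pi.add_apply, Pi.neg_apply, Finset.sum_apply, Pi.smul_apply, smul_eq_mul]

theorem IsSolution.evol_psiB (hW : W.IsSolution T) (hT : 0 < T) (ht : t ∈ Set.Icc 0 T)
    (i : Fin n) (A I) : dd T eT (fun s y => psiB i (W.Mv s y) (W.Mv s y) A I) t x
      = -∑ j, W.v j t x * dd T (eX j) (fun s y => psiB i (W.Mv s y) (W.Mv s y) A I) t x
        + ((∑ j, dd T (eX j) (W.v j) t x) * psiB i (W.Mv t x) (W.Mv t x) A I
          + colFlow (fun k j => dd T (eX k) (W.v j) t x) (psiB i (W.Mv t x) (W.Mv t x)) A I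
          + pairUp (fun k β => dd T (eX k) (W.d β) t x) (psiB i (W.Mv t x) (W.Mv t x)) A I
          - ∑ k, dd T (eX i) (W.v k) t x * psiB k (W.Mv t x) (W.Mv t x) A I) := by
  simp only [hW.dd_psiB hT ht]
  rw [hW.evol_M hT ht]
  have h := bilinear_transport (psiL i) (fun j => W.v j t x) (W.Mv t x)
    (colFlow (fun k j => dd T (eX k) (W.v j) t x) (W.Mv t x)
        - pairUp (fun k β => dd T (eX k) (W.d β) t x) (W.Mv t x)) (fun j => W.dM T (eX j) t x)
  simp only [psiL, LinearMap.mk₂_apply, psiB_flow] at h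
  rw [h]
  simp only [Pi.add_apply, Pi.sub_apply, Pi.neg_apply, Finset.sum_apply, Pi.smul_apply,
    smul_eq_mul]

theorem IsSolution.evol_phi (hW : W.IsSolution T) (hT : 0 < T) (ht : t ∈ Set.Icc 0 T)
    (α : Fin m) (A : Finset (Fin m)) (I : Finset (Fin n)) (h : I.card = A.card + 1) :
    dt T (W.phi α A I) t x =
      2 * W.phi α A I t x * ∑ j, dx j (W.v j) t x - ∑ j, W.v j t x * dx j (W.phi α A I) t x
        - ∑ j, ∑ k, (if j ∈ I ∧ k ∉ I \ {j} then
            (-1 : ℝ) ^ (ord (I \ {j}) k + ord I j) * W.phi α A ((I \ {j}) ∪ {k}) t x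
              * dx j (W.v k) t x
          else 0)
        + ∑ β, ∑ j, (if β ∈ A ∧ j ∈ I then
            (-1 : ℝ) ^ (ord A α + ord A β + ord (A \ {β}) α + ord I j)
              * W.phi α (A \ {β}) (I \ {j}) t x * dx j (W.d β) t x
          else 0) := by
  have hc := hW.c1_phiB α A I
  have hc' := (IsC1.const ((-1 : ℝ) ^ ord A α)).mul hc
  rw [show W.phi α A I = fun s y => (-1 : ℝ) ^ ord A α * phiB α (W.Mv s y) (W.Mv s y) A I from
    funext fun s => funext fun y => phi_eq α h s y]
  simp only [(hc'.diffAt ht x).dt_eq hT ht, fun j => (hc'.diffAt ht x).dx_eq ht j,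
    fun e => dd_const_mul (e := e) hT ht ((-1 : ℝ) ^ ord A α) (hc.diffAt ht x),
    hW.evol_phiB hT ht, colFlow_eq,
    fun i j => (hW.diffAt_v (x := x) ht i).dx_eq ht j,
    fun i j => (hW.diffAt_d (x := x) ht i).dx_eq ht j]
  have h1 : ∑ j, ∑ k, (if j ∈ I ∧ k ∉ I \ {j} then
        (-1 : ℝ) ^ (ord (I \ {j}) k + ord I j) * W.phi α A ((I \ {j}) ∪ {k}) t x
          * dd T (eX j) (W.v k) t x else 0)
      = (-1) ^ ord A α * ∑ j, ∑ k, dd T (eX j) (W.v k) t x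
        * colUp j (colDown k (phiB α (W.Mv t x) (W.Mv t x))) A I := by
    simp only [Finset.mul_sum]
    refine Finset.sum_congr rfl fun j _ => Finset.sum_congr rfl fun k _ => ?_
    rw [colUp_apply]
    by_cases hj : j ∈ I
    · by_cases hk : k ∉ I \ {j}
      · rw [if_pos ⟨hj, hk⟩, if_pos hj, colDown_apply, if_pos hk,
          phi_eq α (by rw [card_sdiff_union hj hk, h]), pow_add]
        ring
      · rw [if_neg (fun h => hk h.2), if_pos hj, colDown_apply, if_neg hk]; ring
    · rw [if_neg (fun h => hj h.1), if_neg hj]; ring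
  have h2 : ∑ β, ∑ j, (if β ∈ A ∧ j ∈ I then
        (-1 : ℝ) ^ (ord A α + ord A β + ord (A \ {β}) α + ord I j)
          * W.phi α (A \ {β}) (I \ {j}) t x * dd T (eX j) (W.d β) t x else 0)
      = (-1) ^ ord A α * ∑ j, ∑ β, dd T (eX j) (W.d β) t x
        * rowUp β (colUp j (phiB α (W.Mv t x) (W.Mv t x))) A I := by
    rw [Finset.sum_comm]
    simp only [Finset.mul_sum]
    refine Finset.sum_congr rfl fun j _ => Finset.sum_congr rfl fun β _ => ?_
    rw [rowUp_apply]
    by_cases hβ : β ∈ A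
    · by_cases hj : j ∈ I
      · have e1 := card_sdiff_singleton' hβ
        have e2 := card_sdiff_singleton' hj
        rw [if_pos ⟨hβ, hj⟩, if_pos hβ, colUp_apply, if_pos hj, phiB_eq α (by omega), pow_add,
          pow_add, pow_add]
        ring
      · rw [if_neg (fun h => hj h.2), if_pos hβ, colUp_apply, if_neg hj]; ring
    · rw [if_neg (fun h => hβ h.1), if_neg hβ]; ring
  rw [h1, h2]
  simp only [pairUp_apply, Pi.sub_apply, Pi.smul_apply, Finset.sum_apply, smul_eq_mul]
  have h3 : ∑ j, W.v j t x * ((-1) ^ ord A α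
        * dd T (eX j) (fun s y => phiB α (W.Mv s y) (W.Mv s y) A I) t x)
      = (-1) ^ ord A α * ∑ j, W.v j t x
        * dd T (eX j) (fun s y => phiB α (W.Mv s y) (W.Mv s y) A I) t x := by
    rw [Finset.mul_sum]
    exact Finset.sum_congr rfl fun j _ => by ring
  rw [h3]
  ring

theorem IsSolution.evol_psi (hW : W.IsSolution T) (hT : 0 < T) (ht : t ∈ Set.Icc 0 T)
    (i : Fin n) (A : Finset (Fin m)) (I : Finset (Fin n)) (h : A.card = I.card + 1) :
    dt T (W.psi i A I) t x =
      2 * W.psi i A I t x * ∑ j, dx j (W.v j) t x - ∑ j, W.v j t x * dx j (W.psi i A I) t x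
        - ∑ k, (-1 : ℝ) ^ (ord I i + ord I k) * W.psi k A I t x * dx i (W.v k) t x
        + ∑ β ∈ A, ∑ j ∈ I,
            (-1 : ℝ) ^ (ord A β + ord I j + ord I i + ord (I \ {j}) i)
              * W.psi i (A \ {β}) (I \ {j}) t x * dx j (W.d β) t x
        - ∑ j, ∑ k, (if j ∈ I ∧ k ∉ I \ {j} then
            (-1 : ℝ) ^ (ord I i + ord I j + ord (I \ {j}) k + ord ((I \ {j}) ∪ {k}) i)
              * W.psi i A ((I \ {j}) ∪ {k}) t x * dx j (W.v k) t x
          else 0) := by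
  have hc := hW.c1_psiB i A I
  have hc' := (IsC1.const ((-1 : ℝ) ^ ord I i)).mul hc
  rw [show (∑ k, (-1 : ℝ) ^ (ord I i + ord I k) * W.psi k A I t x * dx i (W.v k) t x)
    = (-1 : ℝ) ^ ord I i * ∑ k, dd T (eX i) (W.v k) t x * psiB k (W.Mv t x) (W.Mv t x) A I by
      rw [Finset.mul_sum]
      refine Finset.sum_congr rfl fun k _ => ?_
      rw [psiB_eq k h, (hW.diffAt_v ht k).dx_eq ht, pow_add]; ring]
  rw [show W.psi i A I = fun s y => (-1 : ℝ) ^ ord I i * psiB i (W.Mv s y) (W.Mv s y) A I from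
    funext fun s => funext fun y => psi_eq i h s y]
  simp only [(hc'.diffAt ht x).dt_eq hT ht, fun j => (hc'.diffAt ht x).dx_eq ht j,
    fun e => dd_const_mul (e := e) hT ht ((-1 : ℝ) ^ ord I i) (hc.diffAt ht x),
    hW.evol_psiB hT ht, colFlow_eq,
    fun i j => (hW.diffAt_v (x := x) ht i).dx_eq ht j,
    fun i j => (hW.diffAt_d (x := x) ht i).dx_eq ht j]
  have h1 : ∑ j, ∑ k, (if j ∈ I ∧ k ∉ I \ {j} then
        (-1 : ℝ) ^ (ord I i + ord I j + ord (I \ {j}) k + ord ((I \ {j}) ∪ {k}) i)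
          * W.psi i A ((I \ {j}) ∪ {k}) t x
          * dd T (eX j) (W.v k) t x else 0)
      = (-1) ^ ord I i * ∑ j, ∑ k, dd T (eX j) (W.v k) t x
        * colUp j (colDown k (psiB i (W.Mv t x) (W.Mv t x))) A I := by
    simp only [Finset.mul_sum]
    refine Finset.sum_congr rfl fun j _ => Finset.sum_congr rfl fun k _ => ?_
    rw [colUp_apply]
    by_cases hj : j ∈ I
    · by_cases hk : k ∉ I \ {j}
      · rw [if_pos ⟨hj, hk⟩, if_pos hj, colDown_apply, if_pos hk,
          psiB_eq i (by rw [card_sdiff_union hj hk, h]), pow_add, pow_add, pow_add]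
        ring
      · rw [if_neg (fun h => hk h.2), if_pos hj, colDown_apply, if_neg hk]; ring
    · rw [if_neg (fun h => hj h.1), if_neg hj]; ring
  have h2 : ∑ β ∈ A, ∑ j ∈ I,
        (-1 : ℝ) ^ (ord A β + ord I j + ord I i + ord (I \ {j}) i)
          * W.psi i (A \ {β}) (I \ {j}) t x * dd T (eX j) (W.d β) t x
      = (-1) ^ ord I i * ∑ j, ∑ β, dd T (eX j) (W.d β) t x
        * rowUp β (colUp j (psiB i (W.Mv t x) (W.Mv t x))) A I := by
    rw [Finset.sum_comm (s := Finset.univ), Finset.mul_sum]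
    rw [← Finset.sum_subset (Finset.subset_univ A)
      (fun β _ hβ => by simp [rowUp_apply, hβ])]
    refine Finset.sum_congr rfl fun β hβ => ?_
    rw [← Finset.sum_subset (Finset.subset_univ I)
      (fun j _ hj => by simp [rowUp_apply, hβ, colUp_apply, hj]), Finset.mul_sum]
    refine Finset.sum_congr rfl fun j hj => ?_
    have e1 := card_sdiff_singleton' hβ
    have e2 := card_sdiff_singleton' hj
    rw [rowUp_apply, if_pos hβ, colUp_apply, if_pos hj, psiB_eq i (by omega), pow_add,
      pow_add, pow_add]
    ring
  rw [h1, h2]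
  simp only [pairUp_apply, Pi.sub_apply, Pi.smul_apply, Finset.sum_apply, smul_eq_mul]
  have h3 : ∑ j, W.v j t x * ((-1) ^ ord I i
        * dd T (eX j) (fun s y => psiB i (W.Mv s y) (W.Mv s y) A I) t x)
      = (-1) ^ ord I i * ∑ j, W.v j t x
        * dd T (eX j) (fun s y => psiB i (W.Mv s y) (W.Mv s y) A I) t x := by
    rw [Finset.mul_sum]
    exact Finset.sum_congr rfl fun j _ => by ring
  rw [h3]
  ring

end State

end ExtremalSurface

/-! ### Evolution of `ω` and `λ` -/

namespace ExtremalSurface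

/-- A sum over all pairs whose terms vanish for `|I| ≠ |A| + 1` is a sum over `bigPairs` and the
terms of the pairs `(∅, {k})`. -/
theorem sum_eq_sum_bigPairs {n m : ℕ} (f : Finset (Fin m) → Finset (Fin n) → ℝ)
    (h : ∀ A I, I.card ≠ A.card + 1 → f A I = 0) :
    ∑ A, ∑ I, f A I = ∑ k, f ∅ {k} + ∑ p ∈ bigPairs n m, f p.1 p.2 := by
  have h1 : ∑ k, f ∅ {k} = ∑ A, ∑ I, if A = ∅ ∧ I.card = 1 then f A I else 0 := by
    symm
    rw [Finset.sum_eq_single ∅ (fun A _ hA => by simp [hA]) (by simp)]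
    simp only [true_and, ← Finset.sum_filter]
    rw [Finset.univ_filter_card_eq, Finset.powersetCard_one, Finset.sum_map]
    rfl
  rw [h1, bigPairs, Finset.sum_filter, Fintype.sum_prod_type, ← Finset.sum_add_distrib]
  refine Finset.sum_congr rfl fun A _ => ?_
  rw [← Finset.sum_add_distrib]
  refine Finset.sum_congr rfl fun I _ => ?_
  by_cases hc : I.card = A.card + 1
  · by_cases hA : A = ∅
    · subst hA; simp at hc; simp [hc]
    · have := Finset.card_pos.2 (Finset.nonempty_iff_ne_empty.2 hA)
      rw [if_neg (fun h => hA h.1), if_pos ⟨by simp only; omega, hc⟩, zero_add]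
  · simp [h A I hc]

section Inner

variable {n m : ℕ}

theorem ip_colDown (i : Fin n) (f g : Minors m n) : ip (colDown i f) g = ip f (colUp i g) := by
  rw [ip_comm, ← ip_colUp, ip_comm]

theorem ip_colUp_psiB (i j : Fin n) (f g : Minors m n) :
    ip (colUp j (psiB i f f)) g = ∑ α, f {α} {i} * ip (rowUp α (colUp j f)) g
      - f ∅ ∅ * ip (colUp j (colDown i f)) g := by
  simp only [psiB, map_sub, map_sum, map_smul, colUp_rowUp, ip_comm _ g, ip_sub, ip_sum, ip_smul]

/-- The quadratic form of the flow, in terms of the vectors `c_j f`: this is what turns the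
terms `∂v` and `∂d` of the equation of `λ` into derivatives of products. -/
theorem ip_flow (V : Fin n → Fin n → ℝ) (D : Fin n → Fin m → ℝ) (f : Minors m n) :
    ip f (colFlow V f - pairUp D f) = ∑ j, ip (colUp j f)
      (∑ i, V j i • colUp i f - ∑ α, D j α • rowDown α f) := by
  simp only [colFlow_apply, pairUp_apply, ip_sub, ip_sum, ip_smul, Finset.sum_sub_distrib,
    ← ip_colUp, ← ip_rowUp]
  congr 1
  · exact Finset.sum_congr rfl fun j _ => Finset.sum_congr rfl fun i _ => by
      rw [ip_comm (colUp j f)]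
  · exact Finset.sum_congr rfl fun j _ => Finset.sum_congr rfl fun i _ => by
      rw [ip_comm f]

/-- The right-hand side of the equation of `v_i`, after `c†_i c_j = δ_{ij} - c_j c†_i`. -/
theorem ip_colUp_colUp (i : Fin n) (f : Minors m n) (g : Fin n → Minors m n) :
    ip f (g i) - ∑ j, ip (colUp j (colDown i f)) (g j)
      = ∑ j, ip (colUp j f) (colUp i (g j)) := by
  have h : ∀ j, ip (colUp j f) (colUp i (g j))
      = (if i = j then ip f (g j) else 0) - ip (colUp j (colDown i f)) (g j) := by
    intro j
    rw [← ip_colDown, colDown_colUp, ip_comm, ip_sub]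
    congr 1
    · split_ifs
      · exact ip_comm _ _
      · simp [ip]
    · exact ip_comm _ _
  simp only [h, Finset.sum_sub_distrib, Finset.sum_ite_eq, Finset.mem_univ, if_true]

end Inner

namespace State

variable {n m : ℕ} {W : State n m} {T t : ℝ} {x : Space n}

theorem om_eq (i : Fin n) :
    W.om i = fun s y => W.τ s y * W.v i s y - ∑ α, W.M {α} {i} s y * W.d α s y := by
  funext s y; simp only [om, M_singleton]

theorem IsSolution.c1_om (hW : W.IsSolution T) (i : Fin n) : IsC1 T (W.om i) := by
  rw [om_eq]
  exact (hW.c1_τ.mul (hW.c1_v i)).sub (IsC1.sum fun α _ => (hW.c1_M _ _).mul (hW.c1_d α))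

theorem IsSolution.dd_om (hW : W.IsSolution T) (hT : 0 < T) (ht : t ∈ Set.Icc 0 T) (i : Fin n)
    (e) : dd T e (W.om i) t x = W.dM T e t x ∅ ∅ * W.v i t x + W.τ t x * dd T e (W.v i) t x
      - (∑ α, W.dM T e t x {α} {i} * W.d α t x + ∑ α, W.Mv t x {α} {i} * dd T e (W.d α) t x) := by
  have hτ := hW.c1_τ.diffAt ht x
  have hv := hW.diffAt_v (x := x) ht i
  have hd := fun α => hW.diffAt_d (x := x) ht α
  have hM := fun α => hW.diffAt_M (x := x) ht {α} {i}
  rw [om_eq, dd_sub hT ht (hτ.mul hv) (DiffAt.sum fun α _ => (hM α).mul (hd α)),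
    dd_mul hT ht hτ hv, dd_sum hT ht (fun α _ => (hM α).mul (hd α)),
    Finset.sum_congr rfl (fun α _ => dd_mul hT ht (hM α) (hd α)), Finset.sum_add_distrib]
  simp only [dM, M_empty, Mv]

theorem lam_eq : W.lam = fun s y => (1 / 2) * (∑ A, ∑ I, W.M A I s y ^ 2
    + ∑ i, W.v i s y ^ 2 + ∑ α, W.d α s y ^ 2 - 1) := by
  funext s y
  rw [sum_eq_sum_minorPairs (fun A I => W.M A I s y ^ 2) (fun A I hc => by
    rw [M_of_card_ne W hc]; simp), M_empty, lam,
    show ∑ p ∈ minorPairs n m, W.mm p.1 p.2 s y ^ 2 = ∑ p ∈ minorPairs n m, W.M p.1 p.2 s y ^ 2 from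
      Finset.sum_congr rfl (fun p hp => by rw [mm_eq_M hp])]
  ring

theorem IsSolution.c1_lam (hW : W.IsSolution T) : IsC1 T W.lam := by
  rw [lam_eq]
  simp only [pow_two]
  exact (IsC1.const _).mul ((((IsC1.sum fun A _ => IsC1.sum fun I _ =>
    (hW.c1_M A I).mul (hW.c1_M A I)).add (IsC1.sum fun i _ => (hW.c1_v i).mul (hW.c1_v i))).add
    (IsC1.sum fun α _ => (hW.c1_d α).mul (hW.c1_d α))).sub (IsC1.const 1))

theorem IsSolution.dd_lam (hW : W.IsSolution T) (hT : 0 < T) (ht : t ∈ Set.Icc 0 T) (e) :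
    dd T e W.lam t x = ip (W.Mv t x) (W.dM T e t x) + ∑ i, W.v i t x * dd T e (W.v i) t x
      + ∑ α, W.d α t x * dd T e (W.d α) t x := by
  have hv := fun i => hW.diffAt_v (x := x) ht i
  have hd := fun α => hW.diffAt_d (x := x) ht α
  have hM := fun A I => hW.diffAt_M (x := x) ht A I
  have s1 : DiffAt T (fun s y => ∑ A, ∑ I, W.M A I s y ^ 2) t x :=
    DiffAt.sum fun A _ => DiffAt.sum fun I _ => (hM A I).sq
  have s2 : DiffAt T (fun s y => ∑ i, W.v i s y ^ 2) t x := DiffAt.sum fun i _ => (hv i).sq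
  have s3 : DiffAt T (fun s y => ∑ α, W.d α s y ^ 2) t x := DiffAt.sum fun i _ => (hd i).sq
  rw [lam_eq, dd_const_mul hT ht _ (((s1.add s2).add s3).sub (DiffAt.const 1)),
    dd_sub hT ht ((s1.add s2).add s3) (DiffAt.const 1), dd_const, dd_add hT ht (s1.add s2) s3,
    dd_add hT ht s1 s2, dd_sum hT ht (fun A _ => DiffAt.sum fun I _ => (hM A I).sq),
    dd_sum hT ht (fun i _ => (hv i).sq), dd_sum hT ht (fun i _ => (hd i).sq),
    Finset.sum_congr rfl (fun A _ => dd_sum hT ht (fun I _ => (hM A I).sq))]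
  simp only [dd_sq hT ht (hM _ _), dd_sq hT ht (hv _), dd_sq hT ht (hd _), mul_assoc,
    ← Finset.mul_sum, ip, Mv, dM]
  ring

theorem IsSolution.evol_om_ip (hW : W.IsSolution T) (hT : 0 < T) (ht : t ∈ Set.Icc 0 T)
    (i : Fin n) : dd T eT (W.om i) t x =
      W.om i t x * ∑ j, dd T (eX j) (W.v j) t x - ∑ j, W.om j t x * dd T (eX i) (W.v j) t x
        - ∑ j, W.v j t x * dd T (eX j) (W.om i) t x + W.τ t x * dd T (eX i) W.lam t x
        + ∑ j, ip (colUp j (psiB i (W.Mv t x) (W.Mv t x))) (W.dM T (eX j) t x) := by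
  have hτ : W.Mv t x ∅ ∅ = W.τ t x := by rw [Mv, M_empty]
  simp only [hW.dd_om hT ht, hW.dd_lam hT ht, hW.evol_M hT ht, hW.evol_v hT ht, hW.evol_d hT ht,
    ip_colUp_psiB, Pi.add_apply, Pi.sub_apply, Pi.neg_apply, Finset.sum_apply, Pi.smul_apply,
    smul_eq_mul, colFlow_empty, pairUp_empty, colFlow_singleton, pairUp_singleton, hτ]
  rw [show W.om i t x = W.τ t x * W.v i t x - ∑ α, W.Mv t x {α} {i} * W.d α t x by rw [om_eq]; rfl]
  simp only [show ∀ j, W.om j t x = W.τ t x * W.v j t x - ∑ α, W.Mv t x {α} {j} * W.d α t x from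
    fun j => by rw [om_eq]; rfl]
  simp only [mul_add, mul_sub, add_mul, sub_mul, neg_mul, mul_neg, Finset.sum_add_distrib,
    Finset.sum_sub_distrib, Finset.sum_neg_distrib]
  have e1 : ∑ α, (∑ j, W.v j t x * W.dM T (eX j) t x {α} {i}) * W.d α t x
      = ∑ j, W.v j t x * ∑ α, W.dM T (eX j) t x {α} {i} * W.d α t x := by
    simp only [Finset.sum_mul, Finset.mul_sum]
    rw [Finset.sum_comm]
    exact Finset.sum_congr rfl fun _ _ => Finset.sum_congr rfl fun _ _ => by ring
  have e2 : ∑ α, W.Mv t x {α} {i} * ∑ j, W.v j t x * dd T (eX j) (W.d α) t x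
      = ∑ j, W.v j t x * ∑ α, W.Mv t x {α} {i} * dd T (eX j) (W.d α) t x := by
    simp only [Finset.mul_sum]
    rw [Finset.sum_comm]
    exact Finset.sum_congr rfl fun _ _ => Finset.sum_congr rfl fun _ _ => by ring
  have e3 : ∑ α, (∑ j, dd T (eX i) (W.v j) t x * W.Mv t x {α} {j}) * W.d α t x
      = ∑ j, (∑ α, W.Mv t x {α} {j} * W.d α t x) * dd T (eX i) (W.v j) t x := by
    simp only [Finset.sum_mul]
    rw [Finset.sum_comm]
    exact Finset.sum_congr rfl fun _ _ => Finset.sum_congr rfl fun _ _ => by ring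
  have e4 : ∑ α, W.Mv t x {α} {i} * ∑ j, ip (rowUp α (colUp j (W.Mv t x))) (W.dM T (eX j) t x)
      = ∑ j, ∑ α, W.Mv t x {α} {i} * ip (rowUp α (colUp j (W.Mv t x))) (W.dM T (eX j) t x) := by
    simp only [Finset.mul_sum]
    rw [Finset.sum_comm]
  have e5 : (∑ j, W.v j t x * W.dM T (eX j) t x ∅ ∅) * W.v i t x
      = ∑ j, W.v j t x * (W.dM T (eX j) t x ∅ ∅ * W.v i t x) := by
    simp only [Finset.sum_mul]
    exact Finset.sum_congr rfl fun _ _ => by ring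
  have e6 : ∑ j, W.v j t x * (W.τ t x * dd T (eX j) (W.v i) t x)
      = W.τ t x * ∑ j, W.v j t x * dd T (eX j) (W.v i) t x := by
    simp only [Finset.mul_sum]
    exact Finset.sum_congr rfl fun _ _ => by ring
  have e7 : ∑ j, W.τ t x * W.v j t x * dd T (eX i) (W.v j) t x
      = W.τ t x * ∑ j, W.v j t x * dd T (eX i) (W.v j) t x := by
    simp only [Finset.mul_sum]
    exact Finset.sum_congr rfl fun _ _ => by ring
  have e8 : ∑ α, dd T (eX i) (W.d α) t x * W.τ t x * W.d α t x
      = W.τ t x * ∑ α, W.d α t x * dd T (eX i) (W.d α) t x := by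
    simp only [Finset.mul_sum]
    exact Finset.sum_congr rfl fun _ _ => by ring
  have e9 : ∑ α, (∑ j, dd T (eX j) (W.v j) t x) * W.Mv t x {α} {i} * W.d α t x
      = (∑ j, dd T (eX j) (W.v j) t x) * ∑ α, W.Mv t x {α} {i} * W.d α t x := by
    rw [Finset.mul_sum]
    exact Finset.sum_congr rfl fun _ _ => by ring
  have e10 : ∑ j, W.τ t x * ip (colUp j (colDown i (W.Mv t x))) (W.dM T (eX j) t x)
      = W.τ t x * ∑ j, ip (colUp j (colDown i (W.Mv t x))) (W.dM T (eX j) t x) := by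
    rw [Finset.mul_sum]
  rw [e1, e2, e3, e4, e5, e6, e7, e8, e9, e10]
  ring

/-- The family `∑ v_i c_i m - ∑ d_α a†_α m`, whose divergence drives `λ`. -/
def Z (A : Finset (Fin m)) (I : Finset (Fin n)) : Field n := fun s y =>
  ∑ i, W.v i s y * colUp i (W.Mv s y) A I - ∑ α, W.d α s y * rowDown α (W.Mv s y) A I

variable (W) in
/-- The space derivatives of `Z` at a point. -/
noncomputable def dZ (T : ℝ) (j : Fin n) (t : ℝ) (x : Space n) : Minors m n :=
  fun A I => dd T (eX j) (Z (W := W) A I) t x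

theorem IsSolution.dZ_eq (hW : W.IsSolution T) (hT : 0 < T) (ht : t ∈ Set.Icc 0 T) (j : Fin n) :
    W.dZ T j t x = (∑ i, dd T (eX j) (W.v i) t x • colUp i (W.Mv t x)
        - ∑ α, dd T (eX j) (W.d α) t x • rowDown α (W.Mv t x))
      + (∑ i, W.v i t x • colUp i (W.dM T (eX j) t x)
        - ∑ α, W.d α t x • rowDown α (W.dM T (eX j) t x)) := by
  funext A I
  have hv := fun i => hW.diffAt_v (x := x) ht i
  have hd := fun α => hW.diffAt_d (x := x) ht α
  have h1 := fun i => (hW.c1_colUp i A I).diffAt ht x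
  have h2 := fun α => (hW.c1_rowDown α A I).diffAt ht x
  unfold dZ Z
  rw [dd_sub hT ht (DiffAt.sum fun i _ => (hv i).mul (h1 i))
    (DiffAt.sum fun α _ => (hd α).mul (h2 α)), dd_sum hT ht (fun i _ => (hv i).mul (h1 i)),
    dd_sum hT ht (fun α _ => (hd α).mul (h2 α)),
    Finset.sum_congr rfl (fun i _ => dd_mul hT ht (hv i) (h1 i)),
    Finset.sum_congr rfl (fun α _ => dd_mul hT ht (hd α) (h2 α))]
  simp only [hW.dd_colUp hT ht, hW.dd_rowDown hT ht, Finset.sum_add_distrib, Pi.add_apply,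
    Pi.sub_apply, Finset.sum_apply, Pi.smul_apply, smul_eq_mul]
  ring

theorem IsSolution.evol_lam_ip (hW : W.IsSolution T) (hT : 0 < T) (ht : t ∈ Set.Icc 0 T) :
    dd T eT W.lam t x = -∑ j, W.v j t x * dd T (eX j) W.lam t x
      + ∑ j, ip (colUp j (W.Mv t x)) (W.dZ T j t x) := by
  simp only [hW.dZ_eq hT ht, ip_add, Finset.sum_add_distrib]
  rw [← ip_flow (fun j i => dd T (eX j) (W.v i) t x) (fun j α => dd T (eX j) (W.d α) t x)]
  simp only [hW.dd_lam hT ht]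
  rw [hW.evol_M hT ht, ip_add]
  have hv : ∀ i, dd T eT (W.v i) t x = -∑ j, W.v j t x * dd T (eX j) (W.v i) t x
      + ∑ j, ip (colUp j (W.Mv t x)) (colUp i (W.dM T (eX j) t x)) := by
    intro i
    rw [hW.evol_v hT ht, ← ip_colUp_colUp i (W.Mv t x) fun j => W.dM T (eX j) t x]
    ring
  simp only [hv, hW.evol_d hT ht, ip_rowUp]
  have e0 : ip (W.Mv t x) (-∑ j, W.v j t x • W.dM T (eX j) t x)
      = -∑ j, W.v j t x * ip (W.Mv t x) (W.dM T (eX j) t x) := by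
    rw [← neg_one_smul ℝ, ip_smul, ip_sum]
    simp only [ip_smul]; ring
  rw [e0]
  simp only [ip_sub, ip_sum, ip_smul, mul_add, mul_sub, mul_neg, Finset.sum_add_distrib,
    Finset.sum_sub_distrib, Finset.sum_neg_distrib]
  have e1 : ∑ i, W.v i t x * ∑ j, W.v j t x * dd T (eX j) (W.v i) t x
      = ∑ j, W.v j t x * ∑ i, W.v i t x * dd T (eX j) (W.v i) t x := by
    simp only [Finset.mul_sum]
    rw [Finset.sum_comm]
    exact Finset.sum_congr rfl fun _ _ => Finset.sum_congr rfl fun _ _ => by ring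
  have e2 : ∑ α, W.d α t x * ∑ j, W.v j t x * dd T (eX j) (W.d α) t x
      = ∑ j, W.v j t x * ∑ α, W.d α t x * dd T (eX j) (W.d α) t x := by
    simp only [Finset.mul_sum]
    rw [Finset.sum_comm]
    exact Finset.sum_congr rfl fun _ _ => Finset.sum_congr rfl fun _ _ => by ring
  have e3 : ∑ i, W.v i t x * ∑ j, ip (colUp j (W.Mv t x)) (colUp i (W.dM T (eX j) t x))
      = ∑ j, ∑ i, W.v i t x * ip (colUp j (W.Mv t x)) (colUp i (W.dM T (eX j) t x)) := by
    simp only [Finset.mul_sum]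
    rw [Finset.sum_comm]
  have e4 : ∑ α, W.d α t x * ∑ j, ip (colUp j (W.Mv t x)) (rowDown α (W.dM T (eX j) t x))
      = ∑ j, ∑ α, W.d α t x * ip (colUp j (W.Mv t x)) (rowDown α (W.dM T (eX j) t x)) := by
    simp only [Finset.mul_sum]
    rw [Finset.sum_comm]
  rw [e1, e2, e3, e4]
  ring

/-- Where `τ ≠ 0`, `Z` is a combination of the constraint functions `ω` and `φ`. -/
theorem Z_eq (h : W.τ t x ≠ 0) (A I) : Z (W := W) A I t x
    = ∑ i, colUp i (W.Mv t x) A I * W.om i t x / W.τ t x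
      + ∑ α, phiB α (W.Mv t x) (W.Mv t x) A I * W.d α t x / W.τ t x := by
  rw [← Finset.sum_div, ← Finset.sum_div, ← add_div, eq_div_iff h]
  simp only [Z, om_eq, phiB, Pi.sub_apply, Finset.sum_apply, Pi.smul_apply, smul_eq_mul, mul_sub,
    sub_mul, Finset.sum_sub_distrib, Finset.sum_mul, Finset.mul_sum]
  simp only [show W.Mv t x ∅ ∅ = W.τ t x by rw [Mv, M_empty]]
  rw [show ∑ i, ∑ α, colUp i (W.Mv t x) A I * (W.M {α} {i} t x * W.d α t x)
      = ∑ α, ∑ i, W.Mv t x {α} {i} * colUp i (W.Mv t x) A I * W.d α t x by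
    rw [Finset.sum_comm]
    exact Finset.sum_congr rfl fun _ _ => Finset.sum_congr rfl fun _ _ => by simp only [Mv]; ring]
  rw [show ∑ i, W.v i t x * colUp i (W.Mv t x) A I * W.τ t x
      = ∑ i, colUp i (W.Mv t x) A I * (W.τ t x * W.v i t x) from
    Finset.sum_congr rfl fun _ _ => by ring]
  rw [show ∑ α, W.d α t x * rowDown α (W.Mv t x) A I * W.τ t x
      = ∑ α, W.τ t x * rowDown α (W.Mv t x) A I * W.d α t x from
    Finset.sum_congr rfl fun _ _ => by ring]
  ring

theorem Z_singleton (k : Fin n) : Z (W := W) ∅ {k} = fun s y => -1 * W.om k s y := by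
  funext s y
  have h : ∀ i, W.v i s y * colUp i (W.Mv s y) ∅ {k}
      = if i = k then -(W.v i s y * W.τ s y) else 0 := by
    intro i
    rw [colUp_apply]
    by_cases hi : i = k
    · subst hi; simp [ord_singleton_self, Mv, M_empty]
    · simp [hi]
  simp only [Z, h, om_eq]
  simp [rowDown_apply, ord_empty, Mv, mul_comm]
  ring

theorem IsSolution.evol_om (hW : W.IsSolution T) (hT : 0 < T) (ht : t ∈ Set.Icc 0 T)
    (i : Fin n) : dt T (W.om i) t x =
      W.om i t x * ∑ j, dx j (W.v j) t x - ∑ j, W.om j t x * dx i (W.v j) t x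
        - ∑ j, W.v j t x * dx j (W.om i) t x + W.τ t x * dx i W.lam t x
        + ∑ p ∈ minorPairs n m, ∑ j, (if j ∈ p.2 then
            (-1 : ℝ) ^ (ord p.2 j + ord (p.2 \ {j}) i) * dx j (W.mm p.1 p.2) t x
              * W.psi i p.1 (p.2 \ {j}) t x
          else 0) := by
  rw [Finset.sum_comm (s := minorPairs n m)]
  have h1 : ∀ j, ∑ p ∈ minorPairs n m, (if j ∈ p.2 then
            (-1 : ℝ) ^ (ord p.2 j + ord (p.2 \ {j}) i) * dx j (W.mm p.1 p.2) t x
              * W.psi i p.1 (p.2 \ {j}) t x else 0)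
      = ip (colUp j (psiB i (W.Mv t x) (W.Mv t x))) (W.dM T (eX j) t x) := by
    intro j
    have h2 := sum_minorPairs_ip (T := T) (W := W) (t := t) (x := x)
      (colUp j (psiB i (W.Mv t x) (W.Mv t x))) (eX j) (fun A I => if j ∈ I then
          (-1 : ℝ) ^ (ord I j + ord (I \ {j}) i) * W.psi i A (I \ {j}) t x else 0) ?_
    · rw [show colUp j (psiB i (W.Mv t x) (W.Mv t x)) ∅ ∅ = 0 by simp [colUp_apply], zero_mul,
        sub_zero] at h2
      rw [← h2]
      refine Finset.sum_congr rfl fun p hp => ?_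
      rw [mm_eq_M hp, (hW.diffAt_M ht p.1 p.2).dx_eq ht, ite_mul, zero_mul]
      congr 1
      ring
    · rintro ⟨A, I⟩ hp
      have hc := (Finset.mem_filter.1 hp).2.2
      simp only at hc ⊢
      rw [colUp_apply]
      by_cases hj : j ∈ I
      · have := card_sdiff_singleton' hj
        rw [if_pos hj, if_pos hj, psiB_eq i (by omega), pow_add]
        ring
      · rw [if_neg hj, if_neg hj]
  simp only [h1, ((hW.c1_om i).diffAt ht x).dt_eq hT ht, hW.evol_om_ip hT ht i,
    fun j => ((hW.c1_om i).diffAt ht x).dx_eq ht j, fun j => (hW.c1_lam.diffAt ht x).dx_eq ht j,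
    fun i j => (hW.diffAt_v (x := x) ht i).dx_eq ht j]

theorem IsSolution.evol_lam (hW : W.IsSolution T) (hT : 0 < T) (ht : t ∈ Set.Icc 0 T)
    (h0 : W.τ t x ≠ 0) : dt T W.lam t x =
      -∑ j, W.v j t x * dx j W.lam t x + W.τ t x * ∑ i, dx i (W.om i) t x
        + ∑ p ∈ bigPairs n m, ∑ i, ∑ j, (if i ∈ p.2 ∧ j ∈ p.2 then
            (-1 : ℝ) ^ (ord p.2 i + ord p.2 j) * W.mm p.1 (p.2 \ {j}) t x
              * dx j (fun s y => W.mm p.1 (p.2 \ {i}) s y * W.om i s y / W.τ s y) t x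
          else 0)
        + ∑ p ∈ bigPairs n m, ∑ α, ∑ i, (if i ∈ p.2 then
            (-1 : ℝ) ^ (ord p.1 α + ord p.2 i) * W.mm p.1 (p.2 \ {i}) t x
              * dx i (fun s y => W.phi α p.1 p.2 s y * W.d α s y / W.τ s y) t x
          else 0) := by
  have hτ := hW.c1_τ.diffAt ht x
  rw [(hW.c1_lam.diffAt ht x).dt_eq hT ht, hW.evol_lam_ip hT ht]
  simp only [fun j => (hW.c1_lam.diffAt ht x).dx_eq ht j,
    fun i j => ((hW.c1_om i).diffAt ht x).dx_eq ht j]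
  rw [add_assoc, add_assoc, add_right_inj, ← Finset.sum_add_distrib]
  have hsum : ∑ j, ip (colUp j (W.Mv t x)) (W.dZ T j t x)
      = ∑ A, ∑ I, ∑ j, colUp j (W.Mv t x) A I * W.dZ T j t x A I := by
    simp only [ip]
    rw [Finset.sum_comm]
    exact Finset.sum_congr rfl fun A _ => Finset.sum_comm
  rw [hsum, sum_eq_sum_bigPairs]
  · congr 1
    -- the pairs `(∅, {k})` give the term `τ ∂_k ω_k`
    · rw [Finset.mul_sum]
      refine Finset.sum_congr rfl fun k _ => ?_
      rw [Finset.sum_eq_single k (fun j _ hj => by simp [colUp_apply, hj]) (by simp), dZ,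
        Z_singleton, dd_const_mul hT ht _ ((hW.c1_om k).diffAt ht x), colUp_apply]
      simp [ord_singleton_self, Mv, M_empty]
    · refine Finset.sum_congr rfl ?_
      rintro ⟨A, I⟩ hp
      obtain ⟨-, -, hc⟩ := Finset.mem_filter.1 hp
      simp only at hc ⊢
      rw [Finset.sum_comm (γ := Fin n), Finset.sum_comm (γ := Fin m), ← Finset.sum_add_distrib]
      refine Finset.sum_congr rfl fun j _ => ?_
      by_cases hj : j ∈ I
      swap
      · simp [hj, colUp_apply]
      have hcj := card_sdiff_singleton' hj
      have q1 : ∀ i, DiffAt T (fun s y => colUp i (W.Mv s y) A I * W.om i s y / W.τ s y) t x :=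
        fun i => (((hW.c1_colUp i A I).diffAt ht x).mul ((hW.c1_om i).diffAt ht x)).div hτ h0
      have q2 : ∀ α, DiffAt T
          (fun s y => phiB α (W.Mv s y) (W.Mv s y) A I * W.d α s y / W.τ s y) t x :=
        fun α => (((hW.c1_phiB α A I).diffAt ht x).mul (hW.diffAt_d ht α)).div hτ h0
      have hZ : W.dZ T j t x A I
          = ∑ i, dd T (eX j) (fun s y => colUp i (W.Mv s y) A I * W.om i s y / W.τ s y) t x
            + ∑ α, dd T (eX j)
              (fun s y => phiB α (W.Mv s y) (W.Mv s y) A I * W.d α s y / W.τ s y) t x := by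
        rw [← dd_sum hT ht (fun i _ => q1 i), ← dd_sum hT ht (fun α _ => q2 α),
          ← dd_add hT ht (DiffAt.sum fun i _ => q1 i) (DiffAt.sum fun α _ => q2 α)]
        refine dd_congr ?_ (Z_eq h0 A I)
        filter_upwards [hτ.continuousWithinAt.eventually_ne h0] with p hp using Z_eq hp A I
      rw [hZ, mul_add, Finset.mul_sum, Finset.mul_sum, colUp_apply, if_pos hj, Mv,
        M_of_card_eq W (by omega)]
      congr 1
      · refine Finset.sum_congr rfl fun i _ => ?_
        by_cases hi : i ∈ I
        · have hci := card_sdiff_singleton' hi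
          have q3 : DiffAt T (fun s y => W.mm A (I \ {i}) s y * W.om i s y / W.τ s y) t x := by
            rw [← M_of_card_eq W (by omega)]
            exact ((hW.diffAt_M ht _ _).mul ((hW.c1_om i).diffAt ht x)).div hτ h0
          rw [if_pos ⟨hi, hj⟩, q3.dx_eq ht]
          have e : (fun s y => colUp i (W.Mv s y) A I * W.om i s y / W.τ s y)
              = fun s y => (-1 : ℝ) ^ ord I i
                * (W.mm A (I \ {i}) s y * W.om i s y / W.τ s y) := by
            funext s y
            rw [colUp_apply, if_pos hi, Mv, M_of_card_eq W (by omega)]; ring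
          rw [e, dd_const_mul hT ht _ q3, pow_add]
          ring
        · rw [if_neg (fun h => hi h.1)]
          simp only [colUp_apply, if_neg hi, zero_mul, zero_div, dd_const, mul_zero]
      · refine Finset.sum_congr rfl fun α _ => ?_
        have e : (fun s y => W.phi α A I s y * W.d α s y / W.τ s y)
            = fun s y => (-1 : ℝ) ^ ord A α
              * (phiB α (W.Mv s y) (W.Mv s y) A I * W.d α s y / W.τ s y) := by
          funext s y
          rw [phi_eq α hc]; ring
        have q3 := (DiffAt.const (T := T) (t := t) (x := x) ((-1 : ℝ) ^ ord A α)).mul (q2 α)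
        rw [if_pos hj, e, q3.dx_eq ht, dd_const_mul hT ht _ (q2 α), pow_add]
        linear_combination (-(-1 : ℝ) ^ ord I j * W.mm A (I \ {j}) t x * dd T (eX j)
          (fun s y => phiB α (W.Mv s y) (W.Mv s y) A I * W.d α s y / W.τ s y) t x)
          * sign_mul_self A α
  · intro A I hc
    refine Finset.sum_eq_zero fun j _ => ?_
    rw [colUp_apply]
    split_ifs with hj
    · have := card_sdiff_singleton' hj
      rw [Mv_of_card_ne W (by omega)]; ring
    · ring

theorem IsSolution.constraintEvolution (hW : W.IsSolution T) (hT : 0 < T)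
    (ht : t ∈ Set.Icc 0 T) : W.ConstraintEvolution T t x where
  evol_om := hW.evol_om hT ht
  evol_lam := hW.evol_lam hT ht
  evol_phi := hW.evol_phi hT ht
  evol_psi := hW.evol_psi hT ht

end State

end ExtremalSurface

/-! ### Integrals of compactly supported fields, and the cutoff -/

namespace ExtremalSurface

section Integrals

open MeasureTheory

variable {n : ℕ} {T : ℝ}

theorem IsC1.continuousOn_dd {f : Field n} (hT : 0 < T) (h : IsC1 T f) (e : ℝ × Space n) :
    ContinuousOn (fun p : ℝ × Space n => dd T e f p.1 p.2) (Set.Icc 0 T ×ˢ Set.univ) := by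
  have h1 := ContDiffOn.continuousOn_fderivWithin h (uniqueDiffOn_slab hT) le_rfl
  exact h1.clm_apply continuousOn_const

theorem continuous_slice {f : Field n}
    (h : ContinuousOn (fun p : ℝ × Space n => f p.1 p.2) (Set.Icc 0 T ×ˢ Set.univ))
    {t : ℝ} (ht : t ∈ Set.Icc 0 T) : Continuous (f t) := by
  rw [← continuousOn_univ]
  exact h.comp (f := fun x : Space n => (t, x)) (by fun_prop) fun x _ => ⟨ht, trivial⟩

theorem exists_bound_on_ball {f : Field n}
    (h : ContinuousOn (fun p : ℝ × Space n => f p.1 p.2) (Set.Icc 0 T ×ˢ Set.univ))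
    (x₀ : Space n) (R : ℝ) :
    ∃ C, ∀ t ∈ Set.Icc 0 T, ∀ x ∈ Metric.closedBall x₀ R, |f t x| ≤ C := by
  have hK : IsCompact (Set.Icc 0 T ×ˢ Metric.closedBall x₀ R) :=
    isCompact_Icc.prod (isCompact_closedBall x₀ R)
  obtain ⟨C, hC⟩ := hK.exists_bound_of_continuousOn
    (h.mono (Set.prod_mono le_rfl (Set.subset_univ _)))
  exact ⟨C, fun t ht x hx => hC (t, x) ⟨ht, hx⟩⟩

theorem dd_eT_eq_of_hasDerivWithinAt {f : Field n} {t : ℝ} {x : Space n} (hT : 0 < T)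
    (ht : t ∈ Set.Icc 0 T) (h : DiffAt T f t x) {d : ℝ}
    (hd : HasDerivWithinAt (fun s => f s x) d (Set.Icc 0 T) t) : dd T eT f t x = d :=
  (uniqueDiffOn_Icc hT t ht).eq_deriv _ h.hasDerivWithinAt hd

theorem dd_eX_eq_of_hasFDerivAt {f : Field n} {t : ℝ} {x : Space n}
    (ht : t ∈ Set.Icc 0 T) (h : DiffAt T f t x) {d : Space n →L[ℝ] ℝ}
    (hd : HasFDerivAt (f t) d x) (j : Fin n) :
    dd T (eX j) f t x = d (EuclideanSpace.single j 1) := by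
  rw [← h.dx_eq ht, dx, hd.fderiv]

theorem dd_eT_eq_zero_off_ball {f : Field n} (hT : 0 < T) (h : IsC1 T f) {x₀ : Space n} {R : ℝ}
    (hs : ∀ t ∈ Set.Icc 0 T, ∀ x, x ∉ Metric.closedBall x₀ R → f t x = 0)
    {t : ℝ} (ht : t ∈ Set.Icc 0 T) {x : Space n} (hx : x ∉ Metric.closedBall x₀ R) :
    dd T eT f t x = 0 := by
  refine dd_eT_eq_of_hasDerivWithinAt hT ht (h.diffAt ht x) ?_
  exact (hasDerivWithinAt_const t _ (0 : ℝ)).congr (fun s hs' => hs s hs' x hx) (hs t ht x hx)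

theorem integrable_of_off_ball {f : Space n → ℝ} (hf : Continuous f) {x₀ : Space n} {R : ℝ}
    (hs : ∀ x, x ∉ Metric.closedBall x₀ R → f x = 0) : Integrable f :=
  hf.integrable_of_hasCompactSupport (HasCompactSupport.intro (isCompact_closedBall x₀ R)
    fun x hx => hs x hx)

theorem hasDerivAt_integral_of_off_ball {f : Field n} (hT : 0 < T) (h : IsC1 T f) {x₀ : Space n}
    {R : ℝ} (hs : ∀ t ∈ Set.Icc 0 T, ∀ x, x ∉ Metric.closedBall x₀ R → f t x = 0)
    {t : ℝ} (ht : t ∈ Set.Ioo 0 T) :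
    HasDerivAt (fun s => ∫ x, f s x) (∫ x, dd T eT f t x) t := by
  obtain ⟨C, hC⟩ := exists_bound_on_ball (h.continuousOn_dd hT eT) x₀ R
  have ht' := Set.Ioo_subset_Icc_self ht
  refine (hasDerivAt_integral_of_dominated_loc_of_deriv_le (F' := fun s x => dd T eT f s x)
    (bound := (Metric.closedBall x₀ R).indicator fun _ => C) (Ioo_mem_nhds ht.1 ht.2)
    ?_ ?_ ?_ ?_ ?_ ?_).2
  · filter_upwards [Ioo_mem_nhds ht.1 ht.2] with s hs'
    exact (continuous_slice h.continuousOn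
      (Set.Ioo_subset_Icc_self hs')).aestronglyMeasurable
  · exact integrable_of_off_ball (continuous_slice h.continuousOn ht') (hs t ht')
  · exact (continuous_slice (h.continuousOn_dd hT eT) ht').aestronglyMeasurable
  · refine Filter.Eventually.of_forall fun x s hs' => ?_
    have hs' := Set.Ioo_subset_Icc_self hs'
    by_cases hx : x ∈ Metric.closedBall x₀ R
    · rw [Set.indicator_of_mem hx]; exact hC s hs' x hx
    · rw [dd_eT_eq_zero_off_ball hT h hs hs' hx, Set.indicator_of_notMem hx]; simp
  · rw [integrable_indicator_iff measurableSet_closedBall]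
    exact integrableOn_const (isCompact_closedBall x₀ R).measure_lt_top.ne
  · refine Filter.Eventually.of_forall fun x s hs' => ?_
    exact (h.diffAt (Set.Ioo_subset_Icc_self hs') x).hasDerivWithinAt.hasDerivAt
      (Icc_mem_nhds hs'.1 hs'.2)

theorem dd_eX_eq_zero_off_ball {f : Field n} (h : IsC1 T f) {x₀ : Space n} {R : ℝ}
    (hs : ∀ t ∈ Set.Icc 0 T, ∀ x, x ∉ Metric.closedBall x₀ R → f t x = 0)
    {t : ℝ} (ht : t ∈ Set.Icc 0 T) {x : Space n} (hx : x ∉ Metric.closedBall x₀ R) (j : Fin n) :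
    dd T (eX j) f t x = 0 := by
  rw [dd_eX_eq_of_hasFDerivAt (d := 0) ht (h.diffAt ht x) ?_ j]
  · rfl
  · refine (hasFDerivAt_const (0 : ℝ) x).congr_of_eventuallyEq ?_
    filter_upwards [Metric.isClosed_closedBall.isOpen_compl.mem_nhds hx] with y hy
    exact hs t ht y hy

theorem integral_dd_eX_eq_zero {f : Field n} (hT : 0 < T) (h : IsC1 T f) {x₀ : Space n} {R : ℝ}
    (hs : ∀ t ∈ Set.Icc 0 T, ∀ x, x ∉ Metric.closedBall x₀ R → f t x = 0)
    {t : ℝ} (ht : t ∈ Set.Icc 0 T) (j : Fin n) : ∫ x, dd T (eX j) f t x = 0 := by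
  have hd : ∀ x, fderiv ℝ (f t) x (EuclideanSpace.single j 1) = dd T (eX j) f t x := fun x =>
    (h.diffAt ht x).dx_eq ht j
  have := integral_mul_fderiv_eq_neg_fderiv_mul_of_integrable (μ := volume)
    (f := fun _ : Space n => (1 : ℝ)) (g := f t) (v := EuclideanSpace.single j 1)
    (by simp) ?_ ?_ (by simp) (fun x _ => ((h.diffAt ht x).hasFDerivAt ht).differentiableAt)
  · simpa [hd] using this
  · simp only [hd, one_mul]
    exact integrable_of_off_ball (continuous_slice (h.continuousOn_dd hT _) ht)
      fun x hx => dd_eX_eq_zero_off_ball h hs ht hx j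
  · simp only [one_mul]
    exact integrable_of_off_ball (continuous_slice h.continuousOn ht) (hs t ht)

end Integrals

section Cutoff

variable {n : ℕ} {T : ℝ}

/-- A smooth cutoff function, positive inside the paraboloid `|x - x₀|² + L t < R²` and zero
outside. -/
noncomputable def cutoff (R L : ℝ) (x₀ : Space n) : Field n :=
  fun t x => expNegInvGlue (R ^ 2 - L * t - ‖x - x₀‖ ^ 2)

theorem cutoff_c1 (R L : ℝ) (x₀ : Space n) : IsC1 T (cutoff R L x₀) := by
  have h : ContDiff ℝ 1 (fun p : ℝ × Space n => R ^ 2 - L * p.1 - ‖p.2 - x₀‖ ^ 2) := by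
    have h2 : ContDiff ℝ 1 (fun p : ℝ × Space n => ‖p.2 - x₀‖ ^ 2) :=
      (contDiff_snd.sub contDiff_const).norm_sq ℝ
    exact (contDiff_const.sub (contDiff_const.mul contDiff_fst)).sub h2
  exact ((expNegInvGlue.contDiff (n := 1)).comp h).contDiffOn

theorem cutoff_nonneg (R L : ℝ) (x₀ : Space n) (t x) : 0 ≤ cutoff R L x₀ t x :=
  expNegInvGlue.nonneg _

theorem cutoff_off_ball {R L : ℝ} (hR : 0 ≤ R) (hL : 0 ≤ L) {x₀ : Space n} {t : ℝ} (ht : 0 ≤ t)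
    {x : Space n} (hx : x ∉ Metric.closedBall x₀ R) : cutoff R L x₀ t x = 0 := by
  refine expNegInvGlue.zero_of_nonpos ?_
  rw [Metric.mem_closedBall, dist_eq_norm, not_le] at hx
  nlinarith [mul_nonneg hL ht]

theorem hasDerivAt_glue (s : ℝ) : HasDerivAt expNegInvGlue (deriv expNegInvGlue s) s :=
  ((expNegInvGlue.contDiff (n := 1)).differentiable one_ne_zero s).hasDerivAt

theorem deriv_glue_nonneg (s : ℝ) : 0 ≤ deriv expNegInvGlue s :=
  expNegInvGlue.monotone.deriv_nonneg

theorem deriv_glue_of_neg {s : ℝ} (hs : s < 0) : deriv expNegInvGlue s = 0 := by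
  refine ((hasDerivAt_const s (0 : ℝ)).congr_of_eventuallyEq ?_).deriv
  filter_upwards [Iio_mem_nhds hs] with r hr using expNegInvGlue.zero_of_nonpos (le_of_lt hr)

/-- The cutoff decreases in time at least as fast as `L / (2 R)` times its slope in space. -/
theorem cutoff_decay (hT : 0 < T) {R L κ : ℝ} (hκ0 : 0 ≤ κ) (hL : L = 2 * κ * R)
    (hR : 0 ≤ R)
    (x₀ : Space n) {t : ℝ} (ht : t ∈ Set.Icc 0 T) (x : Space n) (e : ℝ) (Q : Fin n → ℝ)
    (hκ : ∑ j, |Q j| ≤ κ * e) :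
    dd T eT (cutoff R L x₀) t x * e + ∑ j, dd T (eX j) (cutoff R L x₀) t x * Q j ≤ 0 := by
  set g := R ^ 2 - L * t - ‖x - x₀‖ ^ 2 with hg
  have hd := (cutoff_c1 (T := T) R L x₀).diffAt ht x
  have h1 : dd T eT (cutoff R L x₀) t x = deriv expNegInvGlue g * (-L) := by
    refine dd_eT_eq_of_hasDerivWithinAt hT ht hd (HasDerivAt.hasDerivWithinAt ?_)
    have : HasDerivAt (fun s => R ^ 2 - L * s - ‖x - x₀‖ ^ 2) (-L) t := by
      simpa using (((hasDerivAt_id t).const_mul L).const_sub (R ^ 2)).sub_const (‖x - x₀‖ ^ 2)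
    exact (hasDerivAt_glue g).comp t this
  have h2 : ∀ j, dd T (eX j) (cutoff R L x₀) t x
      = deriv expNegInvGlue g * (-(2 * inner ℝ (x - x₀) (EuclideanSpace.single j 1))) := by
    intro j
    have h3 : HasFDerivAt (fun y : Space n => R ^ 2 - L * t - ‖y - x₀‖ ^ 2)
        (-(2 • (innerSL ℝ (x - x₀)).comp (ContinuousLinearMap.id ℝ (Space n)))) x :=
      (((hasFDerivAt_id x).sub_const x₀).norm_sq).const_sub _
    rw [dd_eX_eq_of_hasFDerivAt ht hd ((hasDerivAt_glue g).comp_hasFDerivAt x h3) j]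
    simp [inner_sub_left]
  by_cases hneg : g < 0
  · simp [h1, h2, deriv_glue_of_neg hneg]
  · rw [h1, Finset.sum_congr rfl fun j _ => by rw [h2 j]]
    have hx : ‖x - x₀‖ ≤ R := by
      have hLt : 0 ≤ L * t := mul_nonneg (by rw [hL]; positivity) ht.1
      exact abs_le_of_sq_le_sq' (by linarith [not_lt.1 hneg]) hR |>.2
    have h4 : ∀ j, deriv expNegInvGlue g
          * (-(2 * inner ℝ (x - x₀) (EuclideanSpace.single j 1))) * Q j
        ≤ deriv expNegInvGlue g * (2 * R * |Q j|) := by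
      intro j
      rw [mul_assoc]
      refine mul_le_mul_of_nonneg_left ?_ (deriv_glue_nonneg g)
      have h5 := abs_real_inner_le_norm (x - x₀) (EuclideanSpace.single j (1 : ℝ))
      rw [PiLp.norm_single, norm_one, mul_one] at h5
      calc _ ≤ |-(2 * inner ℝ (x - x₀) (EuclideanSpace.single j 1)) * Q j| := le_abs_self _
        _ = 2 * |inner ℝ (x - x₀) (EuclideanSpace.single j 1)| * |Q j| := by
          rw [abs_mul, abs_neg, abs_mul, abs_two]
        _ ≤ _ := by gcongr; exact h5.trans hx
    calc _ ≤ deriv expNegInvGlue g * -L * e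
          + ∑ j, deriv expNegInvGlue g * (2 * R * |Q j|) :=
        add_le_add le_rfl (Finset.sum_le_sum fun j _ => h4 j)
      _ = deriv expNegInvGlue g * (2 * R * (∑ j, |Q j| - κ * e)) := by
        rw [← Finset.mul_sum, ← Finset.mul_sum, hL]; ring
      _ ≤ 0 := mul_nonpos_of_nonneg_of_nonpos (deriv_glue_nonneg g)
        (mul_nonpos_of_nonneg_of_nonpos (by positivity) (by linarith))

end Cutoff

end ExtremalSurface

/-! ### Uniqueness for symmetric hyperbolic systems -/

namespace ExtremalSurface

open MeasureTheory

section SymmetricHyperbolic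

variable {n : ℕ} {T : ℝ} {ι : Type*} [Fintype ι]

theorem sum_abs_sq_le (u : ι → ℝ) : (∑ q, |u q|) ^ 2 ≤ Fintype.card ι * ∑ q, u q ^ 2 := by
  have := sq_sum_le_card_mul_sum_sq (s := Finset.univ) (f := fun q => |u q|)
  simpa using this

/-- A quadratic form with coefficients of size at most `C`, bounded by the sum of squares. -/
theorem sum_sum_abs_le {C : ℝ} (u : ι → ℝ) (a : ι → ι → ℝ) (ha : ∀ q r, |a q r| ≤ C)
    (hC : 0 ≤ C) :
    |∑ q, ∑ r, u q * a q r * u r| ≤ C * Fintype.card ι * ∑ q, u q ^ 2 := by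
  calc |∑ q, ∑ r, u q * a q r * u r| ≤ ∑ q, ∑ r, |u q| * C * |u r| := by
        refine (Finset.abs_sum_le_sum_abs _ _).trans (Finset.sum_le_sum fun q _ => ?_)
        refine (Finset.abs_sum_le_sum_abs _ _).trans (Finset.sum_le_sum fun r _ => ?_)
        rw [abs_mul, abs_mul]
        gcongr
        exact ha q r
    _ = C * (∑ q, |u q|) ^ 2 := by
        rw [pow_two, Finset.sum_mul_sum, Finset.mul_sum]
        refine Finset.sum_congr rfl fun q _ => ?_
        rw [Finset.mul_sum]
        exact Finset.sum_congr rfl fun r _ => by ring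
    _ ≤ _ := by
        rw [mul_assoc]
        exact mul_le_mul_of_nonneg_left (sum_abs_sq_le u) hC

/-- Gronwall's inequality for a nonnegative function that vanishes at `0`. -/
theorem eq_zero_of_deriv_le {E E' : ℝ → ℝ} {K : ℝ} (hE : ContinuousOn E (Set.Icc 0 T))
    (hE' : ∀ t ∈ Set.Ioo 0 T, HasDerivAt E (E' t) t) (hK : ∀ t ∈ Set.Ioo 0 T, E' t ≤ K * E t)
    (h0 : E 0 = 0) (hpos : ∀ t ∈ Set.Icc 0 T, 0 ≤ E t) {t : ℝ} (ht : t ∈ Set.Icc 0 T) :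
    E t = 0 := by
  have hd : ∀ s ∈ Set.Ioo 0 T, HasDerivAt (fun s => Real.exp (-K * s) * E s)
      (Real.exp (-K * s) * (-K) * E s + Real.exp (-K * s) * E' s) s := by
    intro s hs
    have h1 : HasDerivAt (fun s => Real.exp (-K * s)) (Real.exp (-K * s) * (-K)) s := by
      simpa using ((hasDerivAt_id s).const_mul (-K)).exp
    exact h1.mul (hE' s hs)
  have hanti : AntitoneOn (fun s => Real.exp (-K * s) * E s) (Set.Icc 0 T) := by
    refine antitoneOn_of_deriv_nonpos (convex_Icc 0 T)
      (ContinuousOn.mul (by fun_prop) hE) ?_ ?_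
    · rw [interior_Icc]
      exact fun s hs => (hd s hs).differentiableAt.differentiableWithinAt
    · rw [interior_Icc]
      intro s hs
      rw [(hd s hs).deriv]
      nlinarith [hK s hs, Real.exp_pos (-K * s)]
  have h1 := hanti ⟨le_rfl, ht.1.trans ht.2⟩ ht ht.1
  simp only [h0, mul_zero] at h1
  have h2 := hpos t ht
  have h3 := Real.exp_pos (-K * t)
  by_contra hne
  have : 0 < E t := lt_of_le_of_ne h2 (Ne.symm hne)
  linarith [mul_pos h3 this]

/-- The pointwise energy inequality, as an algebraic fact about the values and derivatives at a
point: `c`, `c₀`, `cx` stand for the cutoff and its derivatives, `ut`, `ux` for the derivatives of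
the solution, `ax` for those of the coefficients. -/
theorem energy_inequality {K C' c c₀ : ℝ} (hc : 0 ≤ c) (hK : 0 ≤ K) (hC' : 0 ≤ C')
    (cx : Fin n → ℝ) (u ut : ι → ℝ) (ux : Fin n → ι → ℝ) (a ax : Fin n → ι → ι → ℝ)
    (hsym : ∀ j q r, a j q r = a j r q) (hax : ∀ j q r, |ax j q r| ≤ C')
    (heq : ∀ q, |ut q + ∑ j, ∑ r, a j q r * ux j r| ≤ K * ∑ r, |u r|)
    (hcut : c₀ * ∑ q, u q ^ 2 + ∑ j, cx j * ∑ q, ∑ r, u q * a j q r * u r ≤ 0) :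
    (c₀ * ∑ q, u q ^ 2 + c * ∑ q, 2 * u q * ut q)
      + ∑ j, (cx j * ∑ q, ∑ r, u q * a j q r * u r
        + c * ∑ q, ∑ r, ((ux j q * a j q r + u q * ax j q r) * u r + u q * a j q r * ux j r))
      ≤ (2 * K * Fintype.card ι + n * (C' * Fintype.card ι)) * (c * ∑ q, u q ^ 2) := by
  have e1 : ∑ j, ∑ q, ∑ r, ((ux j q * a j q r + u q * ax j q r) * u r + u q * a j q r * ux j r)
      = ∑ j, ∑ q, ∑ r, u q * ax j q r * u r
        + ∑ q, 2 * u q * ∑ j, ∑ r, a j q r * ux j r := by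
    have e2 : ∑ q, 2 * u q * ∑ j, ∑ r, a j q r * ux j r
        = ∑ j, ∑ q, ∑ r, 2 * (u q * a j q r * ux j r) := by
      rw [Finset.sum_comm]
      refine Finset.sum_congr rfl fun q _ => ?_
      rw [Finset.mul_sum]
      refine Finset.sum_congr rfl fun j _ => ?_
      rw [Finset.mul_sum]
      exact Finset.sum_congr rfl fun r _ => by ring
    rw [e2, ← Finset.sum_add_distrib]
    refine Finset.sum_congr rfl fun j _ => ?_
    -- by the symmetry of the coefficients the two terms with a derivative of `u` agree
    have e3 : ∑ q, ∑ r, ux j q * a j q r * u r = ∑ q, ∑ r, u q * a j q r * ux j r := by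
      rw [Finset.sum_comm]
      exact Finset.sum_congr rfl fun q _ => Finset.sum_congr rfl fun r _ => by
        rw [hsym j r q]; ring
    simp only [add_mul, Finset.sum_add_distrib, e3, ← Finset.mul_sum]
    ring
  have e4 : ∑ q, 2 * u q * (ut q + ∑ j, ∑ r, a j q r * ux j r)
      ≤ 2 * K * Fintype.card ι * ∑ q, u q ^ 2 := by
    calc _ ≤ ∑ q, 2 * |u q| * (K * ∑ r, |u r|) := by
          refine Finset.sum_le_sum fun q _ => (le_abs_self _).trans ?_
          rw [abs_mul, abs_mul, abs_two]
          gcongr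
          exact heq q
      _ = 2 * K * (∑ q, |u q|) ^ 2 := by
          rw [← Finset.sum_mul, ← Finset.mul_sum]; ring
      _ ≤ _ := by
          rw [mul_assoc _ (Fintype.card ι : ℝ)]
          exact mul_le_mul_of_nonneg_left (sum_abs_sq_le u) (by positivity)
  have e5 : ∑ j, ∑ q, ∑ r, u q * ax j q r * u r
      ≤ n * (C' * Fintype.card ι) * ∑ q, u q ^ 2 := by
    calc _ ≤ ∑ _j : Fin n, C' * Fintype.card ι * ∑ q, u q ^ 2 :=
          Finset.sum_le_sum fun j _ => (le_abs_self _).trans (sum_sum_abs_le u _ (hax j) hC')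
      _ = _ := by simp; ring
  rw [Finset.sum_add_distrib, ← Finset.mul_sum, e1]
  have e6 := mul_le_mul_of_nonneg_left (add_le_add e4 e5) hc
  simp only [mul_add, Finset.sum_add_distrib] at e6 ⊢
  linarith

/-- Uniqueness for linear symmetric hyperbolic systems with bounded continuously differentiable
coefficients, whose terms of order zero are only locally bounded: a classical solution that
vanishes at time `0` vanishes identically. -/
theorem symmetric_hyperbolic_unique (hT : 0 < T) (u : ι → Field n) (a : Fin n → ι → ι → Field n)
    (hu : ∀ q, IsC1 T (u q)) (ha : ∀ j q r, IsC1 T (a j q r))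
    (hsym : ∀ j q r t x, a j q r t x = a j r q t x)
    (hb : ∃ C, ∀ j q r, ∀ t ∈ Set.Icc 0 T, ∀ x, |a j q r t x| ≤ C)
    (heq : ∀ x₀ R, ∃ K, ∀ t ∈ Set.Icc 0 T, ∀ x ∈ Metric.closedBall x₀ R, ∀ q,
      |dd T eT (u q) t x + ∑ j, ∑ r, a j q r t x * dd T (eX j) (u r) t x|
        ≤ K * ∑ r, |u r t x|)
    (h0 : ∀ q x, u q 0 x = 0) {t₀ : ℝ} (ht₀ : t₀ ∈ Set.Icc 0 T) (x₀ : Space n) (q₀ : ι) :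
    u q₀ t₀ x₀ = 0 := by
  obtain ⟨C₁, hC₁⟩ := hb
  set C := max C₁ 0
  have hC : ∀ j q r, ∀ t ∈ Set.Icc 0 T, ∀ x, |a j q r t x| ≤ C := fun j q r t ht x =>
    (hC₁ j q r t ht x).trans (le_max_left _ _)
  have hC0 : 0 ≤ C := le_max_right _ _
  set κ : ℝ := n * (C * Fintype.card ι) with hκ
  have hκ0 : 0 ≤ κ := by positivity
  -- `R² > L T`, so that the cutoff is positive at `(t₀, x₀)`
  set R : ℝ := 2 * κ * T + 1
  have hR : 0 < R := by positivity
  set L : ℝ := 2 * κ * R with hL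
  have hL0 : 0 ≤ L := by positivity
  -- constants are enlarged to be nonnegative
  obtain ⟨K₁, hK₁⟩ := heq x₀ R
  set K := max K₁ 0
  have hK0 : 0 ≤ K := le_max_right _ _
  have hK : ∀ t ∈ Set.Icc 0 T, ∀ x ∈ Metric.closedBall x₀ R, ∀ q,
      |dd T eT (u q) t x + ∑ j, ∑ r, a j q r t x * dd T (eX j) (u r) t x|
        ≤ K * ∑ r, |u r t x| := fun t ht x hx q => (hK₁ t ht x hx q).trans
    (mul_le_mul_of_nonneg_right (le_max_left _ _) (Finset.sum_nonneg fun _ _ => abs_nonneg _))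
  choose Ca hCa using fun j q r =>
    exists_bound_on_ball ((ha j q r).continuousOn_dd hT (eX j)) x₀ R
  set C' : ℝ := ∑ j, ∑ q, ∑ r, |Ca j q r|
  have hC'0 : 0 ≤ C' := Finset.sum_nonneg fun _ _ => Finset.sum_nonneg fun _ _ =>
    Finset.sum_nonneg fun _ _ => abs_nonneg _
  have hC' : ∀ j q r, ∀ t ∈ Set.Icc 0 T, ∀ x ∈ Metric.closedBall x₀ R,
      |dd T (eX j) (a j q r) t x| ≤ C' := by
    intro j q r t ht x hx
    refine (hCa j q r t ht x hx).trans ((le_abs_self _).trans ?_)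
    refine le_trans ?_ (Finset.single_le_sum (f := fun j => ∑ q, ∑ r, |Ca j q r|)
      (fun _ _ => Finset.sum_nonneg fun _ _ => Finset.sum_nonneg fun _ _ => abs_nonneg _)
      (Finset.mem_univ j))
    refine le_trans ?_ (Finset.single_le_sum (f := fun q => ∑ r, |Ca j q r|)
      (fun _ _ => Finset.sum_nonneg fun _ _ => abs_nonneg _) (Finset.mem_univ q))
    exact Finset.single_le_sum (f := fun r => |Ca j q r|) (fun _ _ => abs_nonneg _)
      (Finset.mem_univ r)
  set χ : Field n := cutoff R L x₀
  have hχ : IsC1 T χ := cutoff_c1 R L x₀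
  have hχ0 : ∀ t ∈ Set.Icc 0 T, ∀ x, x ∉ Metric.closedBall x₀ R → χ t x = 0 :=
    fun t ht x hx => cutoff_off_ball hR.le hL0 ht.1 hx
  -- the energy density and the energy flux
  set e : Field n := fun t x => ∑ q, u q t x ^ 2
  set Q : Fin n → Field n := fun j t x => ∑ q, ∑ r, u q t x * a j q r t x * u r t x
  set f : Field n := fun t x => χ t x * e t x
  set G : Fin n → Field n := fun j t x => χ t x * Q j t x
  have he : IsC1 T e := by
    simp only [e, pow_two]
    exact IsC1.sum fun q _ => (hu q).mul (hu q)
  have hQ : ∀ j, IsC1 T (Q j) := fun j =>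
    IsC1.sum fun q _ => IsC1.sum fun r _ => ((hu q).mul (ha j q r)).mul (hu r)
  have hf : IsC1 T f := hχ.mul he
  have hG : ∀ j, IsC1 T (G j) := fun j => hχ.mul (hQ j)
  have hf0 : ∀ t ∈ Set.Icc 0 T, ∀ x, x ∉ Metric.closedBall x₀ R → f t x = 0 :=
    fun t ht x hx => by simp only [f, hχ0 t ht x hx, zero_mul]
  have hG0 : ∀ j, ∀ t ∈ Set.Icc 0 T, ∀ x, x ∉ Metric.closedBall x₀ R → G j t x = 0 :=
    fun j t ht x hx => by simp only [G, hχ0 t ht x hx, zero_mul]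
  set K' : ℝ := 2 * K * Fintype.card ι + n * (C' * Fintype.card ι)
  have hpt : ∀ t ∈ Set.Icc 0 T, ∀ x,
      dd T eT f t x + ∑ j, dd T (eX j) (G j) t x ≤ K' * f t x := by
    intro t ht x
    by_cases hx : x ∈ Metric.closedBall x₀ R
    · have du := fun q => (hu q).diffAt ht x
      have da := fun j q r => (ha j q r).diffAt ht x
      have h1 : dd T eT f t x = dd T eT χ t x * ∑ q, u q t x ^ 2
          + χ t x * ∑ q, 2 * u q t x * dd T eT (u q) t x := by
        rw [dd_mul hT ht (hχ.diffAt ht x) (he.diffAt ht x), dd_sum hT ht fun q _ => (du q).sq]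
        simp only [dd_sq hT ht (du _), e]
      have h2 : ∀ j, dd T (eX j) (G j) t x
          = dd T (eX j) χ t x * ∑ q, ∑ r, u q t x * a j q r t x * u r t x
          + χ t x * ∑ q, ∑ r, ((dd T (eX j) (u q) t x * a j q r t x
            + u q t x * dd T (eX j) (a j q r) t x) * u r t x
            + u q t x * a j q r t x * dd T (eX j) (u r) t x) := by
        intro j
        rw [dd_mul hT ht (hχ.diffAt ht x) ((hQ j).diffAt ht x),
          dd_sum hT ht fun q _ => DiffAt.sum fun r _ => ((du q).mul (da j q r)).mul (du r)]
        simp only [dd_sum hT ht fun r _ => ((du _).mul (da j _ r)).mul (du r),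
          dd_mul hT ht ((du _).mul (da _ _ _)) (du _), dd_mul hT ht (du _) (da _ _ _), Q]
      rw [h1, Finset.sum_congr rfl fun j _ => h2 j]
      refine energy_inequality (cutoff_nonneg R L x₀ t x) hK0 hC'0 _ _ _
        (fun j r => dd T (eX j) (u r) t x) _ (fun j q r => dd T (eX j) (a j q r) t x)
        (fun j q r => hsym j q r t x) (fun j q r => hC' j q r t ht x hx)
        (fun q => hK t ht x hx q) ?_
      refine cutoff_decay hT hκ0 hL hR.le x₀ ht x (∑ q, u q t x ^ 2)
        (fun j => ∑ q, ∑ r, u q t x * a j q r t x * u r t x) ?_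
      calc _ ≤ ∑ _j : Fin n, C * Fintype.card ι * ∑ q, u q t x ^ 2 :=
            Finset.sum_le_sum fun j _ => sum_sum_abs_le _ _ (fun q r => hC j q r t ht x) hC0
        _ = _ := by simp [hκ]; ring
    · rw [dd_eT_eq_zero_off_ball hT hf hf0 ht hx, hf0 t ht x hx,
        Finset.sum_eq_zero fun j _ => dd_eX_eq_zero_off_ball (hG j) (hG0 j) ht hx j]
      simp
  have hint : ∀ t ∈ Set.Icc 0 T, ∫ x, dd T eT f t x ≤ K' * ∫ x, f t x := by
    intro t ht
    have i1 : Integrable (fun x => dd T eT f t x) :=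
      integrable_of_off_ball (continuous_slice (hf.continuousOn_dd hT eT) ht)
        fun x hx => dd_eT_eq_zero_off_ball hT hf hf0 ht hx
    have i2 : ∀ j, Integrable (fun x => dd T (eX j) (G j) t x) := fun j =>
      integrable_of_off_ball (continuous_slice ((hG j).continuousOn_dd hT _) ht)
        fun x hx => dd_eX_eq_zero_off_ball (hG j) (hG0 j) ht hx j
    have i3 : Integrable (fun x => f t x) :=
      integrable_of_off_ball (continuous_slice hf.continuousOn ht) (hf0 t ht)
    have h1 : ∫ x, (dd T eT f t x + ∑ j, dd T (eX j) (G j) t x) = ∫ x, dd T eT f t x := by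
      rw [integral_add i1 (integrable_finsetSum _ fun j _ => i2 j),
        integral_finsetSum _ fun j _ => i2 j,
        Finset.sum_eq_zero fun j _ => integral_dd_eX_eq_zero hT (hG j) (hG0 j) ht j, add_zero]
    rw [← h1, ← integral_const_mul]
    exact integral_mono (i1.add (integrable_finsetSum _ fun j _ => i2 j)) (i3.const_mul K')
      (hpt t ht)
  have hfpos : ∀ t x, 0 ≤ f t x := fun t x =>
    mul_nonneg (cutoff_nonneg R L x₀ t x) (Finset.sum_nonneg fun _ _ => sq_nonneg _)
  have hE : ∫ x, f t₀ x = 0 := by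
    refine eq_zero_of_deriv_le (E := fun t => ∫ x, f t x) (E' := fun t => ∫ x, dd T eT f t x)
      (K := K') (continuousOn_integral_of_compact_support (isCompact_closedBall x₀ R)
        hf.continuousOn fun t x ht hx => hf0 t ht x hx)
      (fun t ht => hasDerivAt_integral_of_off_ball hT hf hf0 ht)
      (fun t ht => hint t (Set.Ioo_subset_Icc_self ht)) ?_
      (fun t _ => integral_nonneg (hfpos t)) ht₀
    simp [f, e, h0]
  -- a continuous nonnegative function with zero integral vanishes
  have hft : f t₀ = 0 := by
    have hcont := continuous_slice hf.continuousOn ht₀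
    rw [integral_eq_zero_iff_of_nonneg (hfpos t₀)
      (integrable_of_off_ball hcont (hf0 t₀ ht₀))] at hE
    exact (hcont.ae_eq_iff_eq volume continuous_const).1 hE
  have hχpos : 0 < χ t₀ x₀ := by
    refine expNegInvGlue.pos_of_pos ?_
    simp only [sub_self, norm_zero]
    have : L * t₀ ≤ L * T := mul_le_mul_of_nonneg_left ht₀.2 hL0
    have h2 : R ^ 2 - L * T = R := by simp only [hL, R]; ring
    nlinarith
  have h1 : χ t₀ x₀ * e t₀ x₀ = 0 := congrFun hft x₀
  have h2 : e t₀ x₀ = 0 := (mul_eq_zero.1 h1).resolve_left hχpos.ne'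
  have h3 := (Finset.sum_eq_zero_iff_of_nonneg fun _ _ => sq_nonneg _).1 h2 q₀ (Finset.mem_univ _)
  exact pow_eq_zero_iff two_ne_zero |>.1 h3

end SymmetricHyperbolic

end ExtremalSurface

/-! ### Characteristics, and the nonvanishing of `τ` -/

namespace ExtremalSurface

section Characteristics

variable {n : ℕ} {T : ℝ}

theorem eT_add_sum_eX (w : Space n) : ((1, w) : ℝ × Space n) = eT + ∑ j, w j • eX j := by
  have h : ∑ j, w j • eX j = ((0, w) : ℝ × Space n) := by
    refine Prod.ext ?_ ?_
    · simp [eX, Prod.fst_sum]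
    · simp only [eX, Prod.snd_sum, Prod.smul_snd]
      ext i
      simp [Finset.sum_apply, Pi.single_apply]
  rw [h]
  simp [eT]

theorem fderivWithin_eq_dd (f : Field n) (t : ℝ) (x w : Space n) :
    fderivWithin ℝ (fun p : ℝ × Space n => f p.1 p.2) (Set.Icc 0 T ×ˢ Set.univ) (t, x) (1, w)
      = dd T eT f t x + ∑ j, w j * dd T (eX j) f t x := by
  rw [eT_add_sum_eX, map_add, map_sum]
  simp only [map_smul, smul_eq_mul, dd]

/-- The characteristics of a bounded continuously differentiable velocity field are defined on all
of `[0,T]`. -/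
theorem exists_characteristic (hT : 0 < T) {v : Fin n → Field n} (hv : ∀ j, IsC1 T (v j))
    (hb : ∃ C, ∀ t ∈ Set.Icc 0 T, ∀ x, ∀ j, |v j t x| ≤ C) {t₀ : ℝ} (ht₀ : t₀ ∈ Set.Icc 0 T)
    (x₀ : Space n) : ∃ X : ℝ → Space n, X t₀ = x₀ ∧ ∀ t ∈ Set.Icc 0 T,
      HasDerivWithinAt X (WithLp.toLp 2 fun j => v j t (X t)) (Set.Icc 0 T) t := by
  obtain ⟨C, hC⟩ := hb
  set V : ℝ → Space n → Space n := fun t x => WithLp.toLp 2 fun j => v j t x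
  have hV : ContDiffOn ℝ 1 (fun p : ℝ × Space n => V p.1 p.2) (Set.Icc 0 T ×ˢ Set.univ) :=
    contDiffOn_euclidean.2 hv
  set L : NNReal := Real.toNNReal (√(∑ _j : Fin n, C ^ 2))
  have hL : ∀ t ∈ Set.Icc 0 T, ∀ x, ‖V t x‖ ≤ L := by
    intro t ht x
    rw [Real.coe_toNNReal _ (Real.sqrt_nonneg _), EuclideanSpace.norm_eq]
    refine Real.sqrt_le_sqrt (Finset.sum_le_sum fun j _ => ?_)
    rw [Real.norm_eq_abs]
    exact pow_le_pow_left₀ (abs_nonneg _) (hC t ht x j) 2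
  -- the velocity is bounded by `L`, so the characteristic stays in the ball of radius `L T`
  set a : NNReal := L * Real.toNNReal T
  obtain ⟨K, hK⟩ := (hV.mono (Set.prod_mono le_rfl (Set.subset_univ _))).exists_lipschitzOnWith
    one_ne_zero ((convex_Icc 0 T).prod (convex_closedBall x₀ a))
    (isCompact_Icc.prod (isCompact_closedBall x₀ a))
  have hpl : IsPicardLindelof V (⟨t₀, ht₀⟩ : Set.Icc 0 T) x₀ a 0 L K := by
    refine ⟨fun t ht => ?_, fun x _ => ?_, fun t ht x _ => hL t ht x, ?_⟩
    · intro x hx y hy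
      have := hK (x := (t, x)) ⟨ht, hx⟩ (y := (t, y)) ⟨ht, hy⟩
      simpa [Prod.edist_eq] using this
    · exact hV.continuousOn.comp (f := fun t : ℝ => (t, x)) (by fun_prop) fun t ht => ⟨ht, trivial⟩
    · simp only [a, NNReal.coe_mul, Real.coe_toNNReal _ hT.le, NNReal.coe_zero, sub_zero]
      exact mul_le_mul_of_nonneg_left (max_le (by linarith [ht₀.1]) (by linarith [ht₀.2])) L.2
  exact hpl.exists_eq_forall_mem_Icc_hasDerivWithinAt₀

/-- A solution of a linear transport equation that vanishes at some point already vanishes at the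
foot of the characteristic through this point. -/
theorem exists_zero_of_transport (hT : 0 < T) {v : Fin n → Field n} (hv : ∀ j, IsC1 T (v j))
    (hb : ∃ C, ∀ t ∈ Set.Icc 0 T, ∀ x, ∀ j, |v j t x| ≤ C) {f g : Field n} (hf : IsC1 T f)
    (hg : ContinuousOn (fun p : ℝ × Space n => g p.1 p.2) (Set.Icc 0 T ×ˢ Set.univ))
    (heq : ∀ t ∈ Set.Icc 0 T, ∀ x,
      dd T eT f t x + ∑ j, v j t x * dd T (eX j) f t x = g t x * f t x)
    {t₀ : ℝ} (ht₀ : t₀ ∈ Set.Icc 0 T) {x₀ : Space n} (h0 : f t₀ x₀ = 0) : ∃ y, f 0 y = 0 := by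
  obtain ⟨X, hX0, hX⟩ := exists_characteristic hT hv hb ht₀ x₀
  have hXc : ContinuousOn X (Set.Icc 0 T) := fun t ht => (hX t ht).continuousWithinAt
  have hmaps : Set.MapsTo (fun t => (t, X t)) (Set.Icc 0 T) (Set.Icc 0 T ×ˢ Set.univ) :=
    fun t ht => ⟨ht, trivial⟩
  have hgc : ContinuousOn (fun t => g t (X t)) (Set.Icc 0 T) :=
    hg.comp (continuousOn_id.prodMk hXc) hmaps
  obtain ⟨K, hK⟩ := isCompact_Icc.exists_bound_of_continuousOn hgc
  have hder : ∀ t ∈ Set.Icc 0 T,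
      HasDerivWithinAt (fun s => f s (X s)) (g t (X t) * f t (X t)) (Set.Icc 0 T) t := by
    intro t ht
    have h1 := (hf.diffAt ht (X t)).hasFDerivWithinAt.comp_hasDerivWithinAt t
      ((hasDerivWithinAt_id t _).prodMk (hX t ht)) hmaps
    rw [fderivWithin_eq_dd, heq t ht] at h1
    exact h1
  -- along the characteristic both `f` and `0` solve the linear equation `y' = g y`
  have huniq := ODE_solution_unique_of_mem_Icc_left (a := 0) (b := t₀)
    (v := fun t y => g t (X t) * y) (s := fun _ => Set.univ) (K := Real.toNNReal K)
    (f := fun s => f s (X s)) (g := fun _ => (0 : ℝ)) ?_ ?_ ?_ (fun _ _ => trivial)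
    continuousOn_const ?_ (fun _ _ => trivial) (by simp only [hX0, h0])
  · exact ⟨X 0, huniq ⟨le_rfl, ht₀.1⟩⟩
  · intro t ht
    refine LipschitzWith.lipschitzOnWith (LipschitzWith.of_dist_le_mul fun x y => ?_)
    rw [Real.dist_eq, ← mul_sub, abs_mul, ← Real.dist_eq]
    exact mul_le_mul_of_nonneg_right
      ((hK t ⟨ht.1.le, ht.2.trans ht₀.2⟩).trans (Real.le_coe_toNNReal K)) dist_nonneg
  · exact fun t ht => ((hder t ⟨ht.1, ht.2.trans ht₀.2⟩).continuousWithinAt).mono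
      (Set.Icc_subset_Icc_right ht₀.2)
  · intro t ht
    refine (hder t ⟨ht.1.le, ht.2.trans ht₀.2⟩).mono_of_mem_nhdsWithin ?_
    filter_upwards [self_mem_nhdsWithin, mem_nhdsWithin_of_mem_nhds (Ioi_mem_nhds ht.1)]
      with s hs hs' using ⟨le_of_lt hs', hs.trans (ht.2.trans ht₀.2)⟩
  · intro t _
    simpa using hasDerivWithinAt_const t (Set.Iic t) (0 : ℝ)

end Characteristics

namespace State

variable {n m : ℕ} {W : State n m} {T : ℝ}

theorem IsSolution.τ_ne_zero (hW : W.IsSolution T) (hT : 0 < T) (hb : W.IsBounded T)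
    (h0 : ∀ x, W.τ 0 x ≠ 0) : ∀ t ∈ Set.Icc 0 T, ∀ x, W.τ t x ≠ 0 := by
  have heq : ∀ t ∈ Set.Icc 0 T, ∀ x, dd T eT W.τ t x + ∑ j, W.v j t x * dd T (eX j) W.τ t x
      = (∑ j, dd T (eX j) (W.v j) t x) * W.τ t x := by
    intro t ht x
    have h := hW.eq_τ t ht x
    simp only [(hW.c1_τ.diffAt ht x).dx_eq ht, (hW.c1_τ.diffAt ht x).dt_eq hT ht,
        fun j => (hW.diffAt_v (x := x) ht j).dx_eq ht] at h
    linarith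
  intro t ht x hx
  obtain ⟨C, hC⟩ := hb
  obtain ⟨y, hy⟩ := exists_zero_of_transport (v := W.v) (f := W.τ)
    (g := fun t x => ∑ j, dd T (eX j) (W.v j) t x) hT hW.c1_v
    ⟨C, fun t ht x j => (hC t ht x).2.1 j⟩ hW.c1_τ
    (continuousOn_finsetSum _ fun j _ => (hW.c1_v j).continuousOn_dd hT _) heq ht hx
  exact h0 y hy

end State

end ExtremalSurface

/-! ### Laplace expansion of minors -/

namespace ExtremalSurface

section Laplace

variable {k n m : ℕ}

theorem ord_orderEmbOfFin {r : ℕ} (I : Finset (Fin k)) (h : I.card = r) (l : Fin r) :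
    ord I (I.orderEmbOfFin h l) = l + 1 := by
  unfold ord
  congr 1
  have : I.filter (· < I.orderEmbOfFin h l)
      = (Finset.univ.filter (· < l)).map (I.orderEmbOfFin h).toEmbedding := by
    ext c
    simp only [Finset.mem_filter, Finset.mem_map, Finset.mem_univ, true_and]
    constructor
    · rintro ⟨hc, hlt⟩
      have : c ∈ Set.range (I.orderEmbOfFin h) := by
        rw [Finset.range_orderEmbOfFin]; exact hc
      obtain ⟨j, rfl⟩ := this
      exact ⟨j, (I.orderEmbOfFin h).lt_iff_lt.1 hlt, rfl⟩
    · rintro ⟨j, hj, rfl⟩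
      exact ⟨Finset.orderEmbOfFin_mem _ _ _, (I.orderEmbOfFin h).lt_iff_lt.2 hj⟩
  rw [this, Finset.card_map]
  have : Finset.univ.filter (· < l) = Finset.Iio l := by ext; simp
  rw [this, Fin.card_Iio]

/-- Deleting the `l`-th element of `I` deletes the index `l` from its increasing enumeration. -/
theorem orderEmbOfFin_succAbove {r : ℕ} (I : Finset (Fin k)) (h : I.card = r + 1)
    (l : Fin (r + 1)) (h' : (I \ {I.orderEmbOfFin h l}).card = r) :
    (I \ {I.orderEmbOfFin h l}).orderEmbOfFin h' = I.orderEmbOfFin h ∘ l.succAbove := by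
  symm
  refine Finset.orderEmbOfFin_unique h' (fun x => ?_) ?_
  · simp only [Function.comp_apply, Finset.mem_sdiff, Finset.orderEmbOfFin_mem,
      Finset.mem_singleton, true_and, EmbeddingLike.apply_eq_iff_eq]
    exact Fin.succAbove_ne l x
  · exact (I.orderEmbOfFin h).strictMono.comp (Fin.strictMono_succAbove l)

theorem matrixMinor_eq {r : ℕ} (F : Matrix (Fin m) (Fin n) ℝ) {A : Finset (Fin m)}
    {I : Finset (Fin n)} (h : A.card = I.card) (hA : A.card = r) (hI : I.card = r) :
    matrixMinor F A I h = (F.submatrix (A.orderEmbOfFin hA) (I.orderEmbOfFin hI)).det := by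
  subst hA; rfl

theorem sum_orderEmbOfFin {r : ℕ} (I : Finset (Fin k)) (h : I.card = r) (f : Fin k → ℝ) :
    ∑ i ∈ I, f i = ∑ l, f (I.orderEmbOfFin h l) := by
  conv_lhs => rw [← Finset.map_orderEmbOfFin_univ I h]
  rw [Finset.sum_map]; rfl

open Classical in
/-- The minors of a matrix as a family, with value zero on the pairs with `|A| ≠ |I|`. -/
noncomputable def minorFamily (F : Matrix (Fin m) (Fin n) ℝ) (A : Finset (Fin m))
    (I : Finset (Fin n)) : ℝ := if h : A.card = I.card then matrixMinor F A I h else 0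

theorem minorFamily_eq {r : ℕ} (F : Matrix (Fin m) (Fin n) ℝ) {A : Finset (Fin m)}
    {I : Finset (Fin n)} (hA : A.card = r) (hI : I.card = r) :
    minorFamily F A I = (F.submatrix (A.orderEmbOfFin hA) (I.orderEmbOfFin hI)).det := by
  rw [minorFamily, dif_pos (hA.trans hI.symm), matrixMinor_eq F _ hA hI]

/-- Laplace expansion along the row `α`; if `α ∈ A` it computes the determinant of a matrix with
two equal rows. -/
theorem minorFamily_laplace (F : Matrix (Fin m) (Fin n) ℝ) (α : Fin m) {A : Finset (Fin m)}
    {I : Finset (Fin n)} (h : I.card = A.card + 1) :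
    ∑ i ∈ I, (-1 : ℝ) ^ (ord A α + ord I i) * minorFamily F A (I \ {i}) * F α i
      = if α ∉ A then minorFamily F (A ∪ {α}) I else 0 := by
  set r := A.card with hr
  rw [sum_orderEmbOfFin I h]
  have hc : ∀ l, (I \ {I.orderEmbOfFin h l}).card = r := fun l => by
    have := State.card_sdiff_singleton' (Finset.orderEmbOfFin_mem I h l); omega
  by_cases hα : α ∉ A
  · rw [if_pos hα]
    have hA' : (A ∪ {α}).card = r + 1 := State.card_union_singleton' hα
    have : α ∈ Set.range ((A ∪ {α}).orderEmbOfFin hA') := by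
      rw [Finset.range_orderEmbOfFin]; simp
    obtain ⟨p, hp⟩ := this
    have hord : ord A α = p + 1 := by
      rw [← ord_orderEmbOfFin _ hA' p, hp, ← ord_sdiff_of_not_lt (A := A ∪ {α}) (lt_irrefl α),
        union_sdiff_singleton hα]
    have hemb : ⇑(A.orderEmbOfFin hr.symm) = (A ∪ {α}).orderEmbOfFin hA' ∘ p.succAbove := by
      refine (Finset.orderEmbOfFin_unique hr.symm (fun x => ?_)
        (((A ∪ {α}).orderEmbOfFin hA').strictMono.comp (Fin.strictMono_succAbove p))).symm
      have hx : (A ∪ {α}).orderEmbOfFin hA' (p.succAbove x) ∈ (A ∪ {α}) \ {α} := by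
        refine Finset.mem_sdiff.2 ⟨Finset.orderEmbOfFin_mem _ _ _, fun hmem => ?_⟩
        exact Fin.succAbove_ne p x (((A ∪ {α}).orderEmbOfFin hA').injective
          ((Finset.mem_singleton.1 hmem).trans hp.symm))
      rwa [union_sdiff_singleton hα] at hx
    rw [minorFamily_eq F hA' h, Matrix.det_succ_row _ p]
    refine Finset.sum_congr rfl fun l _ => ?_
    rw [minorFamily_eq F hr.symm (hc l), hemb, orderEmbOfFin_succAbove, ord_orderEmbOfFin, hord,
      Matrix.submatrix_submatrix, Matrix.submatrix_apply, hp]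
    ring
  · rw [if_neg hα]
    have hα := not_not.1 hα
    have : α ∈ Set.range (A.orderEmbOfFin hr.symm) := by
      rw [Finset.range_orderEmbOfFin]; exact hα
    obtain ⟨p, hp⟩ := this
    -- put the row `α` on top of the rows in `A`, where it occurs a second time
    have hz : (F.submatrix (Fin.cons α (A.orderEmbOfFin hr.symm) : Fin (r + 1) → Fin m)
        (I.orderEmbOfFin h)).det = 0 := by
      refine Matrix.det_zero_of_row_eq (i := 0) (j := p.succ) (Fin.succ_ne_zero p).symm ?_
      funext l
      simp [hp]
    rw [Matrix.det_succ_row_zero] at hz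
    rw [← mul_zero ((-1 : ℝ) ^ (ord A α + 1)), ← hz, Finset.mul_sum]
    refine Finset.sum_congr rfl fun l _ => ?_
    rw [minorFamily_eq F hr.symm (hc l), orderEmbOfFin_succAbove, ord_orderEmbOfFin,
      Matrix.submatrix_submatrix, Matrix.submatrix_apply, Fin.cons_zero]
    have : (Fin.cons α (A.orderEmbOfFin hr.symm) : Fin (r + 1) → Fin m) ∘ Fin.succ
        = A.orderEmbOfFin hr.symm := by funext; simp
    rw [this]
    ring

theorem minorFamily_transpose (F : Matrix (Fin m) (Fin n) ℝ) (A : Finset (Fin m))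
    (I : Finset (Fin n)) : minorFamily F.transpose I A = minorFamily F A I := by
  by_cases h : A.card = I.card
  · rw [minorFamily_eq F h rfl, minorFamily_eq F.transpose rfl h, ← Matrix.det_transpose]
    rfl
  · rw [minorFamily, minorFamily, dif_neg h, dif_neg (Ne.symm h)]

theorem minorFamily_empty (F : Matrix (Fin m) (Fin n) ℝ) : minorFamily F ∅ ∅ = 1 := by
  rw [minorFamily_eq (r := 0) F rfl rfl]; exact Matrix.det_isEmpty

end Laplace

namespace State

variable {n m : ℕ} {W : State n m} {t : ℝ} {x : Space n}

theorem Constraints.Mv_eq (h : W.Constraints t x) (A : Finset (Fin m)) (I : Finset (Fin n)) :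
    W.Mv t x A I = W.τ t x * minorFamily (W.F t x) A I := by
  by_cases hc : A.card = I.card
  · by_cases hA : A = ∅
    · subst hA
      obtain rfl : I = ∅ := Finset.card_eq_zero.1 (by simpa using hc.symm)
      rw [Mv, M_empty, minorFamily_empty, mul_one]
    · rw [Mv, M_of_card_eq W hc, h.minors A I hc (Finset.nonempty_iff_ne_empty.2 hA),
        minorFamily, dif_pos hc]
  · rw [Mv_of_card_ne W hc, minorFamily, dif_neg hc, mul_zero]

theorem entry_eq_mul_F (h : W.τ t x ≠ 0) (α : Fin m) (i : Fin n) :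
    W.entry α i t x = W.τ t x * W.F t x α i := by
  rw [F, Matrix.of_apply, mul_inv_cancel_left₀ h]

theorem phi_eq_Mv (α : Fin m) {A : Finset (Fin m)} {I : Finset (Fin n)}
    (h : I.card = A.card + 1) : W.phi α A I t x
      = ∑ i ∈ I, (-1 : ℝ) ^ (ord A α + ord I i) * W.Mv t x A (I \ {i}) * W.entry α i t x
        - if α ∉ A then W.τ t x * W.Mv t x (A ∪ {α}) I else 0 := by
  unfold phi
  congr 1
  · refine Finset.sum_congr rfl fun i hi => ?_
    have := card_sdiff_singleton' hi
    rw [Mv, M_of_card_eq W (by omega)]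
  · by_cases hα : α ∉ A
    · rw [if_pos hα, if_pos hα, Mv, M_of_card_eq W (by rw [card_union_singleton' hα, h])]
    · rw [if_neg hα, if_neg hα]

theorem psi_eq_Mv (i : Fin n) {A : Finset (Fin m)} {I : Finset (Fin n)}
    (h : A.card = I.card + 1) : W.psi i A I t x
      = ∑ α ∈ A, (-1 : ℝ) ^ (ord A α + ord I i) * W.Mv t x (A \ {α}) I * W.entry α i t x
        - if i ∉ I then W.τ t x * W.Mv t x A (I ∪ {i}) else 0 := by
  unfold psi
  congr 1
  · refine Finset.sum_congr rfl fun α hα => ?_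
    have := card_sdiff_singleton' hα
    rw [Mv, M_of_card_eq W (by omega)]
  · by_cases hi : i ∉ I
    · rw [if_pos hi, if_pos hi, Mv, M_of_card_eq W (by rw [card_union_singleton' hi, h])]
    · rw [if_neg hi, if_neg hi]

theorem Constraints.phi_eq_zero (h : W.Constraints t x) (α : Fin m) {A : Finset (Fin m)}
    {I : Finset (Fin n)} (hc : I.card = A.card + 1) : W.phi α A I t x = 0 := by
  have h1 := minorFamily_laplace (W.F t x) α hc
  rw [phi_eq_Mv α hc, sub_eq_zero]
  simp only [h.Mv_eq, entry_eq_mul_F h.τ_ne_zero]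
  calc _ = W.τ t x * W.τ t x * ∑ i ∈ I, (-1 : ℝ) ^ (ord A α + ord I i)
          * minorFamily (W.F t x) A (I \ {i}) * W.F t x α i := by
        rw [Finset.mul_sum]; exact Finset.sum_congr rfl fun i _ => by ring
    _ = _ := by rw [h1]; split_ifs <;> ring

theorem Constraints.psi_eq_zero (h : W.Constraints t x) (i : Fin n) {A : Finset (Fin m)}
    {I : Finset (Fin n)} (hc : A.card = I.card + 1) : W.psi i A I t x = 0 := by
  have h1 := minorFamily_laplace (W.F t x).transpose i hc
  simp only [minorFamily_transpose, Matrix.transpose_apply] at h1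
  rw [psi_eq_Mv i hc, sub_eq_zero]
  simp only [h.Mv_eq, entry_eq_mul_F h.τ_ne_zero]
  calc _ = W.τ t x * W.τ t x * ∑ α ∈ A, (-1 : ℝ) ^ (ord I i + ord A α)
          * minorFamily (W.F t x) (A \ {α}) I * W.F t x α i := by
        rw [Finset.mul_sum]
        exact Finset.sum_congr rfl fun i _ => by rw [add_comm (ord I _)]; ring
    _ = _ := by rw [h1]; split_ifs <;> ring

/-- If all `φ^α_{A,I}` vanish, the `m_{A,I}` obey the recursion given by Laplace expansion, hence
are the minors. -/
theorem Mv_eq_of_phi_eq_zero (h0 : W.τ t x ≠ 0) (hphi : ∀ (α : Fin m) (A : Finset (Fin m))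
    (I : Finset (Fin n)), I.card = A.card + 1 → W.phi α A I t x = 0) (A : Finset (Fin m)) :
    ∀ I : Finset (Fin n), A.card = I.card →
      W.Mv t x A I = W.τ t x * minorFamily (W.F t x) A I := by
  induction A using Finset.induction_on with
  | empty =>
    intro I hc
    obtain rfl : I = ∅ := Finset.card_eq_zero.1 (by simpa using hc.symm)
    rw [Mv, M_empty, minorFamily_empty, mul_one]
  | insert α A hα ih =>
    intro I hc
    rw [Finset.card_insert_of_notMem hα] at hc
    have h1 := minorFamily_laplace (W.F t x) α hc.symm
    have h2 := hphi α A I hc.symm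
    rw [phi_eq_Mv α hc.symm, sub_eq_zero, if_pos hα] at h2
    rw [if_pos hα] at h1
    rw [← Finset.union_singleton]
    refine mul_left_cancel₀ h0 ?_
    rw [← h2, ← h1, Finset.mul_sum, Finset.mul_sum]
    refine Finset.sum_congr rfl fun i hi => ?_
    have := card_sdiff_singleton' hi
    rw [ih (I \ {i}) (by omega), entry_eq_mul_F h0]
    ring

end State

end ExtremalSurface

/-! ### Propagation of the constraints -/

namespace ExtremalSurface

section Domination

variable {n : ℕ} {T : ℝ} {ι : Type*} [Fintype ι] {u : ι → Field n} {f g : Field n}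

/-- `f` is bounded, locally uniformly on `[0,T] × ℝⁿ`, by a multiple of the fields `u`. -/
def DomBy (T : ℝ) (u : ι → Field n) (f : Field n) : Prop :=
  ∀ x₀ R, ∃ K, ∀ t ∈ Set.Icc 0 T, ∀ x ∈ Metric.closedBall x₀ R, |f t x| ≤ K * ∑ r, |u r t x|

theorem DomBy.self (q : ι) : DomBy T u (u q) := fun _ _ => ⟨1, fun t _ x _ => by
  rw [one_mul]
  exact Finset.single_le_sum (f := fun r => |u r t x|) (fun _ _ => abs_nonneg _)
    (Finset.mem_univ q)⟩

theorem DomBy.zero : DomBy T u (fun _ _ => 0) := fun _ _ => ⟨0, fun t _ x _ => by simp⟩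

theorem DomBy.congr (hf : DomBy T u f) (h : ∀ t ∈ Set.Icc 0 T, ∀ x, g t x = f t x) :
    DomBy T u g := fun x₀ R => by
  obtain ⟨K, hK⟩ := hf x₀ R
  exact ⟨K, fun t ht x hx => by rw [h t ht x]; exact hK t ht x hx⟩

theorem DomBy.add (hf : DomBy T u f) (hg : DomBy T u g) :
    DomBy T u (fun t x => f t x + g t x) := fun x₀ R => by
  obtain ⟨K, hK⟩ := hf x₀ R
  obtain ⟨K', hK'⟩ := hg x₀ R
  refine ⟨K + K', fun t ht x hx => (abs_add_le _ _).trans ?_⟩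
  rw [add_mul]
  exact add_le_add (hK t ht x hx) (hK' t ht x hx)

theorem DomBy.mul_left (hf : DomBy T u f)
    (hg : ContinuousOn (fun p : ℝ × Space n => g p.1 p.2) (Set.Icc 0 T ×ˢ Set.univ)) :
    DomBy T u (fun t x => g t x * f t x) := fun x₀ R => by
  obtain ⟨K, hK⟩ := hf x₀ R
  obtain ⟨C, hC⟩ := exists_bound_on_ball hg x₀ R
  refine ⟨|C| * K, fun t ht x hx => ?_⟩
  rw [abs_mul, mul_assoc]
  exact mul_le_mul ((hC t ht x hx).trans (le_abs_self C)) (hK t ht x hx) (abs_nonneg _)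
    (abs_nonneg _)

theorem DomBy.const_mul (hf : DomBy T u f) (c : ℝ) : DomBy T u (fun t x => c * f t x) :=
  hf.mul_left (g := fun _ _ => c) continuousOn_const

theorem DomBy.sub (hf : DomBy T u f) (hg : DomBy T u g) :
    DomBy T u (fun t x => f t x - g t x) :=
  (hf.add (hg.const_mul (-1))).congr fun t _ x => by ring

theorem DomBy.sum {κ : Type*} {s : Finset κ} {F : κ → Field n} (h : ∀ i, DomBy T u (F i)) :
    DomBy T u (fun t x => ∑ i ∈ s, F i t x) := by
  classical
  induction s using Finset.induction_on with
  | empty => simpa using DomBy.zero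
  | insert i s hi ih => simpa only [Finset.sum_insert hi] using (h i).add ih

theorem DomBy.uniform {F : ι → Field n} (h : ∀ q, DomBy T u (F q)) (x₀ : Space n) (R : ℝ) :
    ∃ K, ∀ t ∈ Set.Icc 0 T, ∀ x ∈ Metric.closedBall x₀ R, ∀ q,
      |F q t x| ≤ K * ∑ r, |u r t x| := by
  choose K hK using fun q => h q x₀ R
  refine ⟨∑ q, |K q|, fun t ht x hx q => (hK q t ht x hx).trans ?_⟩
  refine mul_le_mul_of_nonneg_right ((le_abs_self _).trans ?_)
    (Finset.sum_nonneg fun _ _ => abs_nonneg _)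
  exact Finset.single_le_sum (f := fun q => |K q|) (fun _ _ => abs_nonneg _) (Finset.mem_univ q)

/-- Uniqueness for transport equations coupled through terms of order zero. -/
theorem transport_unique (hT : 0 < T) {v : Fin n → Field n} (hv : ∀ j, IsC1 T (v j))
    (hb : ∃ C, ∀ t ∈ Set.Icc 0 T, ∀ x, ∀ j, |v j t x| ≤ C) (hu : ∀ q, IsC1 T (u q))
    (heq : ∀ q, DomBy T u
      (fun t x => dd T eT (u q) t x + ∑ j, v j t x * dd T (eX j) (u q) t x))
    (h0 : ∀ q x, u q 0 x = 0) {t : ℝ} (ht : t ∈ Set.Icc 0 T) (x : Space n) (q : ι) :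
    u q t x = 0 := by
  classical
  obtain ⟨C, hC⟩ := hb
  refine symmetric_hyperbolic_unique hT u (fun j q r t x => if q = r then v j t x else 0) hu
    (fun j q r => ?_) (fun j q r t x => ?_) ⟨|C|, fun j q r t ht x => ?_⟩
    (fun x₀ R => ?_) h0 ht x q
  · by_cases h : q = r
    · simpa [h] using hv j
    · simpa [h] using IsC1.const 0
  · simp only [eq_comm]
  · split_ifs
    · exact (hC t ht x j).trans (le_abs_self C)
    · simp
  · simpa using DomBy.uniform heq x₀ R

end Domination

section MinorsDomination

variable {n m : ℕ} {T : ℝ} {ι : Type*} [Fintype ι] {u : ι → Field n}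
  {Φ : ℝ → Space n → Minors m n}

theorem DomBy.colUp (h : ∀ A I, DomBy T u (fun t x => Φ t x A I)) (i : Fin n) (A I) :
    DomBy T u (fun t x => ExtremalSurface.colUp i (Φ t x) A I) := by
  simp only [colUp_apply]
  split_ifs
  · exact (h _ _).const_mul _
  · exact DomBy.zero

theorem DomBy.colDown (h : ∀ A I, DomBy T u (fun t x => Φ t x A I)) (i : Fin n) (A I) :
    DomBy T u (fun t x => ExtremalSurface.colDown i (Φ t x) A I) := by
  simp only [colDown_apply]
  split_ifs
  · exact DomBy.zero
  · exact (h _ _).const_mul _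

theorem DomBy.rowUp (h : ∀ A I, DomBy T u (fun t x => Φ t x A I)) (α : Fin m) (A I) :
    DomBy T u (fun t x => ExtremalSurface.rowUp α (Φ t x) A I) := by
  simp only [rowUp_apply]
  split_ifs
  · exact (h _ _).const_mul _
  · exact DomBy.zero

theorem DomBy.colFlow {V : Fin n → Fin n → Field n}
    (hV : ∀ k j, ContinuousOn (fun p : ℝ × Space n => V k j p.1 p.2)
      (Set.Icc 0 T ×ˢ Set.univ)) (h : ∀ A I, DomBy T u (fun t x => Φ t x A I)) (A I) :
    DomBy T u (fun t x => ExtremalSurface.colFlow (fun k j => V k j t x) (Φ t x) A I) := by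
  simp only [colFlow_apply, Finset.sum_apply, Pi.smul_apply, smul_eq_mul]
  exact DomBy.sum fun k => DomBy.sum fun j =>
    (DomBy.colDown (fun A I => DomBy.colUp h k A I) j A I).mul_left (hV k j)

theorem DomBy.pairUp {D : Fin n → Fin m → Field n}
    (hD : ∀ k β, ContinuousOn (fun p : ℝ × Space n => D k β p.1 p.2)
      (Set.Icc 0 T ×ˢ Set.univ)) (h : ∀ A I, DomBy T u (fun t x => Φ t x A I)) (A I) :
    DomBy T u (fun t x => ExtremalSurface.pairUp (fun k β => D k β t x) (Φ t x) A I) := by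
  simp only [pairUp_apply, Finset.sum_apply, Pi.smul_apply, smul_eq_mul]
  exact DomBy.sum fun k => DomBy.sum fun β =>
    (DomBy.rowUp (fun A I => DomBy.colUp h k A I) β A I).mul_left (hD k β)

end MinorsDomination

namespace State

variable {n m : ℕ} {W : State n m} {T t : ℝ} {x : Space n}

theorem colUp_of_card_ne (i : Fin n) {A : Finset (Fin m)} {I : Finset (Fin n)}
    (h : I.card ≠ A.card + 1) : colUp i (W.Mv t x) A I = 0 := by
  rw [colUp_apply]
  split_ifs with hi
  · have := card_sdiff_singleton' hi
    rw [Mv_of_card_ne W (by omega), mul_zero]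
  · rfl

theorem phiB_of_card_ne (α : Fin m) {A : Finset (Fin m)} {I : Finset (Fin n)}
    (h : I.card ≠ A.card + 1) : phiB α (W.Mv t x) (W.Mv t x) A I = 0 := by
  have h2 : rowDown α (W.Mv t x) A I = 0 := by
    rw [rowDown_apply]
    split_ifs with hα
    · rfl
    · have := card_union_singleton' hα
      rw [Mv_of_card_ne W (by omega), mul_zero]
  simp [phiB, Finset.sum_apply, colUp_of_card_ne _ h, h2]

theorem psiB_of_card_ne (i : Fin n) {A : Finset (Fin m)} {I : Finset (Fin n)}
    (h : A.card ≠ I.card + 1) : psiB i (W.Mv t x) (W.Mv t x) A I = 0 := by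
  have h1 : ∀ α, rowUp α (W.Mv t x) A I = 0 := by
    intro α
    rw [rowUp_apply]
    split_ifs with hα
    · have := card_sdiff_singleton' hα
      rw [Mv_of_card_ne W (by omega), mul_zero]
    · rfl
  have h2 : colDown i (W.Mv t x) A I = 0 := by
    rw [colDown_apply]
    split_ifs with hi
    · rfl
    · have := card_union_singleton' hi
      rw [Mv_of_card_ne W (by omega), mul_zero]
  simp [psiB, Finset.sum_apply, h1, h2]

theorem IsBounded.v (hb : W.IsBounded T) :
    ∃ C, ∀ t ∈ Set.Icc 0 T, ∀ x, ∀ j, |W.v j t x| ≤ C := by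
  obtain ⟨C, hC⟩ := hb
  exact ⟨C, fun t ht x j => (hC t ht x).2.1 j⟩

theorem IsBounded.M (hb : W.IsBounded T) :
    ∃ C, ∀ t ∈ Set.Icc 0 T, ∀ x, ∀ A I, |W.M A I t x| ≤ C := by
  obtain ⟨C, hC⟩ := hb
  refine ⟨C, fun t ht x A I => ?_⟩
  by_cases hc : A.card = I.card
  · by_cases hA : A = ∅
    · subst hA
      obtain rfl : I = ∅ := Finset.card_eq_zero.1 (by simpa using hc.symm)
      rw [M_empty]; exact (hC t ht x).1
    · have hp : (A, I) ∈ minorPairs n m := by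
        simp [minorPairs, hc, Finset.nonempty_iff_ne_empty, hA]
      rw [← mm_eq_M hp]; exact (hC t ht x).2.2.2 _ hp
  · rw [M_of_card_ne W hc, abs_zero]
    exact (abs_nonneg _).trans (hC t ht x).1

theorem IsSolution.phiB_eq_zero (hW : W.IsSolution T) (hT : 0 < T) (hb : W.IsBounded T)
    (h0 : ∀ x, W.Constraints 0 x) (ht : t ∈ Set.Icc 0 T) (α : Fin m) :
    phiB α (W.Mv t x) (W.Mv t x) = 0 := by
  funext A I
  refine transport_unique (ι := Fin m × Finset (Fin m) × Finset (Fin n)) hT hW.c1_v hb.v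
    (u := fun q t x => phiB q.1 (W.Mv t x) (W.Mv t x) q.2.1 q.2.2)
    (fun q => hW.c1_phiB _ _ _) ?_ ?_ ht x (α, A, I)
  · rintro ⟨α, A, I⟩
    set u : Fin m × Finset (Fin m) × Finset (Fin n) → Field n :=
      fun q t x => phiB q.1 (W.Mv t x) (W.Mv t x) q.2.1 q.2.2
    have hs : ∀ A I, DomBy T u (fun t x => phiB α (W.Mv t x) (W.Mv t x) A I) :=
      fun A I => DomBy.self (u := u) (α, A, I)
    refine DomBy.congr (((DomBy.sum (s := Finset.univ) fun j =>
      (hs A I).mul_left ((hW.c1_v j).continuousOn_dd hT (eX j))).add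
      (DomBy.colFlow (fun k j => (hW.c1_v j).continuousOn_dd hT (eX k)) hs A I)).add
      (DomBy.pairUp (fun k β => (hW.c1_d β).continuousOn_dd hT (eX k)) hs A I)) fun t ht x => ?_
    simp only [hW.evol_phiB hT ht, Finset.sum_mul]
    ring
  · rintro ⟨α, A, I⟩ x
    by_cases hc : I.card = A.card + 1
    · simp only [phiB_eq α hc, (h0 x).phi_eq_zero α hc, mul_zero]
    · exact phiB_of_card_ne α hc

theorem IsSolution.psiB_eq_zero (hW : W.IsSolution T) (hT : 0 < T) (hb : W.IsBounded T)
    (h0 : ∀ x, W.Constraints 0 x) (ht : t ∈ Set.Icc 0 T) (i : Fin n) :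
    psiB i (W.Mv t x) (W.Mv t x) = 0 := by
  funext A I
  refine transport_unique (ι := Fin n × Finset (Fin m) × Finset (Fin n)) hT hW.c1_v hb.v
    (u := fun q t x => psiB q.1 (W.Mv t x) (W.Mv t x) q.2.1 q.2.2)
    (fun q => hW.c1_psiB _ _ _) ?_ ?_ ht x (i, A, I)
  · rintro ⟨i, A, I⟩
    set u : Fin n × Finset (Fin m) × Finset (Fin n) → Field n :=
      fun q t x => psiB q.1 (W.Mv t x) (W.Mv t x) q.2.1 q.2.2
    have hs : ∀ i A I, DomBy T u (fun t x => psiB i (W.Mv t x) (W.Mv t x) A I) :=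
      fun i A I => DomBy.self (u := u) (i, A, I)
    refine DomBy.congr ((((DomBy.sum (s := Finset.univ) fun j =>
      (hs i A I).mul_left ((hW.c1_v j).continuousOn_dd hT (eX j))).add
      (DomBy.colFlow (fun k j => (hW.c1_v j).continuousOn_dd hT (eX k)) (hs i) A I)).add
      (DomBy.pairUp (fun k β => (hW.c1_d β).continuousOn_dd hT (eX k)) (hs i) A I)).sub
      (DomBy.sum (s := Finset.univ) fun k =>
        (hs k A I).mul_left ((hW.c1_v k).continuousOn_dd hT (eX i)))) fun t ht x => ?_
    simp only [hW.evol_psiB hT ht, Finset.sum_mul]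
    ring
  · rintro ⟨i, A, I⟩ x
    by_cases hc : A.card = I.card + 1
    · simp only [psiB_eq i hc, (h0 x).psi_eq_zero i hc, mul_zero]
    · exact psiB_of_card_ne i hc

/-- The family `τ⁻¹ ∑ ω_i c_i m`, which symmetrises the system of `λ` and `ω`. -/
noncomputable def Y (A : Finset (Fin m)) (I : Finset (Fin n)) : Field n := fun s y =>
  ∑ i, colUp i (W.Mv s y) A I * (W.τ s y)⁻¹ * W.om i s y

/-- `ω` is recovered from the components `(∅, {i})` of `Y`. -/
theorem Y_singleton (h : W.τ t x ≠ 0) (i : Fin n) : Y (W := W) ∅ {i} t x = -W.om i t x := by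
  rw [Y, Finset.sum_eq_single i (fun j _ hj => by simp [colUp_apply, hj]) (by simp), colUp_apply]
  simp [ord_singleton_self, Mv, M_empty, h]

/-- The coefficients of the symmetric hyperbolic system of `λ` (index `none`) and of the
`Y_{A,I}`. -/
def coeff (W : State n m) (j : Fin n) :
    Option (Finset (Fin m) × Finset (Fin n)) → Option (Finset (Fin m) × Finset (Fin n)) → Field n
  | none, none => W.v j
  | none, some p => fun t x => -colUp j (W.Mv t x) p.1 p.2
  | some p, none => fun t x => -colUp j (W.Mv t x) p.1 p.2
  | some p, some q => fun t x => if p = q then W.v j t x else 0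

theorem IsSolution.c1_coeff (hW : W.IsSolution T) (j : Fin n) (q r) :
    IsC1 T (W.coeff j q r) := by
  rcases q with _ | p <;> rcases r with _ | q
  · exact hW.c1_v j
  · exact (hW.c1_colUp j _ _).neg
  · exact (hW.c1_colUp j _ _).neg
  · simp only [coeff]
    split_ifs
    · exact hW.c1_v j
    · exact IsC1.const 0

theorem coeff_symm (j : Fin n) (q r) (t : ℝ) (x : Space n) :
    W.coeff j q r t x = W.coeff j r q t x := by
  rcases q with _ | p <;> rcases r with _ | q
  · rfl
  · rfl
  · rfl
  · simp only [coeff, eq_comm]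

theorem IsBounded.coeff (hb : W.IsBounded T) :
    ∃ C, ∀ j q r, ∀ t ∈ Set.Icc 0 T, ∀ x, |W.coeff j q r t x| ≤ C := by
  obtain ⟨C, hC⟩ := hb.v
  obtain ⟨C', hC'⟩ := hb.M
  have h1 : ∀ t ∈ Set.Icc 0 T, ∀ x j A I, |colUp j (W.Mv t x) A I| ≤ |C'| := by
    intro t ht x j A I
    rw [colUp_apply]
    split_ifs
    · rw [abs_mul, abs_pow, abs_neg, abs_one, one_pow, one_mul]
      exact (hC' t ht x _ _).trans (le_abs_self _)
    · simp
  refine ⟨max |C| |C'|, fun j q r t ht x => ?_⟩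
  rcases q with _ | p <;> rcases r with _ | q <;> simp only [State.coeff]
  · exact (hC t ht x j).trans ((le_abs_self C).trans (le_max_left _ _))
  · rw [abs_neg]; exact (h1 t ht x j _ _).trans (le_max_right _ _)
  · rw [abs_neg]; exact (h1 t ht x j _ _).trans (le_max_right _ _)
  · split_ifs
    · exact (hC t ht x j).trans ((le_abs_self C).trans (le_max_left _ _))
    · simp

/-- Once `φ` and `ψ` vanish, `λ` and the `Y_{A,I}` solve a symmetric hyperbolic system. -/
theorem IsSolution.lam_Y_eq_zero (hW : W.IsSolution T) (hT : 0 < T) (hb : W.IsBounded T)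
    (h0 : ∀ x, W.Constraints 0 x) (hτ : ∀ t ∈ Set.Icc 0 T, ∀ x, W.τ t x ≠ 0)
    (ht : t ∈ Set.Icc 0 T) (x : Space n) (q : Option (Finset (Fin m) × Finset (Fin n))) :
    q.elim W.lam (fun p => Y (W := W) p.1 p.2) t x = 0 := by
  have hκ : ∀ A I i, IsC1 T (fun s y => colUp i (W.Mv s y) A I * (W.τ s y)⁻¹) :=
    fun A I i => (hW.c1_colUp i A I).mul (hW.c1_τ.inv hτ)
  have hY : ∀ A I, IsC1 T (Y (W := W) A I) :=
    fun A I => IsC1.sum fun i _ => (hκ A I i).mul (hW.c1_om i)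
  have hZY : ∀ t ∈ Set.Icc 0 T, ∀ x A I, Z (W := W) A I t x = Y (W := W) A I t x := by
    intro t ht x A I
    simp only [Z_eq (hτ t ht x), hW.phiB_eq_zero hT hb h0 ht, Pi.zero_apply, zero_mul, zero_div,
      Finset.sum_const_zero, add_zero, Y]
    exact Finset.sum_congr rfl fun i _ => by ring
  set u : Option (Finset (Fin m) × Finset (Fin n)) → Field n :=
    fun q => q.elim W.lam (fun p => Y (W := W) p.1 p.2) with hu
  have hom : ∀ i, DomBy T u (W.om i) := fun i =>
    ((DomBy.self (u := u) (some (∅, {i}))).const_mul (-1)).congr fun t ht x => by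
      simp only [hu, Option.elim_some, Y_singleton (hτ t ht x) i]; ring
  refine symmetric_hyperbolic_unique hT u W.coeff ?_ hW.c1_coeff coeff_symm hb.coeff
    (DomBy.uniform ?_) ?_ ht x q
  · rintro (_ | p)
    · exact hW.c1_lam
    · exact hY _ _
  · rintro (_ | ⟨A, I⟩)
    · refine DomBy.zero.congr fun t ht x => ?_
      have hdZ : ∀ j A I, W.dZ T j t x A I = dd T (eX j) (Y (W := W) A I) t x := fun j A I =>
        dd_congr (by
          filter_upwards [self_mem_nhdsWithin] with p hp using hZY p.1 hp.1 p.2 A I)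
          (hZY t ht x A I)
      simp only [hu, Option.elim_none, Fintype.sum_option, Option.elim_some, coeff,
        hW.evol_lam_ip hT ht, Finset.sum_add_distrib, ip, hdZ, Fintype.sum_prod_type, neg_mul,
        Finset.sum_neg_distrib]
      ring
    · set κ : Fin n → Field n := fun i s y => colUp i (W.Mv s y) A I * (W.τ s y)⁻¹
      have hdY : ∀ t ∈ Set.Icc 0 T, ∀ x e, dd T e (Y (W := W) A I) t x
          = ∑ i, (dd T e (κ i) t x * W.om i t x + κ i t x * dd T e (W.om i) t x) := by
        intro t ht x e
        have h1 := fun i => (hκ A I i).diffAt ht x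
        have h2 := fun i => (hW.c1_om i).diffAt ht x
        unfold Y
        rw [dd_sum hT ht fun i _ => (h1 i).mul (h2 i)]
        exact Finset.sum_congr rfl fun i _ => dd_mul hT ht (h1 i) (h2 i)
      have hevol : ∀ t ∈ Set.Icc 0 T, ∀ x i, dd T eT (W.om i) t x
            + ∑ j, W.v j t x * dd T (eX j) (W.om i) t x
          = W.om i t x * ∑ j, dd T (eX j) (W.v j) t x
            - ∑ j, W.om j t x * dd T (eX i) (W.v j) t x + W.τ t x * dd T (eX i) W.lam t x := by
        intro t ht x i
        rw [hW.evol_om_ip hT ht, hW.psiB_eq_zero hT hb h0 ht]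
        simp only [map_zero, ip, Pi.zero_apply, zero_mul, Finset.sum_const_zero]
        ring
      have d1 : DomBy T u (fun t x => ∑ i, (dd T eT (κ i) t x * W.om i t x
          + ∑ j, W.v j t x * (dd T (eX j) (κ i) t x * W.om i t x))) :=
        DomBy.sum fun i => ((hom i).mul_left ((hκ A I i).continuousOn_dd hT _)).add
          (DomBy.sum fun j => ((hom i).mul_left ((hκ A I i).continuousOn_dd hT _)).mul_left
            (hW.c1_v j).continuousOn)
      have d2 : DomBy T u (fun t x => ∑ i, κ i t x * (∑ j, dd T (eX j) (W.v j) t x * W.om i t x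
          - ∑ j, dd T (eX i) (W.v j) t x * W.om j t x)) :=
        DomBy.sum fun i => DomBy.mul_left
          ((DomBy.sum fun j => (hom i).mul_left ((hW.c1_v j).continuousOn_dd hT _)).sub
            (DomBy.sum fun j => (hom j).mul_left ((hW.c1_v j).continuousOn_dd hT _)))
          (hκ A I i).continuousOn
      refine (d1.add d2).congr fun t ht x => ?_
      -- since `κ_i τ = c_i m`, the terms in `∂λ` cancel against those of the equation of `ω`
      have hsum : ∑ j, ∑ r, W.coeff j (some (A, I)) r t x * dd T (eX j) (u r) t x
          = ∑ j, W.v j t x * dd T (eX j) (Y (W := W) A I) t x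
            - ∑ i, κ i t x * (W.τ t x * dd T (eX i) W.lam t x) := by
        rw [← Finset.sum_sub_distrib]
        refine Finset.sum_congr rfl fun j _ => ?_
        rw [Fintype.sum_option, Finset.sum_eq_single (A, I)
          (fun p _ hp => by simp [coeff, Ne.symm hp]) (by simp)]
        simp only [hu, coeff, Option.elim_none, Option.elim_some, if_true, κ]
        field_simp [hτ t ht x]
        ring
      rw [hsum]
      simp only [hu, Option.elim_some, hdY t ht x]
      have h3 : ∀ i, κ i t x * (W.τ t x * dd T (eX i) W.lam t x)
          = κ i t x * (dd T eT (W.om i) t x + ∑ j, W.v j t x * dd T (eX j) (W.om i) t x)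
            - κ i t x * (∑ j, dd T (eX j) (W.v j) t x * W.om i t x
              - ∑ j, dd T (eX i) (W.v j) t x * W.om j t x) := by
        intro i
        rw [hevol t ht x i, ← Finset.sum_mul]
        simp only [mul_comm (W.om _ t x)]
        ring
      simp only [h3, Finset.sum_sub_distrib, Finset.sum_add_distrib, mul_add, Finset.mul_sum]
      rw [Finset.sum_comm (f := fun j i => W.v j t x * (dd T (eX j) (κ i) t x * W.om i t x)),
        Finset.sum_comm (f := fun j i => W.v j t x * (κ i t x * dd T (eX j) (W.om i) t x))]
      simp only [mul_left_comm (W.v _ t x) (κ _ t x)]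
      ring
  · have hom0 : ∀ i x, W.om i 0 x = 0 := fun i x => sub_eq_zero.2 ((h0 x).momentum i)
    rintro (_ | p) x
    · have := (h0 x).energy
      simp only [hu, Option.elim_none, lam]
      linarith
    · simp [hu, Y, hom0]

theorem IsSolution.constraints (hW : W.IsSolution T) (hT : 0 < T) (hb : W.IsBounded T)
    (h0 : ∀ x, W.Constraints 0 x) (ht : t ∈ Set.Icc 0 T) (x : Space n) : W.Constraints t x := by
  have hτ := hW.τ_ne_zero hT hb fun x => (h0 x).τ_ne_zero
  have huniq := fun q => hW.lam_Y_eq_zero hT hb h0 hτ ht x q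
  refine ⟨hτ t ht x, fun i => ?_, ?_, fun A I hc _ => ?_⟩
  · have h1 := huniq (some (∅, {i}))
    rw [Option.elim_some, Y_singleton (hτ t ht x), neg_eq_zero] at h1
    exact sub_eq_zero.1 h1
  · have h1 := huniq none
    rw [Option.elim_none, lam] at h1
    linarith
  · rw [← M_of_card_eq W hc]
    have h1 := Mv_eq_of_phi_eq_zero (hτ t ht x) (fun α A I hc => by
      rw [phi_eq α hc, hW.phiB_eq_zero hT hb h0 ht, Pi.zero_apply, Pi.zero_apply, mul_zero]) A I hc
    rwa [minorFamily, dif_pos hc] at h1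

end State

end ExtremalSurface

theorem mainTheorem2 (n m : ℕ) (T : ℝ) (hT : 0 < T) (W : ExtremalSurface.State n m)
    (hW : W.IsSolution T) :
    (∀ t ∈ Set.Icc 0 T, ∀ x, W.ConstraintEvolution T t x) ∧
      (W.IsBounded T → (∀ x, W.Constraints 0 x) →
        ∀ t ∈ Set.Icc 0 T, ∀ x, W.Constraints t x) :=
  ⟨fun _ ht _ => hW.constraintEvolution hT ht,
    fun hb h0 _ ht x => hW.constraints hT hb h0 ht x⟩
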